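/- Fix an integer $k\ge 1$. All residues are mod $k+1$; the residue of the cell $(i,j)$ (row $i$, column $j$) is $j-i$. A partition $\lambda$ is $k$-bounded if $\lambda_1\le k$; let $\mathcal P^k$ be the set of these. A $(k+1)$-core is a partition none of whose cells has hook length $k+1$; let $\mathfrak p$ be the bijection from $(k+1)$-cores to $\mathcal P^k$ that deletes from a core all cells of hook length $>k$ and reads off the row lengths of what is left, and let $\mathfrak c=\mathfrak p^{-1}$. Compositions $\alpha=(\alpha_1,\alpha_2,\dots)$ may have zero parts and have finitely many nonzero parts. A $k$-tableau of weight $\alpha$ and shape a core $\gamma$, where $|\alpha|=|\mathfrak p(\gamma)|$, is a semistandard filling of $\gamma$ in which, for each $x$, the cells containing $x$ have exactly $\alpha_x$ distinct residues. The dual $k$-Schur function $\mathfrak S^{(k)}_\lambda$ is $\sum_T x^{w(T)}$ over all $k$-tableaux $T$ of shape $\mathfrak c(\lambda)$, where $w(T)$ denotes the weight of $T$. Let $\tilde S_{k+1}$ be the affine symmetric group with generators $s_0,\dots,s_k$ and length $\ell$. The nil Hecke algebra is the free $\mathbb Z$-module with basis $\{A_w : w\in\tilde S_{k+1}\}$ and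 product determined, with $A_i=A_{s_i}$, by $A_iA_u=A_{s_iu}$ if $\ell(s_iu)>\ell(u)$ and $A_iA_u=-A_u$ otherwise. A word in the residues is cyclically decreasing if it has no repeated letter and $j$ precedes $j-1$ whenever both occur; an element $w$ is cyclically decreasing if it is the product $s_{i_1}\cdots s_{i_\ell}$ of such a word $i_1\cdots i_\ell$. Put $h_r=\sum A_w$ over the cyclically decreasing $w$ of length $r$, and $$G^{(k)}_w=\sum_\alpha \big(\text{coefficient of }A_w\text{ in }\cdots h_{\alpha_3}h_{\alpha_2}h_{\alpha_1}\big)\,x^\alpha .$$ For $\lambda\in\mathcal P^k$ let $w_\lambda$ be the minimal length representative of a coset in $\tilde S_{k+1}/\langle s_1,\dots,s_k\rangle$ such that, for a reduced word $i_\ell\cdots i_1$ of $w_\lambda$, successively adding to the empty shape all addable corners of residue $i_1$, then all of residue $i_2$, ..., then all of residue $i_\ell$, gives $\mathfrak c(\lambda)$. Put $G^{(k)}_\lambda=G^{(k)}_{w_\lambda}$, the affine Grothendieck polynomial. Let $\hat\Lambda$ be the set of symmetric formal power series in $x_1,x_2,\dots$ over $\mathbb Z$ (the completion by degree of the ring $\Lambda$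 of symmetric functions), and let $\hat{\mathcal I}^k$ be the closed $\mathbb Z$-span of the monomial symmetric functions $m_\mu$ with $\mu_1>k$ (the completion of $\mathcal I^k=\langle m_\mu:\mu_1>k\rangle$), where convergence is coefficientwise. Then: 1. There are integers $a^k_{\lambda\mu}$ such that, for every $\lambda\in\mathcal P^k$, as formal power series, $$G^{(k)}_\lambda=\mathfrak S^{(k)}_\lambda+\sum_{\mu\in\mathcal P^k,\ |\mu|>|\lambda|}a^k_{\lambda\mu}\,\mathfrak S^{(k)}_\mu .$$ 2. For every $\lambda\in\mathcal P^k$, the lowest degree in which $G^{(k)}_\lambda$ has a nonzero term is $|\lambda|$, and its homogeneous component of degree $|\lambda|$ is $\mathfrak S^{(k)}_\lambda$. 3. $\{G^{(k)}_\lambda\}_{\lambda\in\mathcal P^k}$ is a (topological) basis of $\hat\Lambda/\hat{\mathcal I}^k$: each $G^{(k)}_\lambda$ lies in $\hat\Lambda$, the sum $\sum_\lambda c_\lambda G^{(k)}_\lambda$ converges for every integer family $(c_\lambda)_{\lambda\in\mathcal P^k}$, and for every $f\in\hat\Lambda$ there is exactly one integer family $(c_\lambda)_{\lambda\in\mathcal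 P^k}$ with $f\equiv\sum_\lambda c_\lambda G^{(k)}_\lambda \pmod{\hat{\mathcal I}^k}$. -/

import Mathlib

open scoped MvPowerSeries.WithPiTopology

noncomputable section

namespace AffineGrothendieck

/-! ### Partitions, cores and residues

A partition is a `YoungDiagram`; its parts are `rowLen 0 ≥ rowLen 1 ≥ ⋯`, and its degree is `card`.
Cells are pairs `(i, j)` (row, column), with both coordinates starting at `0`. -/

/-- The `k`-bounded partitions: all parts are at most `k`. -/
def BoundedPartition (k : ℕ) : Type := {l : YoungDiagram // l.rowLen 0 ≤ k}

/-- The degree of a `k`-bounded partition. -/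
def BoundedPartition.size {k : ℕ} (l : BoundedPartition k) : ℕ := l.1.card

/-- The hook length of the cell `c` of `g`: the cells of its row and column that are weakly
beyond it, with `c` itself counted once. -/
def hookLength (g : YoungDiagram) (c : ℕ × ℕ) : ℕ :=
  (g.rowLen c.1 - c.2) + (g.colLen c.2 - c.1) - 1

/-- A `p`-core has no cell of hook length `p`. -/
def IsCore (p : ℕ) (g : YoungDiagram) : Prop := ∀ c ∈ g, hookLength g c ≠ p

/-- The `(k+1)`-residue `j - i mod k+1` of the cell `(i, j)`. -/
def residue (k : ℕ) (c : ℕ × ℕ) : ZMod (k + 1) := (c.2 : ZMod (k + 1)) - (c.1 : ZMod (k + 1))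

/-- The cells of `g` whose hook length is at most `k`. -/
def smallHookCells (k : ℕ) (g : YoungDiagram) : Finset (ℕ × ℕ) :=
  g.cells.filter (fun c => hookLength g c ≤ k)

/-- The row lengths of `𝔭(g)`: delete from `g` all the cells with hook length larger than `k`
and count what is left in each row. -/
def boundedRows (k : ℕ) (g : YoungDiagram) (i : ℕ) : ℕ :=
  ((smallHookCells k g).filter (fun c => c.1 = i)).card

/-- The core `𝔠(l) = 𝔭⁻¹(l)`: the `(k+1)`-core whose image under `𝔭` is `l`. -/
def coreOf (k : ℕ) (l : BoundedPartition k) : YoungDiagram :=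
  Function.invFunOn (boundedRows k) {g | IsCore (k + 1) g} l.1.rowLen

/-! ### Dual `k`-Schur functions

Formal power series in the variables `x₀, x₁, x₂, …` are elements of `MvPowerSeries ℕ ℤ`, and
the weights (compositions, where zero parts are allowed) are finitely supported maps `ℕ →₀ ℕ`. -/

/-- A `k`-tableau of weight `a` (and of shape a core `g`): a semistandard filling of `g`, where
`a` has degree `|𝔭(g)|`, such that the cells that contain the letter `x` have exactly `a x`
distinct residues, for each letter `x`. -/
def IsKTableau (k : ℕ) {g : YoungDiagram} (T : SemistandardYoungTableau g) (a : ℕ →₀ ℕ) : Prop :=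
  a.degree = (smallHookCells k g).card ∧
    ∀ x : ℕ, ((g.cells.filter (fun c => T c.1 c.2 = x)).image (residue k)).card = a x

/-- The dual `k`-Schur function `𝔖_l^{(k)}`: the weight generating function of the `k`-tableaux
of shape `𝔠(l)`. -/
def dualKSchur (k : ℕ) (l : BoundedPartition k) : MvPowerSeries ℕ ℤ :=
  fun a => (Nat.card {T : SemistandardYoungTableau (coreOf k l) // IsKTableau k T a} : ℤ)

/-! ### The affine symmetric group -/

/-- The Coxeter matrix of the affine Weyl group of type `A_k` (affine type), with generators
indexed by the residues mod `k+1`. For `k = 1` there is no relation between the two generators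
(the entry `0` stands for `∞`). -/
def affineMatrix (k : ℕ) : CoxeterMatrix (ZMod (k + 1)) where
  M := Matrix.of fun i j =>
    if i = j then 1 else if k = 1 then 0 else if i = j + 1 ∨ j = i + 1 then 3 else 2
  isSymm := by
    ext i j
    simp only [Matrix.transpose_apply, Matrix.of_apply, eq_comm (a := j) (b := i),
      or_comm (a := j = i + 1)]
  diagonal := by simp
  off_diagonal := by
    intro i j h
    simp only [Matrix.of_apply, if_neg h]
    split_ifs <;> decide

/-- The affine symmetric group `S̃_{k+1}`. -/
abbrev AffSym (k : ℕ) : Type := (affineMatrix k).Group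

/-- The affine symmetric group with its generators `s_i`. -/
abbrev cox (k : ℕ) : CoxeterSystem (affineMatrix k) (AffSym k) := (affineMatrix k).toCoxeterSystem

/-- A reduced word of `w`. -/
def reducedWord (k : ℕ) (w : AffSym k) : List (ZMod (k + 1)) :=
  Classical.choose ((cox k).exists_isReduced w)

theorem reducedWord_isReduced (k : ℕ) (w : AffSym k) : (cox k).IsReduced (reducedWord k w) :=
  (Classical.choose_spec ((cox k).exists_isReduced w)).1

theorem wordProd_reducedWord (k : ℕ) (w : AffSym k) : (cox k).wordProd (reducedWord k w) = w :=
  (Classical.choose_spec ((cox k).exists_isReduced w)).2.symm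

/-- The affine Grassmannian elements: minimal length representatives of the cosets `w S_{k+1}`
of the finite symmetric group, which is generated by the `s_i` with `i ≠ 0`. -/
def IsGrassmannian (k : ℕ) (w : AffSym k) : Prop :=
  ∀ v ∈ Subgroup.closure {s | ∃ i : ZMod (k + 1), i ≠ 0 ∧ s = (cox k).simple i},
    (cox k).length w ≤ (cox k).length (w * v)

/-- `c` is an addable corner of `g`. -/
def IsAddable (g : YoungDiagram) (c : ℕ × ℕ) : Prop :=
  c ∉ g ∧ (c.1 = 0 ∨ (c.1 - 1, c.2) ∈ g) ∧ (c.2 = 0 ∨ (c.1, c.2 - 1) ∈ g)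

instance (g : YoungDiagram) : DecidablePred (IsAddable g) :=
  fun _ => inferInstanceAs (Decidable (_ ∧ _))

/-- The operator `𝔰_i` on shapes: add all the addable corners of residue `i`. -/
def addCorners (k : ℕ) (i : ZMod (k + 1)) (g : YoungDiagram) : YoungDiagram where
  cells := g.cells ∪
    (Finset.range (g.colLen 0 + 1) ×ˢ Finset.range (g.rowLen 0 + 1)).filter
      (fun c => IsAddable g c ∧ residue k c = i)
  isLowerSet := by
    rintro ⟨a, b⟩ ⟨a', b'⟩ hle hmem
    obtain ⟨h1, h2⟩ : a' ≤ a ∧ b' ≤ b := hle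
    simp only [Finset.coe_union, Set.mem_union, Finset.mem_coe, YoungDiagram.mem_cells] at hmem ⊢
    rcases hmem with hmem | hmem
    · exact Or.inl (g.up_left_mem h1 h2 hmem)
    · have hadd := (Finset.mem_filter.1 hmem).2.1
      obtain ⟨-, hr, hc⟩ := hadd
      simp only at hr hc
      rcases Nat.lt_or_ge a' a with hlt | hge
      · rcases hr with hr | hr
        · omega
        · exact Or.inl (g.up_left_mem (by omega) h2 hr)
      · rcases Nat.lt_or_ge b' b with hlt' | hge'
        · rcases hc with hc | hc
          · omega
          · exact Or.inl (g.up_left_mem h1 (by omega) hc)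
        · have e1 : a' = a := by omega
          have e2 : b' = b := by omega
          subst e1 e2
          exact Or.inr hmem

theorem mem_addCorners (k : ℕ) (i : ZMod (k + 1)) (g : YoungDiagram) (c : ℕ × ℕ) :
    c ∈ addCorners k i g ↔ c ∈ g ∨ (IsAddable g c ∧ residue k c = i) := by
  rw [← YoungDiagram.mem_cells]
  simp only [addCorners, Finset.mem_union, YoungDiagram.mem_cells, Finset.mem_filter,
    Finset.mem_product, Finset.mem_range]
  refine or_congr_right (and_iff_right_of_imp ?_)
  rintro ⟨⟨-, hr, hc⟩, -⟩
  constructor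
  · rcases hr with hr | hr
    · omega
    · have := YoungDiagram.mem_iff_lt_colLen.1 (g.up_left_mem le_rfl (Nat.zero_le _) hr)
      omega
  · rcases hc with hc | hc
    · omega
    · have := YoungDiagram.mem_iff_lt_rowLen.1 (g.up_left_mem (Nat.zero_le _) le_rfl hc)
      omega

/-- The map `𝔱`: apply `𝔰_{i_ℓ} ⋯ 𝔰_{i_1}` to the empty shape, where `i_ℓ ⋯ i_1` is a reduced
word of `w`. -/
def shapeOf (k : ℕ) (w : AffSym k) : YoungDiagram :=
  (reducedWord k w).foldr (addCorners k) ⊥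

/-- `w_l = 𝔱⁻¹(𝔠(l))`: the affine Grassmannian element that corresponds to `l`. -/
def grassOf (k : ℕ) (l : BoundedPartition k) : AffSym k :=
  Function.invFunOn (shapeOf k) {w | IsGrassmannian k w} (coreOf k l)

/-! ### The nil Hecke algebra and affine stable Grothendieck polynomials

The nil Hecke algebra is free over `ℤ` with basis `A_w`. It is realised inside the endomorphism
ring of the free module `AffSym k →₀ ℤ` on this basis, an element acting by left multiplication;
the element itself is recovered as its value at `A_1`. -/

/-- Left multiplication by the generator `A_i`: `A_i A_u` is `A_{s_i u}` if the length goes up,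
and `-A_u` if it goes down. -/
def nilHeckeGen (k : ℕ) (i : ZMod (k + 1)) : Module.End ℤ (AffSym k →₀ ℤ) :=
  Finsupp.linearCombination ℤ fun u =>
    if (cox k).length u < (cox k).length ((cox k).simple i * u) then
      Finsupp.single ((cox k).simple i * u) 1
    else -Finsupp.single u 1

/-- (Left multiplication by) `A_w = A_{i_1} ⋯ A_{i_ℓ}`, where `i_1 ⋯ i_ℓ` is a reduced word of
`w`. -/
def nilHeckeElt (k : ℕ) (w : AffSym k) : Module.End ℤ (AffSym k →₀ ℤ) :=
  ((reducedWord k w).map (nilHeckeGen k)).prod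

/-- The coefficient `⟨x, A_w⟩` of `A_w` in the element `x` of the nil Hecke algebra. -/
def nilHeckeCoeff (k : ℕ) (x : Module.End ℤ (AffSym k →₀ ℤ)) (w : AffSym k) : ℤ :=
  x (Finsupp.single 1 1) w

theorem prod_nilHeckeGen_apply_one (k : ℕ) (l : List (ZMod (k + 1))) (hl : (cox k).IsReduced l) :
    (l.map (nilHeckeGen k)).prod (Finsupp.single 1 1) = Finsupp.single ((cox k).wordProd l) 1 := by
  induction l with
  | nil => simp
  | cons i l ih =>
    have hl' : (cox k).IsReduced l := by simpa using hl.drop 1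
    rw [List.map_cons, List.prod_cons, Module.End.mul_apply, ih hl', nilHeckeGen,
      Finsupp.linearCombination_single, one_smul, if_pos, CoxeterSystem.wordProd_cons]
    have h1 := hl.eq
    have h2 := hl'.eq
    rw [CoxeterSystem.wordProd_cons, List.length_cons] at h1
    omega

/-- The value at `A_1` of left multiplication by `A_w` is `A_w`. -/
theorem nilHeckeElt_apply_one (k : ℕ) (w : AffSym k) :
    nilHeckeElt k w (Finsupp.single 1 1) = Finsupp.single w 1 := by
  rw [nilHeckeElt, prod_nilHeckeGen_apply_one k _ (reducedWord_isReduced k w),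
    wordProd_reducedWord]

/-- A word in the residues is cyclically decreasing if no letter is repeated and `j` precedes
`j - 1` whenever both occur. -/
def IsCycDecWord (k : ℕ) (l : List (ZMod (k + 1))) : Prop :=
  l.Nodup ∧ ∀ j ∈ l, j - 1 ∈ l → l.idxOf j < l.idxOf (j - 1)

/-- The cyclically decreasing elements of length `r`. -/
def cycDec (k r : ℕ) : Set (AffSym k) :=
  {w | (∃ l, IsCycDecWord k l ∧ (cox k).wordProd l = w) ∧ (cox k).length w = r}

theorem cycDec_finite (k r : ℕ) : (cycDec k r).Finite := by
  have hfin : {l : List (ZMod (k + 1)) | l.Nodup}.Finite := by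
    refine (List.finite_length_le (ZMod (k + 1)) (Fintype.card (ZMod (k + 1)))).subset ?_
    intro l hl
    exact List.Nodup.length_le_card hl
  refine (hfin.image (cox k).wordProd).subset ?_
  rintro w ⟨⟨l, hl, rfl⟩, -⟩
  exact ⟨l, hl.1, rfl⟩

/-- The element `h_r` of the nil Hecke algebra: the sum of the `A_w` over all the cyclically
decreasing `w` of length `r`. -/
def nilHeckeH (k r : ℕ) : Module.End ℤ (AffSym k →₀ ℤ) :=
  ∑ w ∈ (cycDec_finite k r).toFinset, nilHeckeElt k w

/-- The product `⋯ h_{a 2} h_{a 1} h_{a 0}`, up to the last nonzero part of `a`. -/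
def nilHeckeProd (k : ℕ) (a : ℕ →₀ ℕ) : Module.End ℤ (AffSym k →₀ ℤ) :=
  ((List.range (a.support.sup (· + 1))).reverse.map fun x => nilHeckeH k (a x)).prod

/-- The affine stable Grothendieck polynomial `G_w^{(k)}`: the coefficient of `x^a` is the
coefficient of `A_w` in `⋯ h_{a 2} h_{a 1} h_{a 0}`. -/
def affineStableGrothendieck (k : ℕ) (w : AffSym k) : MvPowerSeries ℕ ℤ :=
  fun a => nilHeckeCoeff k (nilHeckeProd k a) w

/-- The affine Grothendieck polynomial `G_l^{(k)} = G_{w_l}^{(k)}` of a `k`-bounded partition. -/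
def affineGrothendieck (k : ℕ) (l : BoundedPartition k) : MvPowerSeries ℕ ℤ :=
  affineStableGrothendieck k (grassOf k l)

/-! ### Symmetric functions -/

/-- The symmetric formal power series with integer coefficients in `x₀, x₁, …`, that is, the
completion by degree of the ring `Λ` of symmetric functions. -/
def symmSeries : Submodule ℤ (MvPowerSeries ℕ ℤ) where
  carrier := {f | ∀ (s : Equiv.Perm ℕ) (a : ℕ →₀ ℕ),
    MvPowerSeries.coeff (a.equivMapDomain s) f = MvPowerSeries.coeff a f}
  zero_mem' := by intro s a; simp
  add_mem' := by
    intro f g hf hg s a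
    rw [map_add, map_add, hf s a, hg s a]
  smul_mem' := by
    intro c f hf s a
    rw [map_zsmul, map_zsmul, hf s a]

/-- The monomial symmetric function `m_u`: the sum of all the monomials whose nonzero exponents
are, up to order, the parts of `u`. -/
def monomialSymm (u : YoungDiagram) : MvPowerSeries ℕ ℤ :=
  fun a => if a.support.val.map a = (u.rowLens : Multiset ℕ) then 1 else 0

/-- The completion of the ideal `I^k = ⟨m_u : u_1 > k⟩`: the closed span of the `m_u` with
`u_1 > k`, in the topology of coefficientwise convergence. -/
def idealCompletion (k : ℕ) : Set (MvPowerSeries ℕ ℤ) :=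
  closure (Submodule.span ℤ {f | ∃ u : YoungDiagram, k < u.rowLen 0 ∧ f = monomialSymm u} :
    Set (MvPowerSeries ℕ ℤ))

end AffineGrothendieck

end

/-! A `(k+1)`-core is encoded by its abacus, a level function `c : ℤ → ℤ` with `c (j + (k + 1)) = c
j + 1` whose negative positions are the beads `g_r - r - 1` of the diagram. The generator `s_i`
exchanges the values at `j - 1` and `j` for all `j ≡ i`. The sign of `c j - c (j - 1)` decides
whether this adds corners, removes corners or does nothing. The number of cells with hook length at
most `k` is an inversion number of `c` that changes by one at each effective exchange, so it is the
length of the minimal coset representative attached to the core (`Rep.card_smallHookCells`,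
`isGrassmannian_iff`).

Killing the non-Grassmannian `A_w` projects the nil Hecke algebra onto the free module on level
functions. There `A_i` acts by the exchange, by `-1` or by `0`, according to the same sign
(`proj_nilHeckeGen`). The coefficients of `G_λ` become entries of products of the operators `opH r`,
and three facts about these entries give the theorem.

Symmetry: the `opH r` commute (`opH_mul_comm`). A cyclically decreasing operator sends a carrier
once round the circle, which trades with each position by `min` and `max`. The generating function
of two successive operators is therefore the trace of a twisted product of transfer matrices. A
Yang–Baxter equation provides an exchange matrix that interchanges the two parameters inside the
trace.

Lowest degree: each letter raises the degree of a core by at most one. Hence coefficients vanish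
below degree `|λ|`, and in degree `|λ|` all signs are `+1`, so that a coefficient counts the
sequences of residue sets that build the core. These sequences are the `k`-tableaux
(`coeff_dualKSchur`).

Triangularity: deleting the first row of a core `g` leaves a core `tailD g` (moved up), and `g`
arises from it by a horizontal strip with exactly as many residues as the first part of `λ`. Peeling
rows shows that for `|μ| = |λ|` the coefficient of `x^μ` in `G_λ` is `1` for `μ = λ`, and vanishes
unless `μ` is lexicographically at most `λ` (`numSeq_triangular`).

Exponents above `k` never occur, because a proper set of residues has at most `k` elements.
Symmetric series modulo the completed ideal are determined by their coefficients at `k`-bounded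
partitions. Both expansions are thus integral unitriangular systems over a well-founded order,
solved by `existsUnique_triangular`. -/

noncomputable section

namespace AffineGrothendieck

/-! ### Beads of a Young diagram -/

/-- The integer `j` is a bead of `g` if it is of the form `g_r - r - 1`. -/
def bead (g : YoungDiagram) (j : ℤ) : Prop := ∃ r : ℕ, (g.rowLen r : ℤ) - r - 1 = j

theorem rowLen_sub_strictAnti (g : YoungDiagram) :
    StrictAnti fun r : ℕ => (g.rowLen r : ℤ) - r - 1 := by
  intro a b hab
  have := g.rowLen_anti a b hab.le
  simp only
  omega

theorem bead_rowLen (g : YoungDiagram) (r : ℕ) : bead g ((g.rowLen r : ℤ) - r - 1) := ⟨r, rfl⟩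

/-- A strictly decreasing sequence is determined by its range, so the bead set recovers all row
lengths. -/
theorem eq_of_bead_iff {g h : YoungDiagram} (H : ∀ j, bead g j ↔ bead h j) : g = h := by
  have h1 : (fun r : ℕ => OrderDual.toDual ((g.rowLen r : ℤ) - r - 1)) =
      fun r : ℕ => OrderDual.toDual ((h.rowLen r : ℤ) - r - 1) := by
    refine (StrictMono.range_inj (rowLen_sub_strictAnti g).dual_right
      (rowLen_sub_strictAnti h).dual_right).1 ?_
    ext j
    exact H j
  ext ⟨r, s⟩
  have h2 : (g.rowLen r : ℤ) - r - 1 = (h.rowLen r : ℤ) - r - 1 := congrFun h1 r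
  rw [YoungDiagram.mem_cells, YoungDiagram.mem_cells, YoungDiagram.mem_iff_lt_rowLen,
    YoungDiagram.mem_iff_lt_rowLen]
  omega

/-- The boundary path has one step for each integer: the vertical steps at row ends are the beads,
the horizontal steps at column feet are the gaps. The gap `j` belongs to column `j + r`, where `r`
is the number of beads beyond `j`. -/
theorem not_bead_iff {g : YoungDiagram} {j : ℤ} :
    ¬ bead g j ↔ ∃ s : ℕ, (s : ℤ) - g.colLen s = j := by
  classical
  constructor
  · intro hj
    have hex : ∃ r : ℕ, (g.rowLen r : ℤ) ≤ j + r + 1 := by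
      refine ⟨((g.rowLen 0 : ℤ) - j - 1).toNat, ?_⟩
      have := g.rowLen_anti 0 ((g.rowLen 0 : ℤ) - j - 1).toNat (Nat.zero_le _)
      omega
    obtain ⟨hr, hmin⟩ := And.intro (Nat.find_spec hex) (fun m => Nat.find_min (m := m) hex)
    set r := Nat.find hex
    have hne : (g.rowLen r : ℤ) - r - 1 ≠ j := fun h => hj ⟨r, h⟩
    refine ⟨(j + r).toNat, ?_⟩
    have h1 : g.colLen (j + r).toNat = r := by
      apply le_antisymm
      · by_contra hlt
        have := YoungDiagram.mem_iff_lt_colLen.2 (not_le.1 hlt)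
        rw [YoungDiagram.mem_iff_lt_rowLen] at this
        omega
      · rcases Nat.eq_zero_or_pos r with h0 | h0
        · omega
        · have h2 := hmin (r - 1) (by omega)
          have h3 : (r - 1, (j + r).toNat) ∈ g := by
            rw [YoungDiagram.mem_iff_lt_rowLen]
            omega
          rw [YoungDiagram.mem_iff_lt_colLen] at h3
          omega
    rw [h1]
    omega
  · rintro ⟨s, hs⟩ ⟨r, hr⟩
    rcases lt_or_ge s (g.rowLen r) with h | h
    · have h2 := YoungDiagram.mem_iff_lt_colLen.1 (YoungDiagram.mem_iff_lt_rowLen.2 h)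
      omega
    · have h2 : ¬ r < g.colLen s := fun h' => by
        have := YoungDiagram.mem_iff_lt_rowLen.1 (YoungDiagram.mem_iff_lt_colLen.2 h')
        omega
      omega

theorem bead_of_lt (g : YoungDiagram) {j : ℤ} (hj : j < -(g.colLen 0 : ℤ)) : bead g j := by
  by_contra h
  obtain ⟨s, hs⟩ := not_bead_iff.1 h
  have := g.colLen_anti 0 s (Nat.zero_le _)
  omega

theorem not_bead_of_le (g : YoungDiagram) {j : ℤ} (hj : (g.rowLen 0 : ℤ) ≤ j) : ¬ bead g j := by
  rintro ⟨r, hr⟩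
  have := g.rowLen_anti 0 r (Nat.zero_le _)
  omega

theorem bead_bot {j : ℤ} : bead ⊥ j ↔ j < 0 := by
  have h0 : ∀ r, (⊥ : YoungDiagram).rowLen r = 0 := by
    intro r
    by_contra h
    exact YoungDiagram.notMem_bot _ (YoungDiagram.mem_iff_lt_rowLen.2 (Nat.pos_of_ne_zero h))
  constructor
  · rintro ⟨r, hr⟩
    rw [h0] at hr
    omega
  · intro h
    exact ⟨(-j - 1).toNat, by rw [h0]; omega⟩

theorem residue_eq (k r s : ℕ) : residue k (r, s) = (((s : ℤ) - r : ℤ) : ZMod (k + 1)) := by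
  simp [residue]

/-! ### Adding and removing corners -/

theorem isAddable_iff {g : YoungDiagram} {r s : ℕ} :
    IsAddable g (r, s) ↔ s = g.rowLen r ∧ ¬ bead g ((g.rowLen r : ℤ) - r) := by
  simp only [IsAddable, YoungDiagram.mem_iff_lt_rowLen]
  constructor
  · rintro ⟨h1, h2, h3⟩
    have hs : s = g.rowLen r := by omega
    refine ⟨hs, ?_⟩
    rintro ⟨r', hr'⟩
    have hlt : r' < r := by
      have := (rowLen_sub_strictAnti g).lt_iff_gt (a := r) (b := r')
      omega
    have := g.rowLen_anti r' (r - 1) (by omega)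
    rcases h2 with h2 | h2 <;> omega
  · rintro ⟨rfl, h2⟩
    refine ⟨by omega, ?_, by omega⟩
    rcases Nat.eq_zero_or_pos r with h0 | h0
    · exact Or.inl h0
    · right
      by_contra h
      have h3 := g.rowLen_anti (r - 1) r (by omega)
      exact h2 ⟨r - 1, by omega⟩

theorem eq_of_lt_iff {a b : ℕ} (h : ∀ j, j < a ↔ j < b) : a = b := by
  have h1 := h a
  have h2 := h b
  omega

open Classical in
theorem rowLen_addCorners (k : ℕ) (i : ZMod (k + 1)) (g : YoungDiagram) (r : ℕ) :
    (addCorners k i g).rowLen r = g.rowLen r +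
      if ¬ bead g ((g.rowLen r : ℤ) - r) ∧ (((g.rowLen r : ℤ) - r : ℤ) : ZMod (k + 1)) = i
        then 1 else 0 := by
  apply eq_of_lt_iff
  intro j
  rw [← YoungDiagram.mem_iff_lt_rowLen, mem_addCorners, YoungDiagram.mem_iff_lt_rowLen,
    isAddable_iff, residue_eq]
  split_ifs with h
  · constructor
    · rintro (h1 | ⟨⟨h1, -⟩, -⟩) <;> omega
    · intro h1
      rcases Nat.lt_or_ge j (g.rowLen r) with h2 | h2
      · exact Or.inl h2
      · have : j = g.rowLen r := by omega
        subst this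
        exact Or.inr ⟨⟨rfl, h.1⟩, h.2⟩
  · constructor
    · rintro (h1 | ⟨⟨h1, h2⟩, h3⟩)
      · omega
      · subst h1
        exact absurd ⟨h2, h3⟩ h
    · intro h1
      exact Or.inl (by omega)

theorem intCast_ne_add_one (k : ℕ) [NeZero k] (j : ℤ) :
    ((j + 1 : ℤ) : ZMod (k + 1)) ≠ (j : ZMod (k + 1)) := by
  have : Fact (1 < k + 1) := ⟨by have := NeZero.pos k; omega⟩
  simp

/-- Adding a cell to a row moves its bead one place to the right. Since `k > 0`, the pairs `(j - 1,
j)` with `j ≡ i` are disjoint, so each pair is sorted independently, with its bead on the right. -/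
theorem bead_addCorners (k : ℕ) [NeZero k] (i : ZMod (k + 1)) (g : YoungDiagram) (j : ℤ) :
    bead (addCorners k i g) j ↔
      (if ((j : ℤ) : ZMod (k + 1)) = i then bead g j ∨ bead g (j - 1)
      else if ((j + 1 : ℤ) : ZMod (k + 1)) = i then bead g j ∧ bead g (j + 1) else bead g j) := by
  classical
  have key : bead (addCorners k i g) j ↔
      (bead g j ∧ ¬ (¬ bead g (j + 1) ∧ ((j + 1 : ℤ) : ZMod (k + 1)) = i)) ∨
        (bead g (j - 1) ∧ ¬ bead g j ∧ ((j : ℤ) : ZMod (k + 1)) = i) := by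
    constructor
    · rintro ⟨r, hr⟩
      rw [rowLen_addCorners] at hr
      split_ifs at hr with h
      · right
        have e : (g.rowLen r : ℤ) - r = j := by push_cast at hr; omega
        rw [e] at h
        exact ⟨⟨r, by omega⟩, h⟩
      · left
        have e : (g.rowLen r : ℤ) - r = j + 1 := by push_cast at hr; omega
        rw [e] at h
        exact ⟨⟨r, by omega⟩, h⟩
    · rintro (⟨⟨r, hr⟩, h⟩ | ⟨⟨r, hr⟩, h⟩)
      · refine ⟨r, ?_⟩
        rw [rowLen_addCorners, if_neg]
        · push_cast; omega
        · rw [show (g.rowLen r : ℤ) - r = j + 1 by omega]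
          exact h
      · refine ⟨r, ?_⟩
        rw [rowLen_addCorners, if_pos]
        · push_cast; omega
        · rw [show (g.rowLen r : ℤ) - r = j by omega]
          exact h
  rw [key]
  have hne := intCast_ne_add_one k j
  split_ifs with h1 h2
  · have h2 : ((j + 1 : ℤ) : ZMod (k + 1)) ≠ i := h1 ▸ hne
    tauto
  · tauto
  · tauto

/-- `c` is a removable corner of `g`. -/
def IsRemovable (g : YoungDiagram) (c : ℕ × ℕ) : Prop :=
  c ∈ g ∧ (c.1 + 1, c.2) ∉ g ∧ (c.1, c.2 + 1) ∉ g

open Classical in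
/-- Remove all the removable corners of residue `i`. -/
def removeCorners (k : ℕ) (i : ZMod (k + 1)) (g : YoungDiagram) : YoungDiagram where
  cells := g.cells.filter fun c => ¬ (IsRemovable g c ∧ residue k c = i)
  isLowerSet := by
    rintro ⟨a, b⟩ ⟨a', b'⟩ hle hmem
    obtain ⟨h1, h2⟩ : a' ≤ a ∧ b' ≤ b := hle
    simp only [Finset.coe_filter, Set.mem_ofPred_eq, YoungDiagram.mem_cells] at hmem ⊢
    refine ⟨g.up_left_mem h1 h2 hmem.1, ?_⟩
    rintro ⟨⟨h3, h4, h5⟩, h6⟩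
    rcases Nat.lt_or_ge a' a with h | h
    · exact h4 (g.up_left_mem h h2 hmem.1)
    · rcases Nat.lt_or_ge b' b with h' | h'
      · exact h5 (g.up_left_mem h1 h' hmem.1)
      · obtain rfl : a' = a := le_antisymm h1 h
        obtain rfl : b' = b := le_antisymm h2 h'
        exact hmem.2 ⟨⟨h3, h4, h5⟩, h6⟩

theorem mem_removeCorners {k : ℕ} {i : ZMod (k + 1)} {g : YoungDiagram} {c : ℕ × ℕ} :
    c ∈ removeCorners k i g ↔ c ∈ g ∧ ¬ (IsRemovable g c ∧ residue k c = i) := by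
  rw [← YoungDiagram.mem_cells]
  simp [removeCorners]

theorem removeCorners_le (k : ℕ) (i : ZMod (k + 1)) (g : YoungDiagram) :
    removeCorners k i g ≤ g := fun _ hc => (mem_removeCorners.1 hc).1

theorem le_addCorners (k : ℕ) (i : ZMod (k + 1)) (g : YoungDiagram) :
    g ≤ addCorners k i g := fun _ hc => (mem_addCorners _ _ _ _).2 (Or.inl hc)

theorem isRemovable_iff {g : YoungDiagram} {r s : ℕ} :
    IsRemovable g (r, s) ↔ s + 1 = g.rowLen r ∧ ¬ bead g ((g.rowLen r : ℤ) - r - 2) := by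
  simp only [IsRemovable, YoungDiagram.mem_iff_lt_rowLen]
  constructor
  · rintro ⟨h1, h2, h3⟩
    refine ⟨by omega, ?_⟩
    rintro ⟨r', hr'⟩
    have hlt : r < r' := by
      have := (rowLen_sub_strictAnti g).lt_iff_gt (a := r') (b := r)
      omega
    have := g.rowLen_anti (r + 1) r' (by omega)
    omega
  · rintro ⟨h1, h2⟩
    refine ⟨by omega, ?_, by omega⟩
    intro h
    have h3 := g.rowLen_anti r (r + 1) (by omega)
    exact h2 ⟨r + 1, by push_cast; omega⟩

open Classical in
theorem rowLen_removeCorners (k : ℕ) (i : ZMod (k + 1)) (g : YoungDiagram) (r : ℕ) :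
    ((removeCorners k i g).rowLen r : ℤ) = g.rowLen r -
      if ¬ bead g ((g.rowLen r : ℤ) - r - 2) ∧ (((g.rowLen r : ℤ) - r - 1 : ℤ) : ZMod (k + 1)) = i
        then 1 else 0 := by
  have key : ∀ j, j < (removeCorners k i g).rowLen r ↔ j < g.rowLen r ∧
      ¬ ((j + 1 = g.rowLen r ∧ ¬ bead g ((g.rowLen r : ℤ) - r - 2)) ∧
        (((j : ℤ) - r : ℤ) : ZMod (k + 1)) = i) := by
    intro j
    rw [← YoungDiagram.mem_iff_lt_rowLen, mem_removeCorners, YoungDiagram.mem_iff_lt_rowLen,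
      isRemovable_iff, residue_eq]
  split_ifs with h
  · have hpos : 0 < g.rowLen r := by
      by_contra h0
      exact h.1 ⟨r + 1, by
        have := g.rowLen_anti r (r + 1) (by omega)
        push_cast; omega⟩
    have : (removeCorners k i g).rowLen r = g.rowLen r - 1 := by
      apply eq_of_lt_iff
      intro j
      rw [key]
      constructor
      · rintro ⟨h1, h2⟩
        by_contra h3
        refine h2 ⟨⟨by omega, h.1⟩, ?_⟩
        rw [← h.2]
        congr 1
        omega
      · intro h1
        exact ⟨by omega, fun h2 => by omega⟩
    omega
  · have : (removeCorners k i g).rowLen r = g.rowLen r := by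
      apply eq_of_lt_iff
      intro j
      rw [key]
      refine ⟨And.left, fun h1 => ⟨h1, ?_⟩⟩
      rintro ⟨⟨h2, h3⟩, h4⟩
      refine h ⟨h3, ?_⟩
      rw [← h4]
      congr 1
      omega
    omega

theorem bead_removeCorners (k : ℕ) [NeZero k] (i : ZMod (k + 1)) (g : YoungDiagram) (j : ℤ) :
    bead (removeCorners k i g) j ↔
      (if ((j : ℤ) : ZMod (k + 1)) = i then bead g j ∧ bead g (j - 1)
      else if ((j + 1 : ℤ) : ZMod (k + 1)) = i then bead g j ∨ bead g (j + 1) else bead g j) := by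
  classical
  have key : bead (removeCorners k i g) j ↔
      (bead g j ∧ ¬ (¬ bead g (j - 1) ∧ ((j : ℤ) : ZMod (k + 1)) = i)) ∨
        (bead g (j + 1) ∧ ¬ bead g j ∧ ((j + 1 : ℤ) : ZMod (k + 1)) = i) := by
    constructor
    · rintro ⟨r, hr⟩
      rw [rowLen_removeCorners] at hr
      split_ifs at hr with h
      · right
        have e : (g.rowLen r : ℤ) - r = j + 2 := by omega
        rw [e, show j + 2 - 2 = j by ring, show j + 2 - 1 = j + 1 by ring] at h
        exact ⟨⟨r, by omega⟩, h⟩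
      · left
        have e : (g.rowLen r : ℤ) - r = j + 1 := by omega
        rw [e, show j + 1 - 2 = j - 1 by ring, show j + 1 - 1 = j by ring] at h
        exact ⟨⟨r, by omega⟩, h⟩
    · rintro (⟨⟨r, hr⟩, h⟩ | ⟨⟨r, hr⟩, h⟩)
      · refine ⟨r, ?_⟩
        rw [rowLen_removeCorners, if_neg]
        · omega
        · rw [show (g.rowLen r : ℤ) - r - 2 = j - 1 by omega,
            show (g.rowLen r : ℤ) - r - 1 = j by omega]
          exact h
      · refine ⟨r, ?_⟩
        rw [rowLen_removeCorners, if_pos]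
        · omega
        · rw [show (g.rowLen r : ℤ) - r - 2 = j by omega,
            show (g.rowLen r : ℤ) - r - 1 = j + 1 by omega]
          exact h
  rw [key]
  have hne := intCast_ne_add_one k j
  split_ifs with h1 h2
  · have h2 : ((j + 1 : ℤ) : ZMod (k + 1)) ≠ i := h1 ▸ hne
    tauto
  · tauto
  · tauto

theorem addCorners_mono (k : ℕ) (i : ZMod (k + 1)) {g h : YoungDiagram} (H : g ≤ h) :
    addCorners k i g ≤ addCorners k i h := by
  intro c hc
  rw [mem_addCorners] at hc ⊢
  by_cases hch : c ∈ h
  · exact Or.inl hch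
  · rcases hc with hc | ⟨⟨h1, h2, h3⟩, h4⟩
    · exact Or.inl (H hc)
    · exact Or.inr ⟨⟨hch, h2.imp id fun h => H h, h3.imp id fun h => H h⟩, h4⟩

theorem removeCorners_mono (k : ℕ) (i : ZMod (k + 1)) {g h : YoungDiagram} (H : g ≤ h) :
    removeCorners k i g ≤ removeCorners k i h := by
  intro c hc
  rw [mem_removeCorners] at hc ⊢
  refine ⟨H hc.1, ?_⟩
  rintro ⟨⟨-, h2, h3⟩, h4⟩
  exact hc.2 ⟨⟨hc.1, fun h => h2 (H h), fun h => h3 (H h)⟩, h4⟩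

theorem exists_isRemovable {g : YoungDiagram} (hg : g ≠ ⊥) : ∃ c, IsRemovable g c := by
  have h0 : (0, 0) ∈ g := by
    by_contra h
    apply hg
    ext ⟨a, b⟩
    simp only [YoungDiagram.mem_cells, YoungDiagram.notMem_bot, iff_false]
    exact fun h' => h (g.up_left_mem (Nat.zero_le _) (Nat.zero_le _) h')
  rw [YoungDiagram.mem_iff_lt_colLen] at h0
  have h1 : (g.colLen 0 - 1, 0) ∈ g := YoungDiagram.mem_iff_lt_colLen.2 (by omega)
  rw [YoungDiagram.mem_iff_lt_rowLen] at h1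
  refine ⟨(g.colLen 0 - 1, g.rowLen (g.colLen 0 - 1) - 1), ?_, ?_, ?_⟩
  · exact YoungDiagram.mem_iff_lt_rowLen.2 (by omega)
  · intro h
    have := YoungDiagram.mem_iff_lt_colLen.1 (g.up_left_mem le_rfl (Nat.zero_le _) h)
    omega
  · intro h
    have := YoungDiagram.mem_iff_lt_rowLen.1 h
    simp only at this
    omega

theorem card_removeCorners_lt {k : ℕ} {g : YoungDiagram} {c : ℕ × ℕ} (hc : IsRemovable g c) :
    (removeCorners k (residue k c) g).card < g.card := by
  apply Finset.card_lt_card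
  rw [YoungDiagram.cells_ssubset_iff]
  refine lt_of_le_of_ne (removeCorners_le _ _ _) ?_
  intro h
  have h1 : c ∈ removeCorners k (residue k c) g := by rw [h]; exact hc.1
  exact (mem_removeCorners.1 h1).2 ⟨hc, rfl⟩

/-! ### Level functions -/

/-- A level function: the abacus description of a `(k+1)`-core. -/
structure QState (k : ℕ) : Type where
  /-- The level at a position. -/
  toFun : ℤ → ℤ
  add_period' : ∀ j, toFun (j + (k + 1)) = toFun j + 1

instance (k : ℕ) : CoeFun (QState k) fun _ => ℤ → ℤ := ⟨QState.toFun⟩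

theorem QState.ext {k : ℕ} {c d : QState k} (h : ∀ j, c j = d j) : c = d := by
  cases c
  cases d
  congr
  exact funext h

theorem QState.add_mul {k : ℕ} (c : QState k) (j t : ℤ) : c (j + t * (k + 1)) = c j + t := by
  induction t with
  | zero => simp
  | succ t ih =>
    rw [show j + ((t : ℤ) + 1) * (k + 1) = j + t * (k + 1) + (k + 1) by ring, c.2, ih]
    ring
  | pred t ih =>
    have h := c.2 (j + (-(t : ℤ) - 1) * (k + 1))
    rw [show j + (-(t : ℤ) - 1) * (k + 1) + (k + 1) = j + -(t : ℤ) * (k + 1) by ring, ih] at h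
    omega

theorem QState.add_period {k : ℕ} (c : QState k) (j : ℤ) : c (j + (k + 1)) = c j + 1 := c.2 j

theorem intCast_eq_iff_exists (k : ℕ) (a b : ℤ) :
    (a : ZMod (k + 1)) = b ↔ ∃ t : ℤ, b = a + t * (k + 1) := by
  rw [ZMod.intCast_eq_intCast_iff_dvd_sub]
  constructor
  · rintro ⟨t, ht⟩
    exact ⟨t, by push_cast at ht; linarith⟩
  · rintro ⟨t, ht⟩
    exact ⟨t, by push_cast; linarith⟩

/-- The standard integer representative of a residue. -/
def liftZ {k : ℕ} (i : ZMod (k + 1)) : ℤ := (i.val : ℤ)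

@[simp] theorem cast_liftZ {k : ℕ} (i : ZMod (k + 1)) : ((liftZ i : ℤ) : ZMod (k + 1)) = i := by
  simp [liftZ]

theorem QState.sub_eq {k : ℕ} (c : QState k) {a b : ℤ} (h : (a : ZMod (k + 1)) = b) (e : ℤ) :
    c (a + e) - c a = c (b + e) - c b := by
  obtain ⟨t, rfl⟩ := (intCast_eq_iff_exists k a b).1 h
  rw [show a + t * (k + 1) + e = a + e + t * (k + 1) by ring, c.add_mul, c.add_mul]
  ring

/-- The permutation of the integers that exchanges `j - 1` and `j` for all `j` of residue `i`. -/
def swapZ (k : ℕ) (i : ZMod (k + 1)) (j : ℤ) : ℤ :=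
  if (j : ZMod (k + 1)) = i then j - 1 else if ((j + 1 : ℤ) : ZMod (k + 1)) = i then j + 1 else j

theorem swapZ_of_eq {k : ℕ} {i : ZMod (k + 1)} {j : ℤ} (h : (j : ZMod (k + 1)) = i) :
    swapZ k i j = j - 1 := if_pos h

theorem swapZ_of_add_one_eq {k : ℕ} [NeZero k] {i : ZMod (k + 1)} {j : ℤ}
    (h : ((j + 1 : ℤ) : ZMod (k + 1)) = i) : swapZ k i j = j + 1 := by
  rw [swapZ, if_neg, if_pos h]
  exact fun h' => intCast_ne_add_one k j (h.trans h'.symm)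

theorem swapZ_of_ne {k : ℕ} {i : ZMod (k + 1)} {j : ℤ} (h : (j : ZMod (k + 1)) ≠ i)
    (h' : ((j + 1 : ℤ) : ZMod (k + 1)) ≠ i) : swapZ k i j = j := by
  rw [swapZ, if_neg h, if_neg h']

theorem swapZ_swapZ (k : ℕ) [NeZero k] (i : ZMod (k + 1)) (j : ℤ) :
    swapZ k i (swapZ k i j) = j := by
  by_cases h : (j : ZMod (k + 1)) = i
  · rw [swapZ_of_eq h, swapZ_of_add_one_eq] <;> simp [h]
  · by_cases h' : ((j + 1 : ℤ) : ZMod (k + 1)) = i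
    · rw [swapZ_of_add_one_eq h', swapZ_of_eq h']
      ring
    · rw [swapZ_of_ne h h', swapZ_of_ne h h']

theorem cast_add_period (k : ℕ) (j : ℤ) :
    ((j + (k + 1) : ℤ) : ZMod (k + 1)) = (j : ZMod (k + 1)) := by
  rw [eq_comm, intCast_eq_iff_exists]
  exact ⟨1, by ring⟩

theorem swapZ_add (k : ℕ) (i : ZMod (k + 1)) (j : ℤ) :
    swapZ k i (j + (k + 1)) = swapZ k i j + (k + 1) := by
  have h1 : ((j + (k + 1) : ℤ) : ZMod (k + 1)) = (j : ZMod (k + 1)) := cast_add_period k j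
  have h2 : ((j + (k + 1) + 1 : ℤ) : ZMod (k + 1)) = ((j + 1 : ℤ) : ZMod (k + 1)) := by
    rw [← cast_add_period k (j + 1)]
    congr 1
    ring
  rw [swapZ, swapZ, h1, h2]
  split_ifs <;> ring

/-- The action of the generator `s_i` on level functions. -/
def QState.swap {k : ℕ} (i : ZMod (k + 1)) (c : QState k) : QState k :=
  ⟨fun j => c (swapZ k i j), fun j => by simp only [swapZ_add, c.2]⟩

theorem QState.swap_apply {k : ℕ} (i : ZMod (k + 1)) (c : QState k) (j : ℤ) :
    c.swap i j = c (swapZ k i j) := rfl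

@[simp] theorem QState.swap_swap {k : ℕ} [NeZero k] (i : ZMod (k + 1)) (c : QState k) :
    (c.swap i).swap i = c := by
  apply QState.ext
  intro j
  rw [swap_apply, swap_apply, swapZ_swapZ]

/-- The level difference across the bond of residue `i`. -/
def QState.gap {k : ℕ} (c : QState k) (i : ZMod (k + 1)) : ℤ := c (liftZ i) - c (liftZ i - 1)

theorem QState.gap_eq {k : ℕ} (c : QState k) {i : ZMod (k + 1)} {j : ℤ}
    (h : (j : ZMod (k + 1)) = i) : c.gap i = c j - c (j - 1) := by
  have := c.sub_eq (a := liftZ i) (b := j) (by simp [h]) (-1)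
  simp only [← sub_eq_add_neg] at this
  rw [gap]
  omega

theorem QState.gap_swap {k : ℕ} [NeZero k] (c : QState k) (i : ZMod (k + 1)) :
    (c.swap i).gap i = -c.gap i := by
  rw [gap, gap, swap_apply, swap_apply, swapZ_of_eq (cast_liftZ i), swapZ_of_add_one_eq]
  · rw [show liftZ i - 1 + 1 = liftZ i by ring]
    ring
  · simp

theorem QState.swap_eq_self {k : ℕ} [NeZero k] {c : QState k} {i : ZMod (k + 1)}
    (h : c.gap i = 0) : c.swap i = c := by
  apply QState.ext
  intro j
  rw [swap_apply]
  by_cases h1 : (j : ZMod (k + 1)) = i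
  · rw [c.gap_eq h1] at h
    rw [swapZ_of_eq h1]
    omega
  · by_cases h2 : ((j + 1 : ℤ) : ZMod (k + 1)) = i
    · rw [c.gap_eq h2] at h
      rw [swapZ_of_add_one_eq h2]
      simp only [add_sub_cancel_right] at h
      omega
    · rw [swapZ_of_ne h1 h2]

/-- The Demazure action of `s_i`: apply it if the shape grows. -/
def QState.dem {k : ℕ} (i : ZMod (k + 1)) (c : QState k) : QState k :=
  if 0 < c.gap i then c.swap i else c

/-- The level function `c` describes the shape `g`. -/
def Rep {k : ℕ} (c : QState k) (g : YoungDiagram) : Prop := ∀ j, c j < 0 ↔ bead g j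

/-- The level function of the empty shape. -/
def emptyState (k : ℕ) : QState k := ⟨fun j => j / (k + 1), fun j => by
  have : (k + 1 : ℤ) ≠ 0 := by positivity
  rw [Int.add_ediv_of_dvd_right (dvd_refl _), Int.ediv_self this]⟩

theorem rep_emptyState (k : ℕ) : Rep (emptyState k) ⊥ := by
  intro j
  rw [bead_bot]
  change j / ((k : ℤ) + 1) < 0 ↔ j < 0
  constructor
  · intro h
    by_contra h'
    exact absurd (Int.ediv_nonneg (not_lt.1 h') (by positivity : (0 : ℤ) ≤ k + 1)) (not_le.2 h)
  · intro h
    exact Int.ediv_neg_of_neg_of_pos h (by positivity)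

theorem Rep.eq_diagram {k : ℕ} {c : QState k} {g h : YoungDiagram} (hg : Rep c g) (hh : Rep c h) :
    g = h := eq_of_bead_iff fun j => (hg j).symm.trans (hh j)

/-- Moving by `t` periods adds `t`, so the signs of `c` along a residue class determine its values.
-/
theorem Rep.eq_state {k : ℕ} {c d : QState k} {g : YoungDiagram} (hc : Rep c g) (hd : Rep d g) :
    c = d := by
  apply QState.ext
  intro j
  have key : ∀ t : ℤ, c j + t < 0 ↔ d j + t < 0 := by
    intro t
    rw [← c.add_mul, ← d.add_mul, hc, hd]
  have h1 := key (-(c j))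
  have h2 := key (-(c j) - 1)
  omega

/-- If the gap is nonpositive, a bead at `j - 1` forces one at `j` and nothing can be added. If it
is positive, a bead at `j` forces one at `j - 1`, and sorting the pairs is the same as exchanging
them. In particular a core never has both addable and removable corners of one residue. -/
theorem Rep.dem {k : ℕ} [NeZero k] {c : QState k} {g : YoungDiagram} (h : Rep c g)
    (i : ZMod (k + 1)) : Rep (c.dem i) (addCorners k i g) := by
  intro j
  rw [bead_addCorners, ← h, ← h, ← h]
  by_cases hup : 0 < c.gap i
  · rw [QState.dem, if_pos hup, QState.swap_apply]
    split_ifs with h1 h2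
    · rw [swapZ_of_eq h1]
      rw [c.gap_eq h1] at hup
      omega
    · rw [swapZ_of_add_one_eq h2]
      rw [c.gap_eq h2] at hup
      simp only [add_sub_cancel_right] at hup
      omega
    · rw [swapZ_of_ne h1 h2]
  · rw [QState.dem, if_neg hup]
    split_ifs with h1 h2
    · rw [c.gap_eq h1] at hup
      omega
    · rw [c.gap_eq h2] at hup
      simp only [add_sub_cancel_right] at hup
      omega
    · rfl

theorem Rep.swap_of_neg {k : ℕ} [NeZero k] {c : QState k} {g : YoungDiagram} (h : Rep c g)
    {i : ZMod (k + 1)} (hi : c.gap i < 0) : Rep (c.swap i) (removeCorners k i g) := by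
  intro j
  rw [bead_removeCorners, ← h, ← h, ← h, QState.swap_apply]
  split_ifs with h1 h2
  · rw [swapZ_of_eq h1]
    rw [c.gap_eq h1] at hi
    omega
  · rw [swapZ_of_add_one_eq h2]
    rw [c.gap_eq h2] at hi
    simp only [add_sub_cancel_right] at hi
    omega
  · rw [swapZ_of_ne h1 h2]

theorem Rep.swap_of_pos {k : ℕ} [NeZero k] {c : QState k} {g : YoungDiagram} (h : Rep c g)
    {i : ZMod (k + 1)} (hi : 0 < c.gap i) : Rep (c.swap i) (addCorners k i g) := by
  have := h.dem i
  rwa [QState.dem, if_pos hi] at this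

theorem Rep.removeCorners_of_nonneg {k : ℕ} [NeZero k] {c : QState k} {g : YoungDiagram}
    (h : Rep c g) {i : ZMod (k + 1)} (hi : 0 ≤ c.gap i) : removeCorners k i g = g := by
  apply eq_of_bead_iff
  intro j
  rw [bead_removeCorners, ← h, ← h, ← h]
  split_ifs with h1 h2
  · rw [c.gap_eq h1] at hi
    omega
  · rw [c.gap_eq h2] at hi
    simp only [add_sub_cancel_right] at hi
    omega
  · rfl

theorem Rep.gap_neg_of_isRemovable {k : ℕ} {c : QState k} {g : YoungDiagram} (h : Rep c g)
    {p : ℕ × ℕ} (hp : IsRemovable g p) : c.gap (residue k p) < 0 := by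
  obtain ⟨r, s⟩ := p
  have h1 := isRemovable_iff.1 hp
  have h2 := bead_rowLen g r
  rw [← h] at h1 h2
  rw [residue_eq, c.gap_eq rfl]
  have e1 : (g.rowLen r : ℤ) - r - 1 = s - r := by omega
  have e2 : (g.rowLen r : ℤ) - r - 2 = s - r - 1 := by omega
  rw [e1] at h2
  rw [e2] at h1
  omega

/-! ### Cores and level functions -/

theorem hookLength_eq {g : YoungDiagram} {r s : ℕ} (h : (r, s) ∈ g) :
    (hookLength g (r, s) : ℤ) = ((g.rowLen r : ℤ) - r - 1) - (s - g.colLen s) := by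
  have h1 := YoungDiagram.mem_iff_lt_rowLen.1 h
  have h2 := YoungDiagram.mem_iff_lt_colLen.1 h
  simp only [hookLength]
  omega

theorem mem_of_colLen_lt {g : YoungDiagram} {r s : ℕ}
    (h : (s : ℤ) - g.colLen s < (g.rowLen r : ℤ) - r - 1) : (r, s) ∈ g := by
  by_contra hn
  have h1 := mt YoungDiagram.mem_iff_lt_rowLen.2 hn
  have h2 := mt YoungDiagram.mem_iff_lt_colLen.2 hn
  omega

/-- By `hookLength_eq`, hook lengths are the distances from a gap up to a larger bead, so a hook of
length `k + 1` is a bead with a gap `k + 1` places below it. -/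
theorem isCore_iff {k : ℕ} {g : YoungDiagram} :
    IsCore (k + 1) g ↔ ∀ j, bead g j → bead g (j - (k + 1)) := by
  constructor
  · rintro h j ⟨r, rfl⟩
    by_contra hb
    obtain ⟨s, hs⟩ := not_bead_iff.1 hb
    have hmem : (r, s) ∈ g := mem_of_colLen_lt (by omega)
    have h1 := hookLength_eq hmem
    exact h _ hmem (by omega)
  · rintro h ⟨r, s⟩ hmem hk
    have h1 := hookLength_eq hmem
    have h2 := h _ (bead_rowLen g r)
    exact not_bead_iff.2 ⟨s, by omega⟩ h2

theorem Rep.isCore {k : ℕ} {c : QState k} {g : YoungDiagram} (h : Rep c g) : IsCore (k + 1) g := by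
  rw [isCore_iff]
  intro j
  rw [← h, ← h]
  have := c.2 (j - (k + 1))
  rw [sub_add_cancel] at this
  omega

theorem exists_rep {k : ℕ} {g : YoungDiagram} (hg : IsCore (k + 1) g) : ∃ c : QState k, Rep c g := by
  rw [isCore_iff] at hg
  have hdown : ∀ (j s : ℤ) (m : ℕ), bead g (j + s * (k + 1)) → bead g (j + (s - m) * (k + 1)) := by
    intro j s m
    induction m with
    | zero => simp
    | succ m ih =>
      intro h
      have h1 := hg _ (ih h)
      rwa [show j + (s - m) * ((k : ℤ) + 1) - (k + 1) = j + (s - (m + 1 : ℕ)) * (k + 1) by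
        push_cast; ring] at h1
  have hex : ∀ j : ℤ, ∃ t : ℤ, ∀ s : ℤ, bead g (j + s * (k + 1)) ↔ s < t := by
    intro j
    obtain ⟨t, ht, hmin⟩ := Int.exists_least_of_bdd (P := fun s => ¬ bead g (j + s * (k + 1)))
      ⟨-(|j| + g.colLen 0), fun z hz => by
        by_contra hlt
        apply hz
        apply bead_of_lt
        have h1 := le_abs_self j
        have h2 : (0 : ℤ) ≤ g.colLen 0 := by positivity
        have h3 := abs_nonneg j
        nlinarith⟩
      ⟨|j| + g.rowLen 0, by
        apply not_bead_of_le
        have h1 := neg_abs_le j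
        have h2 : (0 : ℤ) ≤ g.rowLen 0 := by positivity
        have h3 := abs_nonneg j
        nlinarith⟩
    refine ⟨t, fun s => ⟨fun hs => ?_, fun hs => ?_⟩⟩
    · by_contra hlt
      have := hdown j s (s - t).toNat hs
      rw [show (s - ((s - t).toNat : ℤ)) = t by omega] at this
      exact ht this
    · by_contra hb
      have := hmin s hb
      omega
  choose t ht using hex
  -- On the class of `j` the beads form a down set that ends before the threshold `t j`, so the
  -- level is minus this threshold.
  refine ⟨⟨fun j => -t j, fun j => ?_⟩, fun j => ?_⟩
  · have key : ∀ s : ℤ, s < t (j + (k + 1)) ↔ s + 1 < t j := by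
      intro s
      rw [← ht, ← ht]
      rw [show j + ((k : ℤ) + 1) + s * (k + 1) = j + (s + 1) * (k + 1) by ring]
    have h1 := key (t (j + (k + 1)))
    have h2 := key (t j - 2)
    have h3 := key (t j - 1)
    omega
  · have := ht j 0
    simp only [zero_mul, add_zero] at this
    change -t j < 0 ↔ _
    rw [this]
    omega

/-! ### The number of small hooks -/

/-- The number of inversions of a level function that start at `a`. -/
def invAt {k : ℕ} (c : QState k) (a : ℤ) : ℕ :=
  ∑ b ∈ Finset.Ioo a (a + (k + 1)), (c a - c b).toNat

/-- The number of inversions of a level function. -/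
def invNum {k : ℕ} (c : QState k) : ℕ := ∑ a ∈ Finset.Ico 0 (0 + ((k : ℤ) + 1)), invAt c a

theorem invAt_add {k : ℕ} (c : QState k) (a : ℤ) : invAt c (a + (k + 1)) = invAt c a := by
  rw [invAt, invAt]
  symm
  refine Finset.sum_bij' (fun b _ => b + (k + 1)) (fun b _ => b - (k + 1)) ?_ ?_ ?_ ?_ ?_
  · intro b hb; rw [Finset.mem_Ioo] at hb ⊢; omega
  · intro b hb; rw [Finset.mem_Ioo] at hb ⊢; omega
  · intro b _; ring
  · intro b _; ring
  · intro b _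
    rw [c.2, c.2]
    congr 1
    ring

theorem sum_invAt_add_one {k : ℕ} (c : QState k) (q : ℤ) :
    ∑ a ∈ Finset.Ico (q + 1) (q + 1 + (k + 1)), invAt c a =
      ∑ a ∈ Finset.Ico q (q + (k + 1)), invAt c a := by
  have h1 : Finset.Ico q (q + ((k : ℤ) + 1)) = insert q (Finset.Ico (q + 1) (q + (k + 1))) := by
    ext x; simp only [Finset.mem_Ico, Finset.mem_insert]; omega
  have h2 : Finset.Ico (q + 1) (q + 1 + ((k : ℤ) + 1)) =
      insert (q + (k + 1)) (Finset.Ico (q + 1) (q + (k + 1))) := by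
    ext x; simp only [Finset.mem_Ico, Finset.mem_insert]; omega
  rw [h1, h2, Finset.sum_insert (by simp), Finset.sum_insert (by simp), invAt_add]

theorem invNum_eq {k : ℕ} (c : QState k) (q : ℤ) :
    invNum c = ∑ a ∈ Finset.Ico q (q + (k + 1)), invAt c a := by
  induction q with
  | zero => rfl
  | succ q ih => rw [sum_invAt_add_one, ih]
  | pred q ih =>
    rw [← sum_invAt_add_one, sub_add_cancel, ih]

theorem sum_Ico_two {M : Type*} [AddCommMonoid M] (k : ℕ) [NeZero k] (q : ℤ) (f : ℤ → M) :
    ∑ a ∈ Finset.Ico q (q + ((k : ℤ) + 1)), f a =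
      f q + (f (q + 1) + ∑ a ∈ Finset.Ico (q + 2) (q + ((k : ℤ) + 1)), f a) := by
  have hk := NeZero.pos k
  have h1 : Finset.Ico q (q + ((k : ℤ) + 1)) =
      insert q (insert (q + 1) (Finset.Ico (q + 2) (q + (k + 1)))) := by
    ext x; simp only [Finset.mem_Ico, Finset.mem_insert]; omega
  rw [h1, Finset.sum_insert (by simp), Finset.sum_insert (by simp)]

theorem cast_eq_of_lt {k : ℕ} {q a b : ℤ} (ha : q ≤ a) (ha' : a < q + (k + 1)) (hb : q ≤ b)
    (hb' : b < q + (k + 1)) (h : (a : ZMod (k + 1)) = b) : a = b := by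
  obtain ⟨t, rfl⟩ := (intCast_eq_iff_exists k a b).1 h
  have h1 : t < 1 := by nlinarith
  have h2 : -1 < t := by nlinarith
  obtain rfl : t = 0 := by omega
  simp

/-- In a window starting at `q` with `q + 1 ≡ i`, all comparisons are merely permuted, except those
of `q` with `q + 1` and of `q + 1` with `q + (k + 1)`. For a gap `d > 0` these two contribute `0 +
(d - 1)` before the exchange and `d + 0` after it. -/
theorem invNum_swap_of_pos {k : ℕ} [NeZero k] (c : QState k) {i : ZMod (k + 1)}
    (hi : 0 < c.gap i) : invNum (c.swap i) = invNum c + 1 := by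
  have hk := NeZero.pos k
  set q : ℤ := liftZ i - 1 with hq
  have hqi : ((q + 1 : ℤ) : ZMod (k + 1)) = i := by simp [hq]
  have hgap := c.gap_eq hqi
  rw [add_sub_cancel_right] at hgap
  have hs0 : c.swap i q = c (q + 1) := by rw [QState.swap_apply, swapZ_of_add_one_eq hqi]
  have hs1 : c.swap i (q + 1) = c q := by
    rw [QState.swap_apply, swapZ_of_eq hqi, add_sub_cancel_right]
  have hne : ∀ b ∈ Finset.Ico (q + 2) (q + ((k : ℤ) + 1)), swapZ k i b = b := by
    intro b hb
    rw [Finset.mem_Ico] at hb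
    apply swapZ_of_ne
    · intro h
      have := cast_eq_of_lt (k := k) (q := q) (a := b) (b := q + 1) (by omega) (by omega)
        (by omega) (by omega) (h.trans hqi.symm)
      omega
    · intro h
      have := cast_eq_of_lt (k := k) (q := q + 1) (a := b + 1) (b := q + 1) (by omega) (by omega)
        (by omega) (by omega) (h.trans hqi.symm)
      omega
  have hsn : ∀ b ∈ Finset.Ico (q + 2) (q + ((k : ℤ) + 1)), c.swap i b = c b := by
    intro b hb
    rw [QState.swap_apply, hne b hb]
  have hA : ∀ d : QState k, invAt d q = (d q - d (q + 1)).toNat +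
      ∑ b ∈ Finset.Ico (q + 2) (q + ((k : ℤ) + 1)), (d q - d b).toNat := by
    intro d
    have h1 : Finset.Ioo q (q + ((k : ℤ) + 1)) =
        insert (q + 1) (Finset.Ico (q + 2) (q + (k + 1))) := by
      ext x; simp only [Finset.mem_Ico, Finset.mem_Ioo, Finset.mem_insert]; omega
    rw [invAt, h1, Finset.sum_insert (by simp)]
  have hB : ∀ d : QState k, invAt d (q + 1) = (d (q + 1) - d q - 1).toNat +
      ∑ b ∈ Finset.Ico (q + 2) (q + ((k : ℤ) + 1)), (d (q + 1) - d b).toNat := by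
    intro d
    have h1 : Finset.Ioo (q + 1) (q + 1 + ((k : ℤ) + 1)) =
        insert (q + (k + 1)) (Finset.Ico (q + 2) (q + (k + 1))) := by
      ext x; simp only [Finset.mem_Ico, Finset.mem_Ioo, Finset.mem_insert]; omega
    rw [invAt, h1, Finset.sum_insert (by simp), d.2]
    congr 2
    ring
  -- The interval after such an `a` contains the translated pair `q + (k + 1)`, `q + (k + 1) + 1`
  -- entirely, so the exchange permutes the interval.
  have hC : ∀ a ∈ Finset.Ico (q + 2) (q + ((k : ℤ) + 1)), invAt (c.swap i) a = invAt c a := by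
    intro a ha
    have hsa := hsn a ha
    rw [Finset.mem_Ico] at ha
    have hmaps : ∀ b ∈ Finset.Ioo a (a + ((k : ℤ) + 1)),
        swapZ k i b ∈ Finset.Ioo a (a + ((k : ℤ) + 1)) := by
      intro b hb
      rw [Finset.mem_Ioo] at hb
      by_cases h1 : (b : ZMod (k + 1)) = i
      · rw [swapZ_of_eq h1, Finset.mem_Ioo]
        have : b = q + (k + 1) + 1 := by
          apply cast_eq_of_lt (k := k) (q := a) (by omega) (by omega) (by omega) (by omega)
          rw [h1, show q + ((k : ℤ) + 1) + 1 = q + 1 + (k + 1) by ring, cast_add_period, hqi]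
        omega
      · by_cases h2 : ((b + 1 : ℤ) : ZMod (k + 1)) = i
        · rw [swapZ_of_add_one_eq h2, Finset.mem_Ioo]
          have : b + 1 = q + (k + 1) + 1 := by
            apply cast_eq_of_lt (k := k) (q := a + 1) (by omega) (by omega) (by omega) (by omega)
            rw [h2, show q + ((k : ℤ) + 1) + 1 = q + 1 + (k + 1) by ring, cast_add_period, hqi]
          omega
        · rw [swapZ_of_ne h1 h2, Finset.mem_Ioo]
          omega
    rw [invAt, invAt]
    refine Finset.sum_bij' (fun b _ => swapZ k i b) (fun b _ => swapZ k i b) hmaps hmaps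
      (fun b _ => swapZ_swapZ k i b) (fun b _ => swapZ_swapZ k i b) ?_
    intro b _
    rw [hsa, QState.swap_apply]
  rw [invNum_eq _ q, invNum_eq c q, sum_Ico_two, sum_Ico_two, hA, hA, hB, hB,
    Finset.sum_congr (g := fun a => invAt c a) rfl hC, hs0, hs1,
    Finset.sum_congr rfl (fun b hb => by rw [hsn b hb] :
      ∀ b ∈ Finset.Ico (q + 2) (q + ((k : ℤ) + 1)),
        (c (q + 1) - c.swap i b).toNat = (c (q + 1) - c b).toNat),
    Finset.sum_congr rfl (fun b hb => by rw [hsn b hb] :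
      ∀ b ∈ Finset.Ico (q + 2) (q + ((k : ℤ) + 1)),
        (c q - c.swap i b).toNat = (c q - c b).toNat)]
  omega

theorem invNum_swap_of_neg {k : ℕ} [NeZero k] (c : QState k) {i : ZMod (k + 1)}
    (hi : c.gap i < 0) : invNum (c.swap i) + 1 = invNum c := by
  have := invNum_swap_of_pos (c.swap i) (i := i) (by rw [c.gap_swap]; omega)
  rw [c.swap_swap] at this
  omega

/-- A cell of small hook is a gap `a + t (k + 1)` followed within distance `k` by a bead `b + t (k +
1)`, with `a` in the fundamental window. This means `-c a ≤ t < -c b`, which leaves `(c a - c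
b).toNat` values of `t`. -/
theorem Rep.card_smallHookCells {k : ℕ} {c : QState k} {g : YoungDiagram} (h : Rep c g) :
    (smallHookCells k g).card = invNum c := by
  have hpos : (0 : ℤ) < k + 1 := by positivity
  have hcard : invNum c = ((Finset.Ico 0 (0 + ((k : ℤ) + 1))).sigma fun a =>
      (Finset.Ioo a (a + ((k : ℤ) + 1))).sigma fun b => Finset.Ico (-c a) (-c b)).card := by
    simp only [Finset.card_sigma, invNum, invAt, Int.card_Ico]
    refine Finset.sum_congr rfl fun a _ => Finset.sum_congr rfl fun b _ => ?_
    congr 1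
    ring
  rw [hcard]
  refine Finset.card_bij (fun p _ =>
    ⟨((p.2 : ℤ) - g.colLen p.2) % (k + 1),
      ⟨((g.rowLen p.1 : ℤ) - p.1 - 1) - ((p.2 : ℤ) - g.colLen p.2) / (k + 1) * (k + 1),
        ((p.2 : ℤ) - g.colLen p.2) / (k + 1)⟩⟩) ?_ ?_ ?_
  · rintro ⟨r, s⟩ hp
    simp only [smallHookCells, Finset.mem_filter, YoungDiagram.mem_cells] at hp
    have h1 := hookLength_eq hp.1
    have h2 := YoungDiagram.mem_iff_lt_rowLen.1 hp.1
    have h3 := YoungDiagram.mem_iff_lt_colLen.1 hp.1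
    have hb := bead_rowLen g r
    have hg := (not_bead_iff (g := g)).2 ⟨s, rfl⟩
    rw [← h] at hb hg
    simp only [Finset.mem_sigma, Finset.mem_Ico, Finset.mem_Ioo]
    set x : ℤ := (s : ℤ) - g.colLen s
    set m : ℤ := (g.rowLen r : ℤ) - r - 1
    have e1 := Int.emod_nonneg x hpos.ne'
    have e2 := Int.emod_lt_of_pos x hpos
    have e3 := Int.emod_add_ediv_mul x (k + 1)
    have e4 := c.add_mul (x % (k + 1)) (x / (k + 1))
    have e5 := c.add_mul (m - x / (k + 1) * (k + 1)) (x / (k + 1))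
    rw [e3] at e4
    rw [sub_add_cancel] at e5
    refine ⟨⟨e1, by omega⟩, ⟨?_, ?_⟩, ?_, ?_⟩ <;> omega
  · rintro ⟨r, s⟩ hp ⟨r', s'⟩ hp' heq
    simp only [Sigma.mk.injEq, heq_eq_eq] at heq
    obtain ⟨h1, h2, h3⟩ := heq
    have e3 := Int.emod_add_ediv_mul ((s : ℤ) - g.colLen s) (k + 1)
    have e3' := Int.emod_add_ediv_mul ((s' : ℤ) - g.colLen s') (k + 1)
    rw [h1, h3] at e3
    rw [h3] at h2
    have h4 : (g.rowLen r : ℤ) - r - 1 = (g.rowLen r' : ℤ) - r' - 1 := by omega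
    have h5 : r = r' := (rowLen_sub_strictAnti g).injective h4
    have h6 : (s : ℤ) - g.colLen s = (s' : ℤ) - g.colLen s' := by omega
    have h7 : s = s' := by
      rcases lt_trichotomy s s' with h | h | h
      · have := g.colLen_anti _ _ h.le
        omega
      · exact h
      · have := g.colLen_anti _ _ h.le
        omega
    rw [h5, h7]
  · rintro ⟨a, b, t⟩ habt
    simp only [Finset.mem_sigma, Finset.mem_Ico, Finset.mem_Ioo] at habt
    obtain ⟨⟨ha, ha'⟩, ⟨hb, hb'⟩, ht, ht'⟩ := habt
    have h1 : bead g (b + t * (k + 1)) := by rw [← h, c.add_mul]; omega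
    have h2 : ¬ bead g (a + t * (k + 1)) := by rw [← h, c.add_mul]; omega
    obtain ⟨r, hr⟩ := h1
    obtain ⟨s, hs⟩ := not_bead_iff.1 h2
    have hmem : (r, s) ∈ g := mem_of_colLen_lt (by omega)
    have hhook := hookLength_eq hmem
    refine ⟨(r, s), ?_, ?_⟩
    · simp only [smallHookCells, Finset.mem_filter, YoungDiagram.mem_cells]
      exact ⟨hmem, by omega⟩
    · have e1 : ((s : ℤ) - g.colLen s) / (k + 1) = t := by
        rw [hs, Int.add_mul_ediv_right _ _ hpos.ne', Int.ediv_eq_zero_of_lt ha (by omega)]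
        ring
      have e2 : ((s : ℤ) - g.colLen s) % (k + 1) = a := by
        rw [hs, Int.add_mul_emod_self_right, Int.emod_eq_of_lt ha (by omega)]
      simp only [e1, e2]
      rw [show (g.rowLen r : ℤ) - r - 1 - t * (k + 1) = b by omega]

theorem invNum_emptyState (k : ℕ) : invNum (emptyState k) = 0 := by
  rw [← (rep_emptyState k).card_smallHookCells]
  simp [smallHookCells]

/-! ### The action of the affine symmetric group on level functions -/

theorem one_ne_zero_zmod (k : ℕ) [NeZero k] : (1 : ZMod (k + 1)) ≠ 0 := by
  have : Fact (1 < k + 1) := ⟨by have := NeZero.pos k; omega⟩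
  exact one_ne_zero

theorem two_ne_zero_zmod {k : ℕ} [NeZero k] (hk : k ≠ 1) : (2 : ZMod (k + 1)) ≠ 0 := by
  have h := NeZero.pos k
  intro h2
  have : ((2 : ℕ) : ZMod (k + 1)) = 0 := by exact_mod_cast h2
  rw [ZMod.natCast_eq_zero_iff] at this
  have := Nat.le_of_dvd (by norm_num) this
  omega

theorem swapZ_comm {k : ℕ} {i j : ZMod (k + 1)} (h : i ≠ j) (h1 : i ≠ j + 1) (h2 : j ≠ i + 1)
    (x : ℤ) : swapZ k i (swapZ k j x) = swapZ k j (swapZ k i x) := by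
  simp only [swapZ]
  split_ifs <;> push_cast at * <;> grind

theorem swapZ_braid {k : ℕ} [NeZero k] (hk : k ≠ 1) (i : ZMod (k + 1)) (x : ℤ) :
    swapZ k i (swapZ k (i + 1) (swapZ k i x)) =
      swapZ k (i + 1) (swapZ k i (swapZ k (i + 1) x)) := by
  have h1 := one_ne_zero_zmod k
  have h2 := two_ne_zero_zmod hk
  have hI : ∀ y : ℤ, (y : ZMod (k + 1)) = i → swapZ k i y = y - 1 := fun y h => swapZ_of_eq h
  have hI' : ∀ y : ℤ, (y : ZMod (k + 1)) = i - 1 → swapZ k i y = y + 1 := fun y h =>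
    swapZ_of_add_one_eq (by push_cast; rw [h]; ring)
  have hI'' : ∀ y : ℤ, (y : ZMod (k + 1)) ≠ i → (y : ZMod (k + 1)) ≠ i - 1 → swapZ k i y = y :=
    fun y h h' => swapZ_of_ne h (fun h3 => h' (by push_cast at h3; rw [← h3]; ring))
  have hJ : ∀ y : ℤ, (y : ZMod (k + 1)) = i + 1 → swapZ k (i + 1) y = y - 1 :=
    fun y h => swapZ_of_eq h
  have hJ' : ∀ y : ℤ, (y : ZMod (k + 1)) = i → swapZ k (i + 1) y = y + 1 := fun y h =>
    swapZ_of_add_one_eq (by push_cast; rw [h])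
  have hJ'' : ∀ y : ℤ, (y : ZMod (k + 1)) ≠ i + 1 → (y : ZMod (k + 1)) ≠ i →
      swapZ k (i + 1) y = y :=
    fun y h h' => swapZ_of_ne h (fun h3 => h' (by push_cast at h3; exact add_right_cancel h3))
  have n1 : i ≠ i + 1 := by simpa using h1
  have n2 : i - 1 ≠ i := by simpa using h1
  have n3 : i - 1 ≠ i + 1 := fun h => h2 (by linear_combination -h)
  by_cases c1 : (x : ZMod (k + 1)) = i
  · have a1 : ((x - 1 : ℤ) : ZMod (k + 1)) = i - 1 := by push_cast; rw [c1]
    have a2 : ((x + 1 : ℤ) : ZMod (k + 1)) = i + 1 := by push_cast; rw [c1]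
    rw [hI x c1, hJ'' _ (a1 ▸ n3) (a1 ▸ n2), hI' _ a1, hJ' x c1,
      hI'' _ (a2 ▸ n1.symm) (a2 ▸ n3.symm), hJ _ a2]
    ring
  · by_cases c2 : (x : ZMod (k + 1)) = i - 1
    · have a1 : ((x + 1 : ℤ) : ZMod (k + 1)) = i := by push_cast; rw [c2]; ring
      have a2 : ((x + 1 + 1 : ℤ) : ZMod (k + 1)) = i + 1 := by push_cast; rw [c2]; ring
      rw [hI' x c2, hJ' _ a1, hI'' _ (a2 ▸ n1.symm) (a2 ▸ n3.symm),
        hJ'' x (c2 ▸ n3) (c2 ▸ n2), hI' x c2, hJ' _ a1]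
    · by_cases c3 : (x : ZMod (k + 1)) = i + 1
      · have a1 : ((x - 1 : ℤ) : ZMod (k + 1)) = i := by push_cast; rw [c3]; ring
        have a2 : ((x - 1 - 1 : ℤ) : ZMod (k + 1)) = i - 1 := by push_cast; rw [c3]; ring
        rw [hI'' x c1 c2, hJ x c3, hI _ a1, hJ'' _ (a2 ▸ n3) (a2 ▸ n2)]
      · rw [hI'' x c1 c2, hJ'' x c3 c1, hI'' x c1 c2, hJ'' x c3 c1]

theorem QState.swap_comm {k : ℕ} {i j : ZMod (k + 1)} (h : i ≠ j) (h1 : i ≠ j + 1)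
    (h2 : j ≠ i + 1) (c : QState k) : (c.swap i).swap j = (c.swap j).swap i := by
  apply QState.ext
  intro x
  simp only [swap_apply, swapZ_comm h h1 h2]

theorem QState.swap_braid {k : ℕ} [NeZero k] (hk : k ≠ 1) (i : ZMod (k + 1)) (c : QState k) :
    ((c.swap i).swap (i + 1)).swap i = ((c.swap (i + 1)).swap i).swap (i + 1) := by
  apply QState.ext
  intro x
  simp only [swap_apply, swapZ_braid hk]

/-- The generator `s_i` as a permutation of the level functions. -/
def swapPerm (k : ℕ) [NeZero k] (i : ZMod (k + 1)) : Equiv.Perm (QState k) where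
  toFun := QState.swap i
  invFun := QState.swap i
  left_inv c := c.swap_swap i
  right_inv c := c.swap_swap i

@[simp] theorem swapPerm_apply (k : ℕ) [NeZero k] (i : ZMod (k + 1)) (c : QState k) :
    swapPerm k i c = c.swap i := rfl

theorem affineMatrix_self (k : ℕ) (i : ZMod (k + 1)) : affineMatrix k i i = 1 :=
  (affineMatrix k).diagonal i

theorem affineMatrix_of_not_adj {k : ℕ} [NeZero k] {i j : ZMod (k + 1)} (h : i ≠ j)
    (h1 : i ≠ j + 1) (h2 : j ≠ i + 1) : affineMatrix k i j = 2 := by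
  have hk : k ≠ 1 := by
    rintro rfl
    revert i j
    decide
  change (if i = j then 1 else if k = 1 then 0 else if i = j + 1 ∨ j = i + 1 then 3 else 2) = 2
  rw [if_neg h, if_neg hk, if_neg (by tauto)]

theorem affineMatrix_of_adj {k : ℕ} [NeZero k] (hk : k ≠ 1) {i j : ZMod (k + 1)}
    (h : i = j + 1 ∨ j = i + 1) : affineMatrix k i j = 3 := by
  have h0 : i ≠ j := by
    have := one_ne_zero_zmod k
    rcases h with rfl | rfl <;> simpa
  change (if i = j then 1 else if k = 1 then 0 else if i = j + 1 ∨ j = i + 1 then 3 else 2) = 3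
  rw [if_neg h0, if_neg hk, if_pos h]

theorem swapPerm_isLiftable (k : ℕ) [NeZero k] :
    (affineMatrix k).IsLiftable (swapPerm k) := by
  intro i j
  by_cases hij : i = j
  · subst hij
    rw [affineMatrix_self, pow_one]
    ext1 c
    simp
  · by_cases hadj : i = j + 1 ∨ j = i + 1
    · by_cases hk : k = 1
      · have : affineMatrix k i j = 0 := by
          change (if i = j then 1 else if k = 1 then 0 else if i = j + 1 ∨ j = i + 1 then 3 else 2)
            = 0
          rw [if_neg hij, if_pos hk]
        rw [this, pow_zero]
      · rw [affineMatrix_of_adj hk hadj]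
        ext1 c
        simp only [pow_succ, pow_zero, one_mul, Equiv.Perm.mul_apply, swapPerm_apply,
          Equiv.Perm.one_apply]
        rcases hadj with rfl | rfl
        · rw [QState.swap_braid hk j c]
          simp
        · rw [← QState.swap_braid hk i c]
          simp
    · push Not at hadj
      rw [affineMatrix_of_not_adj hij hadj.1 hadj.2]
      ext1 c
      simp only [pow_succ, pow_zero, one_mul, Equiv.Perm.mul_apply, swapPerm_apply,
        Equiv.Perm.one_apply]
      rw [QState.swap_comm hij hadj.1 hadj.2]
      simp

/-- The action of the affine symmetric group on level functions. -/
def act (k : ℕ) [NeZero k] : AffSym k →* Equiv.Perm (QState k) :=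
  (cox k).lift ⟨swapPerm k, swapPerm_isLiftable k⟩

@[simp] theorem act_simple (k : ℕ) [NeZero k] (i : ZMod (k + 1)) (c : QState k) :
    act k ((cox k).simple i) c = c.swap i := by
  rw [act, CoxeterSystem.lift_apply_simple, swapPerm_apply]

theorem act_simple_mul (k : ℕ) [NeZero k] (i : ZMod (k + 1)) (u : AffSym k) (c : QState k) :
    act k ((cox k).simple i * u) c = (act k u c).swap i := by
  rw [map_mul, Equiv.Perm.mul_apply, act_simple]

theorem simple_comm {k : ℕ} [NeZero k] {i j : ZMod (k + 1)} (h : i ≠ j) (h1 : i ≠ j + 1)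
    (h2 : j ≠ i + 1) : (cox k).simple i * (cox k).simple j =
      (cox k).simple j * (cox k).simple i := by
  have h3 := (cox k).simple_mul_simple_pow i j
  rw [affineMatrix_of_not_adj h h1 h2, pow_two] at h3
  have h4 := eq_inv_of_mul_eq_one_left h3
  rwa [mul_inv_rev, CoxeterSystem.inv_simple, CoxeterSystem.inv_simple] at h4

theorem simple_braid {k : ℕ} [NeZero k] (hk : k ≠ 1) {i j : ZMod (k + 1)}
    (h : i = j + 1 ∨ j = i + 1) :
    (cox k).simple i * ((cox k).simple j * (cox k).simple i) =
      (cox k).simple j * ((cox k).simple i * (cox k).simple j) := by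
  have h3 := (cox k).simple_mul_simple_pow i j
  rw [affineMatrix_of_adj hk h, pow_succ, pow_two] at h3
  have h4 : ((cox k).simple i * ((cox k).simple j * (cox k).simple i)) *
      ((cox k).simple j * ((cox k).simple i * (cox k).simple j)) = 1 := by
    rw [← h3]
    group
  have h5 := eq_inv_of_mul_eq_one_left h4
  rw [h5]
  simp only [mul_inv_rev, CoxeterSystem.inv_simple, mul_assoc]

theorem QState.gap_swap_of_not_adj {k : ℕ} [NeZero k] {i j : ZMod (k + 1)} (h : i ≠ j)
    (h1 : i ≠ j + 1) (h2 : j ≠ i + 1) (c : QState k) : (c.swap i).gap j = c.gap j := by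
  rw [gap, gap, swap_apply, swap_apply, swapZ_of_ne, swapZ_of_ne]
  · simp only [Int.cast_sub, cast_liftZ, Int.cast_one]
    intro h'
    exact h2 (by rw [← h']; ring)
  · simpa using h.symm
  · simpa using h.symm
  · simpa using h1.symm

theorem QState.gap_swap_succ {k : ℕ} [NeZero k] (hk : k ≠ 1) (i : ZMod (k + 1)) (c : QState k) :
    (c.swap i).gap (i + 1) = c.gap i + c.gap (i + 1) := by
  have h2 := two_ne_zero_zmod hk
  have h1 := one_ne_zero_zmod k
  have e1 : ((liftZ i + 1 : ℤ) : ZMod (k + 1)) = i + 1 := by simp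
  rw [gap_eq _ e1, gap_eq _ e1, gap, add_sub_cancel_right, swap_apply, swap_apply,
    swapZ_of_eq (cast_liftZ i), swapZ_of_ne]
  · ring
  · simpa using h1
  · push_cast
    rw [cast_liftZ]
    intro h
    apply h2
    linear_combination h

theorem QState.gap_swap_pred {k : ℕ} [NeZero k] (hk : k ≠ 1) (i : ZMod (k + 1)) (c : QState k) :
    (c.swap (i + 1)).gap i = c.gap i + c.gap (i + 1) := by
  have h2 := two_ne_zero_zmod hk
  have h1 := one_ne_zero_zmod k
  have e1 : ((liftZ i + 1 : ℤ) : ZMod (k + 1)) = i + 1 := by simp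
  rw [c.gap_eq e1, gap, gap, add_sub_cancel_right, swap_apply, swap_apply,
    swapZ_of_add_one_eq e1, swapZ_of_ne]
  · ring
  · push_cast
    rw [cast_liftZ]
    intro h
    apply h2
    linear_combination -h
  · simpa using h1

/-- For `k = 1` the two bonds make up a full period. So two distinct descents cannot coexist, nor a
descent with a zero gap, and no braid relation is needed in this case. -/
theorem gap_add_gap_of_eq_one {k : ℕ} (hk : k = 1) {i j : ZMod (k + 1)} (h : i ≠ j)
    (c : QState k) : c.gap i + c.gap j = 1 := by
  subst hk
  have hj : j = i + 1 := by
    revert i j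
    decide
  subst hj
  have e1 : ((liftZ i + 1 : ℤ) : ZMod (1 + 1)) = i + 1 := by simp
  have := c.2 (liftZ i - 1)
  rw [c.gap_eq e1, QState.gap, add_sub_cancel_right]
  rw [show liftZ i - 1 + (((1 : ℕ) : ℤ) + 1) = liftZ i + 1 by push_cast; ring] at this
  omega

/-! ### Minimal length representatives -/

theorem invNum_swap_le {k : ℕ} [NeZero k] (c : QState k) (i : ZMod (k + 1)) :
    invNum (c.swap i) ≤ invNum c + 1 := by
  rcases lt_trichotomy (c.gap i) 0 with h | h | h
  · have := invNum_swap_of_neg c h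
    omega
  · rw [QState.swap_eq_self h]
    omega
  · rw [invNum_swap_of_pos c h]

theorem invNum_act_le (k : ℕ) [NeZero k] (u : AffSym k) :
    invNum (act k u (emptyState k)) ≤ (cox k).length u := by
  obtain ⟨l, hl, rfl⟩ := (cox k).exists_isReduced u
  rw [hl.eq]
  clear hl
  induction l with
  | nil => simp [invNum_emptyState]
  | cons i l ih =>
    rw [CoxeterSystem.wordProd_cons, act_simple_mul, List.length_cons]
    exact (invNum_swap_le _ _).trans (by omega)

theorem exists_rep_swap {k : ℕ} [NeZero k] {c : QState k} {g : YoungDiagram} (h : Rep c g)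
    (i : ZMod (k + 1)) : ∃ g', Rep (c.swap i) g' := by
  rcases lt_trichotomy (c.gap i) 0 with hi | hi | hi
  · exact ⟨_, h.swap_of_neg hi⟩
  · exact ⟨g, by rwa [QState.swap_eq_self hi]⟩
  · exact ⟨_, h.swap_of_pos hi⟩

theorem exists_rep_act (k : ℕ) [NeZero k] (u : AffSym k) :
    ∃ g, Rep (act k u (emptyState k)) g := by
  induction u using (cox k).simple_induction_left with
  | one => exact ⟨⊥, by simpa using rep_emptyState k⟩
  | mul_simple_left u i ih =>
    obtain ⟨g, hg⟩ := ih
    rw [act_simple_mul]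
    exact exists_rep_swap hg i

/-- `u` has minimal length among the elements that take the empty shape to `c`. -/
def IsMinRep {k : ℕ} [NeZero k] (u : AffSym k) (c : QState k) : Prop :=
  act k u (emptyState k) = c ∧ (cox k).length u = invNum c

theorem isMinRep_one (k : ℕ) [NeZero k] : IsMinRep 1 (emptyState k) :=
  ⟨by simp, by simp [invNum_emptyState]⟩

theorem IsMinRep.simple_mul {k : ℕ} [NeZero k] {u : AffSym k} {c : QState k} {i : ZMod (k + 1)}
    (h : IsMinRep u c) (hi : 0 < c.gap i) : IsMinRep ((cox k).simple i * u) (c.swap i) := by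
  have h1 : act k ((cox k).simple i * u) (emptyState k) = c.swap i := by rw [act_simple_mul, h.1]
  refine ⟨h1, ?_⟩
  have h2 := invNum_act_le k ((cox k).simple i * u)
  rw [h1, invNum_swap_of_pos c hi] at h2
  rw [invNum_swap_of_pos c hi]
  have := (cox k).length_simple_mul u i
  have := h.2
  omega

theorem IsMinRep.cons {k : ℕ} [NeZero k] {u : AffSym k} {c : QState k} {i : ZMod (k + 1)}
    (h : IsMinRep u (c.swap i)) (hi : c.gap i < 0) : IsMinRep ((cox k).simple i * u) c := by
  have := h.simple_mul (i := i) (by rw [c.gap_swap]; omega)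
  rwa [c.swap_swap] at this

theorem exists_isMinRep {k : ℕ} [NeZero k] {c : QState k} {g : YoungDiagram} (h : Rep c g) :
    ∃ u, IsMinRep u c := by
  induction hm : g.card using Nat.strong_induction_on generalizing c g with
  | _ m ih =>
    by_cases hg : g = ⊥
    · subst hg
      exact ⟨1, by rw [h.eq_state (rep_emptyState k)]; exact isMinRep_one k⟩
    · obtain ⟨p, hp⟩ := exists_isRemovable hg
      have hneg := h.gap_neg_of_isRemovable hp
      obtain ⟨u, hu⟩ := ih _ (hm ▸ card_removeCorners_lt (k := k) hp) (h.swap_of_neg hneg) rfl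
      exact ⟨_, hu.cons hneg⟩

theorem IsMinRep.exists_rep {k : ℕ} [NeZero k] {u : AffSym k} {c : QState k} (h : IsMinRep u c) :
    ∃ g, Rep c g := by
  rw [← h.1]
  exact exists_rep_act k u

theorem IsMinRep.exists_cons {k : ℕ} [NeZero k] {u : AffSym k} {c : QState k} {i : ZMod (k + 1)}
    (h : IsMinRep u c) (hi : c.gap i < 0) : ∃ x, IsMinRep x (c.swap i) := by
  obtain ⟨g, hg⟩ := h.exists_rep
  exact exists_isMinRep (hg.swap_of_neg hi)

/-- Dropping the first letter lowers the length by one, and the inversion number is bounded by the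
length, so it has to drop as well. -/
theorem IsMinRep.of_simple_mul {k : ℕ} [NeZero k] {u : AffSym k} {c : QState k}
    {i : ZMod (k + 1)} (h : IsMinRep ((cox k).simple i * u) c)
    (hl : (cox k).length ((cox k).simple i * u) = (cox k).length u + 1) :
    c.gap i < 0 ∧ IsMinRep u (c.swap i) := by
  have h1 : act k u (emptyState k) = c.swap i := by
    rw [← h.1, act_simple_mul, QState.swap_swap]
  have h2 := invNum_act_le k u
  rw [h1] at h2
  have h3 := h.2
  have hneg : c.gap i < 0 := by
    by_contra hn
    rcases (not_lt.1 hn).eq_or_lt with h0 | h0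
    · rw [QState.swap_eq_self h0.symm] at h2
      omega
    · rw [invNum_swap_of_pos c h0] at h2
      omega
  have h4 := invNum_swap_of_neg c hneg
  exact ⟨hneg, h1, by omega⟩

theorem IsMinRep.exists_eq_simple_mul {k : ℕ} [NeZero k] {u : AffSym k} {c : QState k}
    (h : IsMinRep u c) (hu : u ≠ 1) :
    ∃ i x, u = (cox k).simple i * x ∧ c.gap i < 0 ∧ IsMinRep x (c.swap i) := by
  obtain ⟨i, hi⟩ := (cox k).exists_leftDescent_of_ne_one hu
  rw [CoxeterSystem.isLeftDescent_iff] at hi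
  refine ⟨i, (cox k).simple i * u, by rw [CoxeterSystem.simple_mul_simple_cancel_left], ?_⟩
  apply IsMinRep.of_simple_mul
  · rwa [CoxeterSystem.simple_mul_simple_cancel_left]
  · rw [CoxeterSystem.simple_mul_simple_cancel_left]
    omega

/-- A diamond argument by induction on the inversion number. If two representatives begin with
different letters `i` and `j`, both are descents of `c`, and `c` can be lowered further to a state
below both branches. The commutation or braid relation then identifies the two words. -/
theorem IsMinRep.unique {k : ℕ} [NeZero k] {u v : AffSym k} {c : QState k} (hu : IsMinRep u c)
    (hv : IsMinRep v c) : u = v := by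
  induction hm : invNum c using Nat.strong_induction_on generalizing u v c with
  | _ m ih =>
    have one_of : ∀ w, IsMinRep w c → invNum c = 0 → w = 1 := by
      intro w hw h0
      rw [← (cox k).length_eq_zero_iff, hw.2, h0]
    by_cases h0 : invNum c = 0
    · rw [one_of u hu h0, one_of v hv h0]
    have hne : ∀ w, IsMinRep w c → w ≠ 1 := by
      rintro w hw rfl
      have := hw.2
      simp at this
      exact h0 this.symm
    obtain ⟨i, x, rfl, hi, hx⟩ := hu.exists_eq_simple_mul (hne u hu)
    obtain ⟨j, y, rfl, hj, hy⟩ := hv.exists_eq_simple_mul (hne v hv)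
    have hci := invNum_swap_of_neg c hi
    have hcj := invNum_swap_of_neg c hj
    by_cases hij : i = j
    · subst hij
      rw [ih _ (by omega) hx hy rfl]
    · by_cases hadj : i = j + 1 ∨ j = i + 1
      · by_cases hk : k = 1
        · have := gap_add_gap_of_eq_one hk hij c
          omega
        · have hij' : (c.swap i).gap j = c.gap i + c.gap j := by
            rcases hadj with rfl | rfl
            · rw [QState.gap_swap_pred hk, add_comm]
            · rw [QState.gap_swap_succ hk]
          have hji' : (c.swap j).gap i = c.gap i + c.gap j := by
            rcases hadj with rfl | rfl
            · rw [QState.gap_swap_succ hk, add_comm]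
            · rw [QState.gap_swap_pred hk]
          have hiji : ((c.swap i).swap j).gap i = c.gap j := by
            rcases hadj with rfl | rfl
            · rw [QState.gap_swap_succ hk, hij', QState.gap_swap]
              ring
            · rw [QState.gap_swap_pred hk, hij', QState.gap_swap]
              ring
          have hjij : ((c.swap j).swap i).gap j = c.gap i := by
            rcases hadj with rfl | rfl
            · rw [QState.gap_swap_pred hk, hji', QState.gap_swap]
              ring
            · rw [QState.gap_swap_succ hk, hji', QState.gap_swap]
              ring
          have hbr : ((c.swap i).swap j).swap i = ((c.swap j).swap i).swap j := by
            rcases hadj with rfl | rfl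
            · rw [QState.swap_braid hk]
            · rw [QState.swap_braid hk]
          obtain ⟨x', hx'⟩ := hx.exists_cons (i := j) (by omega)
          obtain ⟨z, hz⟩ := hx'.exists_cons (i := i) (by omega)
          have ex : x = (cox k).simple j * ((cox k).simple i * z) :=
            ih _ (by omega) hx ((hz.cons (by omega)).cons (by omega)) rfl
          rw [hbr] at hz
          have ey : y = (cox k).simple i * ((cox k).simple j * z) :=
            ih _ (by omega) hy ((hz.cons (by omega)).cons (by omega)) rfl
          rw [ex, ey]
          have := simple_braid hk hadj
          calc _ = ((cox k).simple i * ((cox k).simple j * (cox k).simple i)) * z := by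
                simp only [mul_assoc]
            _ = _ := by rw [this]; simp only [mul_assoc]
      · push Not at hadj
        have hij' := QState.gap_swap_of_not_adj hij hadj.1 hadj.2 c
        have hji' := QState.gap_swap_of_not_adj (Ne.symm hij) hadj.2 hadj.1 c
        obtain ⟨z, hz⟩ := hx.exists_cons (i := j) (by omega)
        have ex : x = (cox k).simple j * z := ih _ (by omega) hx (hz.cons (by omega)) rfl
        rw [QState.swap_comm hij hadj.1 hadj.2] at hz
        have ey : y = (cox k).simple i * z := ih _ (by omega) hy (hz.cons (by omega)) rfl
        rw [ex, ey, ← mul_assoc, ← mul_assoc, simple_comm hij hadj.1 hadj.2]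

theorem gap_emptyState_zero (k : ℕ) : (emptyState k).gap 0 ≠ 0 := by
  change ((((0 : ZMod (k + 1)).val : ℕ) : ℤ)) / ((k : ℤ) + 1) -
    ((((0 : ZMod (k + 1)).val : ℕ) : ℤ) - 1) / ((k : ℤ) + 1) ≠ 0
  rw [ZMod.val_zero]
  have : (((0 : ℕ) : ℤ) - 1) / ((k : ℤ) + 1) < 0 :=
    Int.ediv_neg_of_neg_of_pos (by norm_num) (by positivity)
  simp only [Nat.cast_zero, Int.zero_ediv] at this ⊢
  omega

/-- The Deodhar phenomenon: a reflection that fixes the coset passes through its minimal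
representative and comes out as a simple one. The reflection is pushed past the first letter by a
commutation or braid relation. At `u = 1` it survives with `j = i`, which is nonzero because the
empty state has a nonzero gap at `0`. -/
theorem IsMinRep.simple_mul_of_gap_eq_zero {k : ℕ} [NeZero k] {u : AffSym k} {c : QState k}
    {i : ZMod (k + 1)} (hu : IsMinRep u c) (hi : c.gap i = 0) :
    ∃ j : ZMod (k + 1), j ≠ 0 ∧ (cox k).simple i * u = u * (cox k).simple j := by
  induction hm : invNum c using Nat.strong_induction_on generalizing u c i with
  | _ m ih =>
    by_cases h1 : u = 1
    · subst h1
      refine ⟨i, ?_, by simp⟩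
      rintro rfl
      rw [← hu.1, map_one, Equiv.Perm.one_apply] at hi
      exact gap_emptyState_zero k hi
    · obtain ⟨a, x, rfl, ha, hx⟩ := hu.exists_eq_simple_mul h1
      have hca := invNum_swap_of_neg c ha
      have hai : a ≠ i := by
        rintro rfl
        omega
      by_cases hadj : a = i + 1 ∨ i = a + 1
      · by_cases hk : k = 1
        · have := gap_add_gap_of_eq_one hk hai c
          omega
        · have h2 : (c.swap a).gap i = c.gap a + c.gap i := by
            rcases hadj with rfl | rfl
            · rw [QState.gap_swap_pred hk, add_comm]
            · rw [QState.gap_swap_succ hk]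
          have h3 : ((c.swap a).swap i).gap a = 0 := by
            rcases hadj with rfl | rfl
            · rw [QState.gap_swap_succ hk, h2, QState.gap_swap]
              omega
            · rw [QState.gap_swap_pred hk, h2, QState.gap_swap]
              omega
          obtain ⟨z, hz⟩ := hx.exists_cons (i := i) (by omega)
          have hzc := invNum_swap_of_neg (c.swap a) (i := i) (by omega)
          have ex : x = (cox k).simple i * z := hx.unique (hz.cons (by omega))
          obtain ⟨j, hj, hj'⟩ := ih _ (by omega) hz h3 rfl
          refine ⟨j, hj, ?_⟩
          have hb := simple_braid hk hadj.symm
          rw [ex]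
          calc _ = ((cox k).simple i * ((cox k).simple a * (cox k).simple i)) * z := by
                simp only [mul_assoc]
            _ = (cox k).simple a * ((cox k).simple i * ((cox k).simple a * z)) := by
                rw [hb]; simp only [mul_assoc]
            _ = _ := by rw [hj']; simp only [mul_assoc]
      · push Not at hadj
        have h2 := QState.gap_swap_of_not_adj hai hadj.1 hadj.2 c
        obtain ⟨j, hj, hj'⟩ := ih _ (by omega) hx (by omega : (c.swap a).gap i = 0) rfl
        refine ⟨j, hj, ?_⟩
        rw [← mul_assoc, simple_comm hai.symm hadj.2 hadj.1, mul_assoc, hj', mul_assoc]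

/-! ### Cosets of the finite symmetric group -/

/-- The finite symmetric group inside the affine one. -/
abbrev finiteParabolic (k : ℕ) : Subgroup (AffSym k) :=
  Subgroup.closure {s | ∃ i : ZMod (k + 1), i ≠ 0 ∧ s = (cox k).simple i}

theorem emptyState_apply_of_window {k : ℕ} {j : ℤ} (h : 0 ≤ j) (h' : j < k + 1) :
    emptyState k j = 0 := Int.ediv_eq_zero_of_lt h h'

theorem gap_emptyState {k : ℕ} {i : ZMod (k + 1)} (hi : i ≠ 0) : (emptyState k).gap i = 0 := by
  have h1 : i.val < k + 1 := ZMod.val_lt i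
  have h2 : i.val ≠ 0 := by rwa [Ne, ZMod.val_eq_zero]
  rw [QState.gap, emptyState_apply_of_window, emptyState_apply_of_window, sub_zero] <;>
    rw [liftZ] <;> omega

theorem act_finiteParabolic {k : ℕ} [NeZero k] {v : AffSym k} (hv : v ∈ finiteParabolic k) :
    act k v (emptyState k) = emptyState k := by
  induction hv using Subgroup.closure_induction with
  | mem x hx =>
    obtain ⟨i, hi, rfl⟩ := hx
    rw [act_simple, QState.swap_eq_self (gap_emptyState hi)]
  | one => simp
  | mul x y _ _ hx hy => rw [map_mul, Equiv.Perm.mul_apply, hy, hx]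
  | inv x _ hx =>
    rw [map_inv, Equiv.Perm.inv_eq_iff_eq, hx]

/-- Left multiplication by `s_i` shortens the minimal factor, lengthens it, or passes through it
into the finite group, according to the sign of the gap. -/
theorem exists_isMinRep_mul (k : ℕ) [NeZero k] (u : AffSym k) :
    ∃ c g v, IsMinRep g c ∧ v ∈ finiteParabolic k ∧ u = g * v := by
  induction u using (cox k).simple_induction_left with
  | one => exact ⟨_, 1, 1, isMinRep_one k, one_mem _, by simp⟩
  | mul_simple_left u i ih =>
    obtain ⟨c, g, v, hg, hv, rfl⟩ := ih
    rcases lt_trichotomy (c.gap i) 0 with hi | hi | hi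
    · obtain ⟨x, hx⟩ := hg.exists_cons hi
      have : g = (cox k).simple i * x := hg.unique (hx.cons hi)
      refine ⟨_, x, v, hx, hv, ?_⟩
      rw [this, mul_assoc, CoxeterSystem.simple_mul_simple_cancel_left]
    · obtain ⟨j, hj, hj'⟩ := hg.simple_mul_of_gap_eq_zero hi
      refine ⟨c, g, (cox k).simple j * v, hg,
        mul_mem (Subgroup.subset_closure ⟨j, hj, rfl⟩) hv, ?_⟩
      rw [← mul_assoc, hj', mul_assoc]
    · exact ⟨_, _, v, hg.simple_mul hi, hv, by rw [mul_assoc]⟩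

/-- The finite group fixes the empty state, so the inversion number of the common image bounds all
lengths in the coset from below, and the minimal factor attains the bound. -/
theorem isGrassmannian_iff {k : ℕ} [NeZero k] {u : AffSym k} :
    IsGrassmannian k u ↔ IsMinRep u (act k u (emptyState k)) := by
  constructor
  · intro h
    refine ⟨rfl, le_antisymm ?_ (invNum_act_le k u)⟩
    obtain ⟨c, g, v, hg, hv, rfl⟩ := exists_isMinRep_mul k u
    rw [map_mul, Equiv.Perm.mul_apply, act_finiteParabolic hv, hg.1, ← hg.2]
    have := h v⁻¹ (inv_mem hv)
    rwa [mul_inv_cancel_right] at this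
  · rintro h v hv
    rw [h.2]
    have := invNum_act_le k (u * v)
    rwa [map_mul, Equiv.Perm.mul_apply, act_finiteParabolic hv] at this

theorem IsMinRep.isGrassmannian {k : ℕ} [NeZero k] {u : AffSym k} {c : QState k}
    (h : IsMinRep u c) : IsGrassmannian k u := by
  rw [isGrassmannian_iff, h.1]
  exact h

/-! ### Shapes of Grassmannian elements -/

/-- Every suffix of a reduced word of a minimal representative is again minimal, so every letter
adds corners effectively. -/
theorem IsMinRep.rep_foldr {k : ℕ} [NeZero k] (l : List (ZMod (k + 1))) {c : QState k}
    (hl : (cox k).IsReduced l) (h : IsMinRep ((cox k).wordProd l) c) :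
    Rep c (l.foldr (addCorners k) ⊥) := by
  induction l generalizing c with
  | nil =>
    rw [← h.1]
    simpa using rep_emptyState k
  | cons i l ih =>
    have hl' : (cox k).IsReduced l := by simpa using hl.drop 1
    rw [CoxeterSystem.wordProd_cons] at h
    have h1 := hl.eq
    rw [CoxeterSystem.wordProd_cons, List.length_cons] at h1
    obtain ⟨hi, hx⟩ := h.of_simple_mul (by rw [h1, hl'.eq])
    have := (ih hl' hx).swap_of_pos (i := i) (by rw [c.gap_swap]; omega)
    rwa [c.swap_swap] at this

theorem IsMinRep.rep_shapeOf {k : ℕ} [NeZero k] {u : AffSym k} {c : QState k}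
    (h : IsMinRep u c) : Rep c (shapeOf k u) :=
  IsMinRep.rep_foldr _ (reducedWord_isReduced k u) (by rwa [wordProd_reducedWord])

theorem isMinRep_grassOf {k : ℕ} [NeZero k] {l : BoundedPartition k} {c : QState k}
    (h : Rep c (coreOf k l)) : IsMinRep (grassOf k l) c := by
  obtain ⟨u, hu⟩ := exists_isMinRep h
  have hex : ∃ w ∈ {w | IsGrassmannian k w}, shapeOf k w = coreOf k l :=
    ⟨u, hu.isGrassmannian, hu.rep_shapeOf.eq_diagram h⟩
  have h1 : IsGrassmannian k (grassOf k l) := Function.invFunOn_mem hex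
  have h2 : shapeOf k (grassOf k l) = coreOf k l := Function.invFunOn_eq hex
  have h3 := isGrassmannian_iff.1 h1
  have h4 := h3.rep_shapeOf
  rw [h2] at h4
  rwa [h4.eq_state h] at h3

/-! ### The nil Hecke action on level functions -/

/-- The free module on the level functions. -/
abbrev QMod (k : ℕ) : Type := QState k →₀ ℤ

/-- The action of `A_i` on the free module on the level functions. -/
def genA (k : ℕ) (i : ZMod (k + 1)) : Module.End ℤ (QMod k) :=
  Finsupp.linearCombination ℤ fun c => Finsupp.single (c.dem i) (c.gap i).sign

theorem genA_single (k : ℕ) (i : ZMod (k + 1)) (c : QState k) (a : ℤ) :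
    genA k i (Finsupp.single c a) = Finsupp.single (c.dem i) (a * (c.gap i).sign) := by
  rw [genA, Finsupp.linearCombination_single, Finsupp.smul_single, smul_eq_mul]

theorem QState.dem_of_pos {k : ℕ} {c : QState k} {i : ZMod (k + 1)} (h : 0 < c.gap i) :
    c.dem i = c.swap i := if_pos h

theorem QState.dem_of_nonpos {k : ℕ} {c : QState k} {i : ZMod (k + 1)} (h : c.gap i ≤ 0) :
    c.dem i = c := if_neg (not_lt.2 h)

open Classical in
/-- The projection of the nil Hecke algebra to the free module on the level functions, which kills
the elements that are not Grassmannian. -/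
def proj (k : ℕ) [NeZero k] : (AffSym k →₀ ℤ) →ₗ[ℤ] QMod k :=
  Finsupp.linearCombination ℤ fun u =>
    if IsMinRep u (act k u (emptyState k)) then Finsupp.single (act k u (emptyState k)) 1 else 0

theorem proj_single_of_isMinRep {k : ℕ} [NeZero k] {u : AffSym k} {c : QState k}
    (h : IsMinRep u c) (a : ℤ) : proj k (Finsupp.single u a) = Finsupp.single c a := by
  classical
  have h' := h
  rw [← h.1] at h'
  rw [proj, Finsupp.linearCombination_single, if_pos h', h.1, Finsupp.smul_single, smul_eq_mul,
    mul_one]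

theorem proj_single_of_not {k : ℕ} [NeZero k] {u : AffSym k}
    (h : ¬ IsMinRep u (act k u (emptyState k))) (a : ℤ) : proj k (Finsupp.single u a) = 0 := by
  classical
  rw [proj, Finsupp.linearCombination_single, if_neg h, smul_zero]

theorem proj_apply {k : ℕ} [NeZero k] {w : AffSym k} {c : QState k} (h : IsMinRep w c)
    (x : AffSym k →₀ ℤ) : proj k x c = x w := by
  classical
  induction x using Finsupp.induction_linear with
  | zero => simp
  | add x y hx hy => rw [map_add, Finsupp.add_apply, Finsupp.add_apply, hx, hy]
  | single u a =>
    by_cases hu : IsMinRep u (act k u (emptyState k))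
    · rw [proj_single_of_isMinRep hu, Finsupp.single_apply, Finsupp.single_apply]
      congr 1
      apply propext
      constructor
      · intro h1
        rw [h1] at hu
        exact hu.unique h
      · rintro rfl
        exact h.1
    · rw [proj_single_of_not hu, Finsupp.single_apply, if_neg]
      · rfl
      · rintro rfl
        exact hu (h.1 ▸ h)

/-- For a minimal `u` with state `c`, a negative gap means that `s_i` is a left descent, and a
positive gap that `s_i u` is minimal again. If the gap is zero, `s_i u` is longer but has the same
state, hence is killed. A non-minimal `u` stays non-minimal under lengthening, since a letter raises
the inversion number by at most one. -/
theorem proj_nilHeckeGen (k : ℕ) [NeZero k] (i : ZMod (k + 1)) (x : AffSym k →₀ ℤ) :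
    proj k (nilHeckeGen k i x) = genA k i (proj k x) := by
  induction x using Finsupp.induction_linear with
  | zero => simp
  | add x y hx hy => rw [map_add, map_add, map_add, map_add, hx, hy]
  | single u a =>
    have hgen : nilHeckeGen k i (Finsupp.single u a) =
        if (cox k).length u < (cox k).length ((cox k).simple i * u) then
          Finsupp.single ((cox k).simple i * u) a else Finsupp.single u (-a) := by
      rw [nilHeckeGen, Finsupp.linearCombination_single]
      split_ifs
      · simp
      · simp
    rw [hgen]
    have hle := invNum_act_le k u
    by_cases hu : IsMinRep u (act k u (emptyState k))
    · rw [proj_single_of_isMinRep hu, genA_single]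
      set c := act k u (emptyState k) with hc
      rcases lt_trichotomy (c.gap i) 0 with hi | hi | hi
      · obtain ⟨x, hx⟩ := hu.exists_cons hi
        have h1 : u = (cox k).simple i * x := hu.unique (hx.cons hi)
        have h2 := invNum_swap_of_neg c hi
        have h3 := hu.2
        have h4 := hx.2
        rw [if_neg, proj_single_of_isMinRep hu, QState.dem_of_nonpos hi.le,
          Int.sign_eq_neg_one_of_neg hi, mul_neg_one]
        rw [h1, CoxeterSystem.simple_mul_simple_cancel_left, ← h1]
        omega
      · have h1 : act k ((cox k).simple i * u) (emptyState k) = c := by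
          rw [act_simple_mul, ← hc, QState.swap_eq_self hi]
        have h2 := invNum_act_le k ((cox k).simple i * u)
        rw [h1] at h2
        have h3 := hu.2
        have h4 := (cox k).length_simple_mul u i
        rw [if_pos (by omega), proj_single_of_not, hi]
        · simp
        · rw [h1]
          intro h5
          have := h5.2
          omega
      · have h1 := hu.simple_mul hi
        have h2 := invNum_swap_of_pos c hi
        have h3 := hu.2
        have h4 := h1.2
        rw [if_pos (by omega), proj_single_of_isMinRep h1, QState.dem_of_pos hi,
          Int.sign_eq_one_of_pos hi, mul_one]
    · rw [proj_single_of_not hu, map_zero]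
      split_ifs with h
      · apply proj_single_of_not
        intro h1
        have h2 := h1.2
        rw [act_simple_mul] at h2
        have h3 := invNum_swap_le (act k u (emptyState k)) i
        exact hu ⟨rfl, by omega⟩
      · exact proj_single_of_not hu _

/-! ### Cyclically decreasing words -/

/-- An inductive form of `IsCycDecWord`. -/
def IsCD {k : ℕ} : List (ZMod (k + 1)) → Prop
  | [] => True
  | i :: l => i ∉ l ∧ i + 1 ∉ l ∧ IsCD l

theorem IsCD.nodup {k : ℕ} {l : List (ZMod (k + 1))} (h : IsCD l) : l.Nodup := by
  induction l with
  | nil => exact List.nodup_nil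
  | cons i l ih => exact List.nodup_cons.2 ⟨h.1, ih h.2.2⟩

theorem IsCD.sublist {k : ℕ} {l l' : List (ZMod (k + 1))} (h : IsCD l) (hs : l'.Sublist l) :
    IsCD l' := by
  induction hs with
  | slnil => trivial
  | cons a _ ih => exact ih h.2.2
  | cons_cons a hs ih =>
    exact ⟨fun h' => h.1 (hs.subset h'), fun h' => h.2.1 (hs.subset h'), ih h.2.2⟩

theorem isCycDecWord_iff {k : ℕ} [NeZero k] {l : List (ZMod (k + 1))} : IsCycDecWord k l ↔ IsCD l := by
  induction l with
  | nil => simp [IsCycDecWord, IsCD]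
  | cons i l ih =>
    rw [IsCD, ← ih, IsCycDecWord, IsCycDecWord, List.nodup_cons]
    constructor
    · rintro ⟨⟨h1, h2⟩, h3⟩
      refine ⟨h1, ?_, h2, ?_⟩
      · intro h4
        have := h3 (i + 1) (List.mem_cons_of_mem _ h4) (by simp)
        simp at this
      · intro j hj hj'
        have h5 := h3 j (List.mem_cons_of_mem _ hj) (List.mem_cons_of_mem _ hj')
        have n1 : i ≠ j := fun h => h1 (h ▸ hj)
        have n2 : i ≠ j - 1 := fun h => h1 (h ▸ hj')
        rw [List.idxOf_cons_ne _ n1, List.idxOf_cons_ne _ n2] at h5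
        omega
    · rintro ⟨h1, h2, h3, h4⟩
      refine ⟨⟨h1, h3⟩, ?_⟩
      intro j hj hj'
      by_cases n2 : i = j - 1
      · exfalso
        have e : j = i + 1 := by rw [n2]; ring
        rcases List.mem_cons.1 hj with h | h
        · rw [h] at n2
          exact one_ne_zero_zmod k (by linear_combination n2)
        · exact h2 (e ▸ h)
      · have h6 : j - 1 ∈ l := (List.mem_cons.1 hj').resolve_left (Ne.symm n2)
        rw [List.idxOf_cons_ne _ n2]
        by_cases n1 : i = j
        · subst n1
          simp
        · rw [List.idxOf_cons_ne _ n1]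
          have := h4 j ((List.mem_cons.1 hj).resolve_left (Ne.symm n1)) h6
          omega


theorem add_one_mem_iff_univ {k : ℕ} {J : Finset (ZMod (k + 1))} (h0 : J.Nonempty)
    (h : ∀ i ∈ J, i + 1 ∈ J) : J = Finset.univ := by
  obtain ⟨a, ha⟩ := h0
  have key : ∀ m : ℕ, a + m ∈ J := by
    intro m
    induction m with
    | zero => simpa using ha
    | succ m ih =>
      have := h _ ih
      rwa [add_assoc, ← Nat.cast_succ] at this
  ext b
  simp only [Finset.mem_univ, iff_true]
  have := key (b - a).val
  simpa using this

/-- A nonempty proper set of residues contains some `i` without its successor `i + 1`, and such an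
`i` may be placed in front. -/
theorem exists_isCD {k : ℕ} (J : Finset (ZMod (k + 1))) (hJ : J ≠ Finset.univ) :
    ∃ l : List (ZMod (k + 1)), IsCD l ∧ l.toFinset = J := by
  induction hm : J.card generalizing J with
  | zero =>
    rw [Finset.card_eq_zero] at hm
    exact ⟨[], trivial, by simp [hm]⟩
  | succ m ih =>
    have h0 : J.Nonempty := Finset.card_pos.1 (by omega)
    have : ∃ i ∈ J, i + 1 ∉ J := by
      by_contra hn
      push Not at hn
      exact hJ (add_one_mem_iff_univ h0 hn)
    obtain ⟨i, hi, hi'⟩ := this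
    obtain ⟨l, hl, hl'⟩ := ih (J.erase i)
      (fun h => Finset.notMem_erase i J (h ▸ Finset.mem_univ i))
      (by rw [Finset.card_erase_of_mem hi]; omega)
    refine ⟨i :: l, ⟨?_, ?_, hl⟩, ?_⟩
    · rw [← List.mem_toFinset, hl']
      exact Finset.notMem_erase i J
    · rw [← List.mem_toFinset, hl']
      exact fun h => hi' (Finset.mem_of_mem_erase h)
    · rw [List.toFinset_cons, hl', Finset.insert_erase hi]

theorem IsCD.toFinset_ne_univ {k : ℕ} [NeZero k] {l : List (ZMod (k + 1))} (h : IsCD l) :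
    l.toFinset ≠ Finset.univ := by
  cases l with
  | nil =>
    intro h'
    have : (0 : ZMod (k + 1)) ∈ ([] : List (ZMod (k + 1))).toFinset := h' ▸ Finset.mem_univ _
    simp at this
  | cons i l =>
    intro h'
    have h1 : i + 1 ∈ (i :: l).toFinset := h' ▸ Finset.mem_univ _
    rw [List.mem_toFinset, List.mem_cons] at h1
    rcases h1 with h1 | h1
    · exact one_ne_zero_zmod k (by simpa using h1)
    · exact h.2.1 h1

open Classical in
/-- A cyclically decreasing word with a given set of letters. -/
def wordOf {k : ℕ} (J : Finset (ZMod (k + 1))) : List (ZMod (k + 1)) :=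
  if h : J ≠ Finset.univ then (exists_isCD J h).choose else []

theorem wordOf_isCD {k : ℕ} {J : Finset (ZMod (k + 1))} (h : J ≠ Finset.univ) :
    IsCD (wordOf J) := by
  rw [wordOf, dif_pos h]
  exact (exists_isCD J h).choose_spec.1

theorem wordOf_toFinset {k : ℕ} {J : Finset (ZMod (k + 1))} (h : J ≠ Finset.univ) :
    (wordOf J).toFinset = J := by
  rw [wordOf, dif_pos h]
  exact (exists_isCD J h).choose_spec.2

theorem mem_wordOf {k : ℕ} {J : Finset (ZMod (k + 1))} (h : J ≠ Finset.univ)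
    {i : ZMod (k + 1)} : i ∈ wordOf J ↔ i ∈ J := by
  rw [← List.mem_toFinset, wordOf_toFinset h]

theorem length_wordOf {k : ℕ} {J : Finset (ZMod (k + 1))} (h : J ≠ Finset.univ) :
    (wordOf J).length = J.card := by
  rw [← List.toFinset_card_of_nodup (wordOf_isCD h).nodup, wordOf_toFinset h]

/-- The product over a cyclically decreasing word depends only on the set of its letters if the
factors commute for residues that are not adjacent. -/
theorem IsCD.prod_map_eq {k : ℕ} {M : Type*} [Monoid M] (f : ZMod (k + 1) → M)
    (hf : ∀ i j, i ≠ j → i ≠ j + 1 → j ≠ i + 1 → f i * f j = f j * f i)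
    {l l' : List (ZMod (k + 1))} (hl : IsCD l) (hl' : IsCD l')
    (h : l.toFinset = l'.toFinset) : (l.map f).prod = (l'.map f).prod := by
  induction l generalizing l' with
  | nil =>
    have : l' = [] := by
      rw [← List.toFinset_eq_empty_iff, ← h]
      rfl
    rw [this]
  | cons i t ih =>
    have hi : i ∈ l' := by
      rw [← List.mem_toFinset, ← h]
      simp
    obtain ⟨p, s, rfl⟩ := List.append_of_mem hi
    have hnd := hl'.nodup
    rw [List.nodup_append] at hnd
    have hps : IsCD (p ++ s) := hl'.sublist (by simp)
    have hset : t.toFinset = (p ++ s).toFinset := by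
      have h1 : t.toFinset = (i :: t).toFinset.erase i := by
        rw [List.toFinset_cons, Finset.erase_insert]
        rw [List.mem_toFinset]
        exact hl.1
      rw [h1, h]
      ext x
      simp only [List.toFinset_append, List.toFinset_cons, Finset.mem_erase, Finset.mem_union,
        Finset.mem_insert, List.mem_toFinset]
      constructor
      · tauto
      · have n1 : i ∉ p := fun h => hnd.2.2 i h i (by simp) rfl
        have n2 : i ∉ s := (List.nodup_cons.1 hnd.2.1).1
        intro hx
        refine ⟨?_, by tauto⟩
        rintro rfl
        tauto
    -- The letter `i` can be moved to the front: `i + 1` does not precede it by assumption, and `i -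
    -- 1` does not precede it in a cyclically decreasing word.
    have hcomm : ∀ q : List (ZMod (k + 1)), IsCD (q ++ i :: s) → (∀ x ∈ q, x ≠ i + 1) →
        (q.map f).prod * f i = f i * (q.map f).prod := by
      intro q
      induction q with
      | nil => simp
      | cons a q ihq =>
        intro hq hq'
        rw [List.map_cons, List.prod_cons, mul_assoc,
          ihq hq.2.2 fun x hx => hq' x (List.mem_cons_of_mem _ hx), ← mul_assoc, ← mul_assoc]
        congr 1
        apply hf
        · rintro rfl
          exact hq.1 (by simp)
        · exact hq' a (by simp)
        · rintro rfl
          exact hq.2.1 (by simp)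
    have hp : ∀ x ∈ p, x ≠ i + 1 := by
      rintro x hx rfl
      have h1 : i + 1 ∈ (i :: t).toFinset := by
        rw [h]
        simp [hx]
      rw [List.mem_toFinset, List.mem_cons] at h1
      rcases h1 with h1 | h1
      · rw [h1] at hx
        exact hnd.2.2 i hx i (by simp) rfl
      · exact hl.2.1 h1
    rw [List.map_cons, List.prod_cons, ih hl.2.2 hps hset, List.map_append, List.map_append,
      List.prod_append, List.prod_append, List.map_cons, List.prod_cons, ← mul_assoc,
      ← hcomm p hl' hp, mul_assoc]

theorem IsCD.wordProd_eq {k : ℕ} [NeZero k] {l l' : List (ZMod (k + 1))} (hl : IsCD l)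
    (hl' : IsCD l') (h : l.toFinset = l'.toFinset) :
    (cox k).wordProd l = (cox k).wordProd l' :=
  hl.prod_map_eq _ (fun _ _ h0 h1 h2 => simple_comm h0 h1 h2) hl' h

/-! ### Detecting the letters of a cyclically decreasing element -/

/-- The rotated empty shape, which is fixed by all the generators except `s_i`. -/
def pointState {k : ℕ} (i : ZMod (k + 1)) : QState k :=
  ⟨fun x => emptyState k (x - liftZ i), fun x => by
    rw [show x + ((k : ℤ) + 1) - liftZ i = x - liftZ i + (k + 1) by ring, (emptyState k).2]⟩

theorem pointState_apply {k : ℕ} (i : ZMod (k + 1)) (x : ℤ) :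
    pointState i x = emptyState k (x - liftZ i) := rfl

theorem gap_pointState {k : ℕ} (i j : ZMod (k + 1)) :
    (pointState i).gap j = (emptyState k).gap (j - i) := by
  rw [QState.gap, pointState_apply, pointState_apply,
    (emptyState k).gap_eq (j := liftZ j - liftZ i) (by push_cast; simp)]
  congr 2
  ring

theorem gap_pointState_of_ne {k : ℕ} {i j : ZMod (k + 1)} (h : j ≠ i) :
    (pointState i).gap j = 0 := by
  rw [gap_pointState]
  exact gap_emptyState (sub_ne_zero.2 h)

theorem act_wordProd_pointState {k : ℕ} [NeZero k] {i : ZMod (k + 1)} {l : List (ZMod (k + 1))}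
    (h : i ∉ l) : act k ((cox k).wordProd l) (pointState i) = pointState i := by
  induction l with
  | nil => simp
  | cons j l ih =>
    rw [List.mem_cons, not_or] at h
    rw [CoxeterSystem.wordProd_cons, act_simple_mul, ih h.2,
      QState.swap_eq_self (gap_pointState_of_ne (Ne.symm h.1))]

/-- The other letters fix `pointState i`, so equality would force `s_i` to fix it, against its
nonzero gap at `i`. Thus the product of a repetition-free word remembers its letters. -/
theorem act_wordProd_pointState_ne {k : ℕ} [NeZero k] {i : ZMod (k + 1)}
    {l : List (ZMod (k + 1))} (hl : l.Nodup) (h : i ∈ l) :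
    act k ((cox k).wordProd l) (pointState i) ≠ pointState i := by
  obtain ⟨p, s, rfl⟩ := List.append_of_mem h
  rw [List.nodup_append] at hl
  have hp : i ∉ p := fun h => hl.2.2 i h i (by simp) rfl
  have hs : i ∉ s := (List.nodup_cons.1 hl.2.1).1
  rw [CoxeterSystem.wordProd_append, map_mul, Equiv.Perm.mul_apply,
    CoxeterSystem.wordProd_cons, act_simple_mul, act_wordProd_pointState hs]
  intro h1
  conv_rhs at h1 => rw [← act_wordProd_pointState hp]
  have h2 := (act k ((cox k).wordProd p)).injective h1
  have h3 := QState.gap_swap (pointState i) i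
  rw [h2, gap_pointState, sub_self] at h3
  have := gap_emptyState_zero k
  omega

theorem toFinset_subset_of_wordProd_eq {k : ℕ} [NeZero k] {l l' : List (ZMod (k + 1))}
    (hl : l.Nodup) (h : (cox k).wordProd l = (cox k).wordProd l') :
    l.toFinset ⊆ l'.toFinset := by
  intro i hi
  rw [List.mem_toFinset] at hi ⊢
  by_contra hn
  have h1 := act_wordProd_pointState_ne hl hi
  rw [h] at h1
  exact h1 (act_wordProd_pointState hn)

/-- Any word with the same product must contain all these letters, so it cannot be shorter. -/
theorem length_wordProd_of_nodup {k : ℕ} [NeZero k] {l : List (ZMod (k + 1))} (hl : l.Nodup) :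
    (cox k).length ((cox k).wordProd l) = l.length := by
  apply le_antisymm ((cox k).length_wordProd_le l)
  obtain ⟨l', h1, h2⟩ := (cox k).exists_isReduced ((cox k).wordProd l)
  rw [h2, h1.eq, ← List.toFinset_card_of_nodup hl]
  exact (Finset.card_le_card (toFinset_subset_of_wordProd_eq hl h2)).trans
    (List.toFinset_card_le l')

theorem IsReduced.toFinset_eq {k : ℕ} [NeZero k] {l l' : List (ZMod (k + 1))} (hl : l.Nodup)
    (hl' : (cox k).IsReduced l') (h : (cox k).wordProd l = (cox k).wordProd l') :
    l'.Nodup ∧ l.toFinset = l'.toFinset := by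
  have h1 := toFinset_subset_of_wordProd_eq hl h
  have h2 := length_wordProd_of_nodup hl
  rw [h, hl'.eq] at h2
  have h3 := Finset.card_le_card h1
  have h4 := List.toFinset_card_le l'
  rw [List.toFinset_card_of_nodup hl] at h3
  refine ⟨?_, Finset.eq_of_subset_of_card_le h1 (by rw [List.toFinset_card_of_nodup hl]; omega)⟩
  rw [← List.dedup_eq_self]
  have h5 : l'.dedup.length = l'.length := by
    rw [← List.card_toFinset]
    omega
  exact (List.dedup_sublist l').eq_of_length h5

theorem act_wordProd_apply_of_notMem {k : ℕ} [NeZero k] {x : ℤ} {p : List (ZMod (k + 1))}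
    (h1 : (x : ZMod (k + 1)) ∉ p) (h2 : ((x + 1 : ℤ) : ZMod (k + 1)) ∉ p) (c : QState k) :
    act k ((cox k).wordProd p) c x = c x := by
  induction p with
  | nil => simp
  | cons j p ih =>
    rw [List.mem_cons, not_or] at h1 h2
    rw [CoxeterSystem.wordProd_cons, act_simple_mul, QState.swap_apply, swapZ_of_ne h1.1 h2.1,
      ih h1.2 h2.2]

/-- The order of two adjacent letters can be read off from the product of a word without
repetitions. -/
theorem not_mem_of_wordProd_eq {k : ℕ} [NeZero k] {i : ZMod (k + 1)} {t p s : List (ZMod (k + 1))}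
    (ht : (i :: t).Nodup) (hi : i + 1 ∈ t) (hl : (p ++ (i + 1) :: s).Nodup) (hip : i ∉ p)
    (h : (cox k).wordProd (i :: t) = (cox k).wordProd (p ++ (i + 1) :: s)) : False := by
  have hk := NeZero.pos k
  set j := i + 1 with hj
  obtain ⟨q, s', rfl⟩ := List.append_of_mem hi
  have hcast : ((liftZ j - 1 : ℤ) : ZMod (k + 1)) = i := by simp [hj]
  have hcast' : ((liftZ j - 1 + 1 : ℤ) : ZMod (k + 1)) = j := by simp
  -- The value at position `liftZ j - 1` separates the two orders: it is `0` if `j` stands before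
  -- `i`, and negative if `i` stands in front.
  have e1 : act k ((cox k).wordProd (p ++ j :: s)) (pointState j) (liftZ j - 1) = 0 := by
    rw [List.nodup_append] at hl
    have hs : j ∉ s := (List.nodup_cons.1 hl.2.1).1
    have hp : j ∉ p := fun h => hl.2.2 j h j (by simp) rfl
    rw [CoxeterSystem.wordProd_append, map_mul, Equiv.Perm.mul_apply,
      CoxeterSystem.wordProd_cons, act_simple_mul, act_wordProd_pointState hs,
      act_wordProd_apply_of_notMem (by rwa [hcast]) (by rwa [hcast']), QState.swap_apply,
      swapZ_of_add_one_eq hcast', sub_add_cancel, pointState_apply, sub_self]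
    exact emptyState_apply_of_window le_rfl (by positivity)
  rw [List.nodup_cons, List.mem_append, not_or, List.nodup_append] at ht
  have hs' : j ∉ s' := (List.nodup_cons.1 ht.2.2.1).1
  have hjq : j ∉ q := fun h => ht.2.2.2 j h j (by simp) rfl
  have hiq : i ∉ q := ht.1.1
  rw [← h, CoxeterSystem.wordProd_cons, act_simple_mul, QState.swap_apply, swapZ_of_eq hcast,
    CoxeterSystem.wordProd_append, map_mul, Equiv.Perm.mul_apply, CoxeterSystem.wordProd_cons,
    act_simple_mul, act_wordProd_pointState hs'] at e1
  -- Values cannot enter or leave this window: its two ends are crossed only by the letters `j` and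
  -- `i = j - 1`, and `q` contains neither.
  have key : ∀ x, liftZ j ≤ x → x ≤ liftZ j + (k - 1) →
      act k ((cox k).wordProd q) ((pointState j).swap j) x ≤ 0 := by
    clear e1 h ht hi
    induction q with
    | nil =>
      intro x hx hx'
      rw [CoxeterSystem.wordProd_nil, map_one, Equiv.Perm.one_apply, QState.swap_apply]
      rcases hx.eq_or_lt with rfl | hlt
      · rw [swapZ_of_eq (cast_liftZ j), pointState_apply]
        apply le_of_lt
        apply Int.ediv_neg_of_neg_of_pos _ (by positivity)
        omega
      · rw [swapZ_of_ne, pointState_apply]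
        · exact (emptyState_apply_of_window (by omega) (by omega)).le
        · intro h
          have := cast_eq_of_lt (k := k) (q := liftZ j) (by omega) (by omega) le_rfl (by omega)
            (h.trans (cast_liftZ j).symm)
          omega
        · intro h
          have := cast_eq_of_lt (k := k) (q := liftZ j) (by omega) (by omega) le_rfl (by omega)
            (h.trans (cast_liftZ j).symm)
          omega
    | cons m q ih =>
      rw [List.mem_cons, not_or] at hjq hiq
      intro x hx hx'
      rw [CoxeterSystem.wordProd_cons, act_simple_mul, QState.swap_apply]
      have := ih hjq.2 hiq.2
      by_cases h1 : (x : ZMod (k + 1)) = m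
      · rw [swapZ_of_eq h1]
        apply this
        · by_contra hc
          have : x = liftZ j := by omega
          rw [this, cast_liftZ] at h1
          exact hjq.1 h1
        · omega
      · by_cases h2 : ((x + 1 : ℤ) : ZMod (k + 1)) = m
        · rw [swapZ_of_add_one_eq h2]
          apply this
          · omega
          · by_contra hc
            have : x + 1 = liftZ j - 1 + (k + 1) := by omega
            rw [this, cast_add_period, hcast] at h2
            exact hiq.1 h2
        · rw [swapZ_of_ne h1 h2]
          exact this x hx hx'
  have h1 := key (liftZ j - 1 - 1 + (k + 1)) (by omega) (by omega)
  rw [QState.add_period] at h1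
  omega

/-- Needed because `nilHeckeElt` uses an arbitrarily chosen reduced word: by this result any such
word gives the same product of operators as `wordOf`. -/
theorem IsCD.of_isReduced {k : ℕ} [NeZero k] {l l' : List (ZMod (k + 1))} (hl : IsCD l)
    (hl' : (cox k).IsReduced l') (h : (cox k).wordProd l = (cox k).wordProd l') :
    IsCD l' := by
  induction l' generalizing l with
  | nil => trivial
  | cons i t ih =>
    obtain ⟨hnd, hset⟩ := IsReduced.toFinset_eq hl.nodup hl' h
    have hi1 : i + 1 ∉ t := by
      intro hi
      have hil : i ∈ l := by
        rw [← List.mem_toFinset, hset]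
        simp
      have hjl : i + 1 ∈ l := by
        rw [← List.mem_toFinset, hset]
        simp [hi]
      obtain ⟨p, s, rfl⟩ := List.append_of_mem hjl
      have hip : i ∉ p := by
        intro hip
        obtain ⟨p1, p2, rfl⟩ := List.append_of_mem hip
        have : IsCD (i :: (p2 ++ (i + 1) :: s)) := hl.sublist (by simp)
        exact this.2.1 (by simp)
      exact not_mem_of_wordProd_eq hnd hi hl.nodup hip h.symm
    have hit := (List.nodup_cons.1 hnd).1
    have hne : t.toFinset ≠ Finset.univ := fun h' =>
      hit (List.mem_toFinset.1 (h' ▸ Finset.mem_univ i))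
    refine ⟨hit, hi1, ih (wordOf_isCD hne) (by simpa using hl'.drop 1) ?_⟩
    have hcd : IsCD (i :: wordOf t.toFinset) := by
      refine ⟨?_, ?_, wordOf_isCD hne⟩
      · rwa [mem_wordOf hne, List.mem_toFinset]
      · rwa [mem_wordOf hne, List.mem_toFinset]
    have h1 := hcd.wordProd_eq hl (by
      rw [hset, List.toFinset_cons, List.toFinset_cons, wordOf_toFinset hne])
    rw [h, CoxeterSystem.wordProd_cons, CoxeterSystem.wordProd_cons] at h1
    exact mul_left_cancel h1

/-! ### The elements `h_r` on level functions -/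

/-- The proper subsets of size `r` of the residues. -/
def properSets (k r : ℕ) : Finset (Finset (ZMod (k + 1))) :=
  (Finset.powersetCard r Finset.univ).filter (· ≠ Finset.univ)

theorem mem_properSets {k r : ℕ} {J : Finset (ZMod (k + 1))} :
    J ∈ properSets k r ↔ J.card = r ∧ J ≠ Finset.univ := by
  simp [properSets]

/-- The cyclically decreasing operator with a given set of letters. -/
def opT (k : ℕ) (J : Finset (ZMod (k + 1))) : Module.End ℤ (QMod k) :=
  ((wordOf J).map (genA k)).prod

/-- The action of `h_r` on the level functions. -/
def opH (k r : ℕ) : Module.End ℤ (QMod k) := ∑ J ∈ properSets k r, opT k J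

theorem sum_cycDec (k r : ℕ) [NeZero k] {M : Type*} [AddCommMonoid M] (f : AffSym k → M) :
    ∑ w ∈ (cycDec_finite k r).toFinset, f w =
      ∑ J ∈ properSets k r, f ((cox k).wordProd (wordOf J)) := by
  symm
  refine Finset.sum_bij (fun J _ => (cox k).wordProd (wordOf J)) ?_ ?_ ?_ ?_
  · intro J hJ
    rw [mem_properSets] at hJ
    rw [Set.Finite.mem_toFinset]
    refine ⟨⟨wordOf J, isCycDecWord_iff.2 (wordOf_isCD hJ.2), rfl⟩, ?_⟩
    rw [length_wordProd_of_nodup (wordOf_isCD hJ.2).nodup, length_wordOf hJ.2, hJ.1]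
  · intro J hJ J' hJ' h
    rw [mem_properSets] at hJ hJ'
    have h1 := toFinset_subset_of_wordProd_eq (wordOf_isCD hJ.2).nodup h
    have h2 := toFinset_subset_of_wordProd_eq (wordOf_isCD hJ'.2).nodup h.symm
    have := Finset.Subset.antisymm h1 h2
    rwa [wordOf_toFinset hJ.2, wordOf_toFinset hJ'.2] at this
  · intro w hw
    rw [Set.Finite.mem_toFinset] at hw
    obtain ⟨⟨l, hl, rfl⟩, hr⟩ := hw
    rw [isCycDecWord_iff] at hl
    have hne := hl.toFinset_ne_univ
    refine ⟨l.toFinset, ?_, (wordOf_isCD hne).wordProd_eq hl (wordOf_toFinset hne)⟩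
    rw [mem_properSets]
    refine ⟨?_, hne⟩
    rw [length_wordProd_of_nodup hl.nodup] at hr
    rw [List.toFinset_card_of_nodup hl.nodup, hr]
  · intro J _
    rfl

theorem QState.dem_comm {k : ℕ} [NeZero k] {i j : ZMod (k + 1)} (h : i ≠ j) (h1 : i ≠ j + 1)
    (h2 : j ≠ i + 1) (c : QState k) : (c.dem i).dem j = (c.dem j).dem i := by
  have e1 := gap_swap_of_not_adj h h1 h2 c
  have e2 := gap_swap_of_not_adj h.symm h2 h1 c
  by_cases hi : 0 < c.gap i <;> by_cases hj : 0 < c.gap j <;>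
    simp only [dem, hi, hj, e1, e2, if_true, if_false]
  exact swap_comm h h1 h2 c

theorem QState.gap_dem_of_not_adj {k : ℕ} [NeZero k] {i j : ZMod (k + 1)} (h : i ≠ j)
    (h1 : i ≠ j + 1) (h2 : j ≠ i + 1) (c : QState k) : (c.dem i).gap j = c.gap j := by
  rw [dem]
  split_ifs
  · exact gap_swap_of_not_adj h h1 h2 c
  · rfl

theorem genA_comm {k : ℕ} [NeZero k] (i j : ZMod (k + 1)) (h : i ≠ j) (h1 : i ≠ j + 1)
    (h2 : j ≠ i + 1) : genA k i * genA k j = genA k j * genA k i := by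
  apply Finsupp.lhom_ext
  intro c a
  rw [Module.End.mul_apply, Module.End.mul_apply, genA_single, genA_single, genA_single,
    genA_single, QState.dem_comm h h1 h2, QState.gap_dem_of_not_adj h h1 h2,
    QState.gap_dem_of_not_adj h.symm h2 h1]
  congr 1
  ring

theorem proj_list_prod (k : ℕ) [NeZero k] (l : List (ZMod (k + 1))) (x : AffSym k →₀ ℤ) :
    proj k ((l.map (nilHeckeGen k)).prod x) = (l.map (genA k)).prod (proj k x) := by
  induction l with
  | nil => simp
  | cons i l ih =>
    rw [List.map_cons, List.prod_cons, Module.End.mul_apply, proj_nilHeckeGen, ih, List.map_cons,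
      List.prod_cons, Module.End.mul_apply]

theorem proj_nilHeckeElt (k : ℕ) [NeZero k] {J : Finset (ZMod (k + 1))} (hJ : J ≠ Finset.univ)
    (x : AffSym k →₀ ℤ) :
    proj k (nilHeckeElt k ((cox k).wordProd (wordOf J)) x) = opT k J (proj k x) := by
  rw [nilHeckeElt, proj_list_prod, opT]
  have h1 := (wordProd_reducedWord k ((cox k).wordProd (wordOf J))).symm
  have h2 := reducedWord_isReduced k ((cox k).wordProd (wordOf J))
  rw [((wordOf_isCD hJ).of_isReduced h2 h1).prod_map_eq _ genA_comm (wordOf_isCD hJ)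
    (IsReduced.toFinset_eq (wordOf_isCD hJ).nodup h2 h1).2.symm]

theorem proj_nilHeckeH (k r : ℕ) [NeZero k] (x : AffSym k →₀ ℤ) :
    proj k (nilHeckeH k r x) = opH k r (proj k x) := by
  rw [nilHeckeH, LinearMap.sum_apply, map_sum, sum_cycDec k r fun w => proj k (nilHeckeElt k w x),
    opH, LinearMap.sum_apply]
  refine Finset.sum_congr rfl fun J hJ => ?_
  rw [proj_nilHeckeElt k (mem_properSets.1 hJ).2]

theorem proj_list_prod_nilHeckeH (k : ℕ) [NeZero k] (L : List ℕ) (x : AffSym k →₀ ℤ) :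
    proj k ((L.map (nilHeckeH k)).prod x) = (L.map (opH k)).prod (proj k x) := by
  induction L with
  | nil => simp
  | cons i l ih =>
    rw [List.map_cons, List.prod_cons, Module.End.mul_apply, proj_nilHeckeH, ih, List.map_cons,
      List.prod_cons, Module.End.mul_apply]

/-- The coefficients of the affine Grothendieck polynomials in terms of level functions. -/
def coefH {k : ℕ} (L : List ℕ) (c : QState k) : ℤ :=
  (L.map (opH k)).prod (Finsupp.single (emptyState k) 1) c

theorem coeff_affineGrothendieck {k : ℕ} [NeZero k] {l : BoundedPartition k} {c : QState k}
    (h : Rep c (coreOf k l)) (a : ℕ →₀ ℕ) :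
    MvPowerSeries.coeff a (affineGrothendieck k l) =
      coefH ((List.range (a.support.sup (· + 1))).reverse.map a) c := by
  have h1 := proj_list_prod_nilHeckeH k ((List.range (a.support.sup (· + 1))).reverse.map a)
    (Finsupp.single 1 1)
  rw [proj_single_of_isMinRep (isMinRep_one k)] at h1
  rw [coefH, ← h1, proj_apply (isMinRep_grassOf h), List.map_map]
  rfl

/-! ### Carriers -/

/-- The sequence of carriers `u` when the cyclically decreasing operator with letters `J` is applied
to `c`, with result `d`. -/
structure IsCarrier {k : ℕ} (J : Finset (ZMod (k + 1))) (c : QState k) (u : QState k)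
    (d : QState k) : Prop where
  step : ∀ j : ℤ, u (j + 1) = if (j : ZMod (k + 1)) ∈ J then min (u j) (c j) else c j
  deposit : ∀ j : ℤ, d (j - 1) = if (j : ZMod (k + 1)) ∈ J then max (u j) (c j) else u j

/-- The sign attached to a sequence of carriers. -/
def carrierSign {k : ℕ} (J : Finset (ZMod (k + 1))) (c u : QState k) : ℤ :=
  ∏ i ∈ J, (c (liftZ i) - u (liftZ i)).sign

theorem sub_eq_sub_of_cast_eq {k : ℕ} (c d : QState k) {a b : ℤ}
    (h : (a : ZMod (k + 1)) = b) : c a - d a = c b - d b := by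
  obtain ⟨t, rfl⟩ := (intCast_eq_iff_exists k a b).1 h
  rw [c.add_mul, d.add_mul]
  ring

/-- When the letter `i` is put in front, neither `i` nor `i + 1` has acted. So a position `j ≡ i`
still holds `c j`, while `j - 1` holds the incoming carrier `u j`. The Demazure step leaves the
maximum at `j - 1` and passes the minimum on, with the sign of `c j - u j`. -/
theorem IsCD.exists_isCarrier {k : ℕ} [NeZero k] {l : List (ZMod (k + 1))} (hl : IsCD l)
    (c : QState k) : ∃ u d, IsCarrier l.toFinset c u d ∧ ∀ a : ℤ,
      (l.map (genA k)).prod (Finsupp.single c a) =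
        Finsupp.single d (a * carrierSign l.toFinset c u) := by
  induction l with
  | nil =>
    refine ⟨⟨fun j => c (j - 1), fun j => ?_⟩, c, ⟨fun j => by simp, fun j => by simp⟩,
      fun a => by simp [carrierSign]⟩
    rw [show j + ((k : ℤ) + 1) - 1 = j - 1 + (k + 1) by ring, c.add_period]
  | cons i t ih =>
    obtain ⟨hi, hi1, ht⟩ := hl
    obtain ⟨u, d, ⟨hstep, hdep⟩, hprod⟩ := ih ht
    simp only [List.mem_toFinset] at hstep hdep
    have hne : i ≠ i + 1 := by simpa using one_ne_zero_zmod k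
    have hgap : ∀ j : ℤ, (j : ZMod (k + 1)) = i → d.gap i = c j - u j := by
      intro j hj
      have h1 := hdep (j + 1)
      rw [add_sub_cancel_right, if_neg (by push_cast; rwa [hj]), hstep, if_neg (by rwa [hj])] at h1
      have h2 := hdep j
      rw [if_neg (by rwa [hj])] at h2
      rw [d.gap_eq hj, h1, h2]
    -- Only the carrier that leaves the positions of residue `i` changes.
    refine ⟨⟨fun j => if ((j - 1 : ℤ) : ZMod (k + 1)) = i then min (u (j - 1)) (c (j - 1)) else u j,
      fun j => ?_⟩, d.dem i, ⟨fun j => ?_, fun j => ?_⟩, fun a => ?_⟩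
    · rw [show j + ((k : ℤ) + 1) - 1 = j - 1 + (k + 1) by ring, cast_add_period, c.add_period,
        u.add_period, u.add_period]
      split_ifs
      · rw [min_add_add_right]
      · rfl
    · simp only [List.toFinset_cons, Finset.mem_insert, List.mem_toFinset, add_sub_cancel_right]
      by_cases h : (j : ZMod (k + 1)) = i
      · have h1 : ¬ ((j - 1 : ℤ) : ZMod (k + 1)) = i := by
          push_cast
          intro h2
          exact one_ne_zero_zmod k (by linear_combination h - h2)
        rw [if_pos h, if_neg h1, if_pos (Or.inl h)]
      · rw [if_neg h, hstep]
        by_cases h2 : (j : ZMod (k + 1)) ∈ t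
        · have h1 : ¬ ((j - 1 : ℤ) : ZMod (k + 1)) = i := by
            push_cast
            intro h3
            apply hi1
            rw [← h3]
            simpa using h2
          rw [if_pos h2, if_pos (Or.inr h2), if_neg h1]
        · rw [if_neg h2, if_neg (by tauto)]
    · simp only [List.toFinset_cons, Finset.mem_insert, List.mem_toFinset]
      by_cases h : (j : ZMod (k + 1)) = i
      · have h1 : ¬ ((j - 1 : ℤ) : ZMod (k + 1)) = i := by
          push_cast
          rw [h]
          intro h2
          exact one_ne_zero_zmod k (by linear_combination -h2)
        rw [if_pos (Or.inl h), if_neg h1]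
        have hg := hgap j h
        have h2 := hdep j
        rw [if_neg (by rwa [h])] at h2
        have h3 := d.gap_eq h
        by_cases hpos : 0 < d.gap i
        · rw [QState.dem_of_pos hpos, QState.swap_apply, swapZ_of_add_one_eq (by simpa using h)]
          rw [sub_add_cancel, max_eq_right (by omega)]
          omega
        · rw [QState.dem_of_nonpos (not_lt.1 hpos), max_eq_left (by omega)]
          exact h2
      · by_cases h1 : ((j - 1 : ℤ) : ZMod (k + 1)) = i
        · have hj : (j : ZMod (k + 1)) = i + 1 := by
            rw [← h1]
            push_cast
            ring
          rw [if_neg (by rw [hj]; simpa [one_ne_zero_zmod k] using hi1), if_pos h1]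
          have hg := hgap _ h1
          have h2 := hdep (j - 1)
          rw [if_neg (by rwa [h1])] at h2
          have h3 := d.gap_eq h1
          by_cases hpos : 0 < d.gap i
          · rw [QState.dem_of_pos hpos, QState.swap_apply, swapZ_of_eq h1,
              min_eq_left (by omega)]
            exact h2
          · rw [QState.dem_of_nonpos (not_lt.1 hpos), min_eq_right (by omega)]
            omega
        · have e : (d.dem i) (j - 1) = d (j - 1) := by
            rw [QState.dem]
            split_ifs
            · rw [QState.swap_apply, swapZ_of_ne h1 (by simpa using h)]
            · rfl
          rw [e, hdep, if_neg h1]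
          by_cases h2 : (j : ZMod (k + 1)) ∈ t
          · rw [if_pos h2, if_pos (Or.inr h2)]
          · rw [if_neg h2, if_neg (by tauto)]
    · rw [List.map_cons, List.prod_cons, Module.End.mul_apply, hprod, genA_single,
        hgap (liftZ i) (cast_liftZ i), List.toFinset_cons, carrierSign, carrierSign,
        Finset.prod_insert (by rwa [List.mem_toFinset])]
      have hu : ∀ m : ZMod (k + 1), m ≠ i + 1 → ¬ ((liftZ m - 1 : ℤ) : ZMod (k + 1)) = i := by
        intro m hm h
        apply hm
        rw [← h]
        simp
      congr 1
      simp only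
      rw [if_neg (hu i hne), mul_assoc, mul_comm (Finset.prod _ _)]
      congr 2
      refine Finset.prod_congr rfl fun m hm => ?_
      rw [if_neg (hu m _)]
      rintro rfl
      exact hi1 (List.mem_toFinset.1 hm)

theorem exists_isCarrier {k : ℕ} [NeZero k] {J : Finset (ZMod (k + 1))} (hJ : J ≠ Finset.univ)
    (c : QState k) : ∃ u d, IsCarrier J c u d ∧ ∀ a : ℤ,
      opT k J (Finsupp.single c a) = Finsupp.single d (a * carrierSign J c u) := by
  have := (wordOf_isCD hJ).exists_isCarrier c
  rwa [wordOf_toFinset hJ] at this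

/-! ### Transfer matrices -/

section Transfer

variable {S K : Type*} [LinearOrder S] [CommRing K]

/-- The sign of a pair: `1` if increasing, `-1` if decreasing. -/
def pairSign (p q : S) : K := if p < q then 1 else if q < p then -1 else 0

/-- `1 + x A` on the first two places. -/
def op12 (x : K) (F : S → S → S → K) (p q r : S) : K :=
  F p q r + x * (pairSign p q * F (max p q) (min p q) r)

/-- `1 + x A` on the last two places. -/
def op23 (x : K) (F : S → S → S → K) (p q r : S) : K :=
  F p q r + x * (pairSign q r * F p (max q r) (min q r))

/-- The exchange operator on the first two places. -/
def exch12 (y x : K) (F : S → S → S → K) (p q r : S) : K :=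
  (1 - y) * F p q r + (x - y) * (pairSign p q * F (max p q) (min p q) r)

/-- The exchange operator on the last two places. -/
def exch23 (y x : K) (F : S → S → S → K) (p q r : S) : K :=
  (1 - y) * F p q r + (x - y) * (pairSign q r * F p (max q r) (min q r))

/-- The Yang–Baxter equation. -/
theorem yang_baxter (x y : K) (F : S → S → S → K) (p q r : S) :
    exch12 y x (op23 x (op12 y F)) p q r = op23 y (op12 x (exch23 y x F)) p q r := by
  simp only [exch12, op23, op12, exch23, pairSign]
  rcases lt_trichotomy p q with h1 | h1 | h1 <;> rcases lt_trichotomy q r with h2 | h2 | h2 <;>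
    rcases lt_trichotomy p r with h3 | h3 | h3 <;>
    first
    | (exfalso; subst_vars; order)
    | skip
  all_goals
    try subst h1
    try subst h2
    try subst h3
    simp only [max_eq_left, max_eq_right, min_eq_left, min_eq_right, le_of_lt,
      not_lt_of_gt, lt_irrefl, if_true, if_false, max_self, min_self, *]
    ring


variable [Fintype S]

/-- The indicator of a deposit and a pair of carriers. -/
def target (e : S) (p : S × S) (e' v u : S) : K := if e' = e ∧ p = (u, v) then 1 else 0

/-- The transfer matrix of a column in two layers, between pairs of carriers. -/
def colM (y x : K) (a e : S) : Matrix (S × S) (S × S) K :=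
  Matrix.of fun p p' => op23 y (op12 x (target e p')) p.2 p.1 a

variable (S) in
/-- The exchange matrix. -/
def exchM (y x : K) : Matrix (S × S) (S × S) K :=
  Matrix.of fun p p' => (1 - y) * (if p = p' then 1 else 0) +
    (x - y) * (pairSign p.2 p.1 * if (min p.2 p.1, max p.2 p.1) = p' then 1 else 0)

theorem exchM_mul_apply (y x : K) (X : Matrix (S × S) (S × S) K) (p p' : S × S) :
    (exchM S y x * X) p p' = (1 - y) * X p p' +
      (x - y) * (pairSign p.2 p.1 * X (min p.2 p.1, max p.2 p.1) p') := by
  rw [Matrix.mul_apply]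
  simp only [exchM, Matrix.of_apply, add_mul, Finset.sum_add_distrib, mul_assoc, ite_mul, one_mul,
    zero_mul, mul_ite, mul_zero, Finset.sum_ite_eq, Finset.mem_univ, if_true]

theorem sum_target_mul (e e' v u : S) (G : S × S → K) :
    ∑ p, target e p e' v u * G p = if e' = e then G (u, v) else 0 := by
  by_cases h : e' = e
  · simp [target, h]
  · simp [target, h]

theorem colM_mul_apply (y x : K) (a e : S) (X : Matrix (S × S) (S × S) K) (p p' : S × S) :
    (colM y x a e * X) p p' =
      op23 y (op12 x fun e' v u => if e' = e then X (u, v) p' else 0) p.2 p.1 a := by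
  rw [Matrix.mul_apply]
  simp only [colM, Matrix.of_apply, op23, op12, add_mul, Finset.sum_add_distrib, mul_assoc,
    ← Finset.mul_sum, sum_target_mul]

/-- The three strands of the Yang–Baxter equation are the second carrier, the first carrier and the
content `a` of the column. The deposit `e` is common to both sides. -/
theorem colM_mul_exchM (y x : K) (a e : S) :
    colM y x a e * exchM S y x = exchM S y x * colM x y a e := by
  ext p p'
  rw [colM_mul_apply, exchM_mul_apply]
  have h := yang_baxter x y (target e p') p.2 p.1 a
  simp only [exch12] at h
  simp only [colM, Matrix.of_apply]
  rw [h]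
  congr 1
  congr 1
  funext e' v u
  simp only [exchM, exch23, Matrix.of_apply, target, eq_comm (a := p')]
  by_cases he : e' = e <;> simp [he]

/-- Unitarity of the exchange matrix. The scalar is nonzero for formal parameters, and this replaces
invertibility in the trace argument. -/
theorem exchM_mul_exchM (y x : K) :
    exchM S y x * exchM S x y = ((1 - y) * (1 - x)) • (1 : Matrix (S × S) (S × S) K) := by
  ext ⟨u, v⟩ p'
  rw [exchM_mul_apply, Matrix.smul_apply, Matrix.one_apply]
  simp only [exchM, Matrix.of_apply, pairSign, smul_eq_mul]
  rcases lt_trichotomy u v with h | h | h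
  · simp only [h, max_eq_left, min_eq_right, h.le, not_lt_of_gt h, if_true, if_false]
    ring
  · subst h
    simp
  · simp only [h, max_eq_left, min_eq_right, h.le, not_lt_of_gt h, if_true, if_false,
      max_eq_right, min_eq_left]
    ring

variable (K) in
/-- The twist matrix of a relation. -/
def twistM (T : S → S → Prop) [DecidableRel T] : Matrix (S × S) (S × S) K :=
  Matrix.of fun p p' => if T p.1 p'.1 ∧ T p.2 p'.2 then 1 else 0

/-- The exchange matrix sees only the relative order of the two carriers, and the twist moves both
by the same order-preserving partial map. -/
theorem twistM_mul_exchM (T : S → S → Prop) [DecidableRel T]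
    (hT : ∀ a a' b b', T a a' → T b b' → (a < b ↔ a' < b'))
    (hfun : ∀ a b b', T a b → T a b' → b = b') (y x : K) :
    twistM K T * exchM S y x = exchM S y x * twistM K T := by
  classical
  ext ⟨u, v⟩ ⟨u', v'⟩
  rw [exchM_mul_apply, Matrix.mul_apply]
  by_cases hex : ∃ a b, T u a ∧ T v b
  · obtain ⟨a, b, ha, hb⟩ := hex
    rw [Finset.sum_eq_single (a, b)]
    · have h1 := hT _ _ _ _ ha hb
      have h2 := hT _ _ _ _ hb ha
      have hu : ∀ z, T u z ↔ z = a := fun z => ⟨fun h => hfun _ _ _ h ha, fun h => h ▸ ha⟩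
      have hv : ∀ z, T v z ↔ z = b := fun z => ⟨fun h => hfun _ _ _ h hb, fun h => h ▸ hb⟩
      simp only [twistM, exchM, Matrix.of_apply, pairSign, h1, h2, ha, hb, true_and, if_true,
        one_mul, Prod.mk.injEq]
      rcases lt_trichotomy a b with h | h | h
      · have h' := h1.2 h
        simp only [h, max_eq_left, min_eq_right, h.le, h'.le, not_lt_of_gt h, if_true,
          if_false, hu, hv, eq_comm (a := a), eq_comm (a := b)]
      · subst h
        simp [hu, hv, eq_comm (a := a)]
      · have h' := h2.2 h
        simp only [h, h.le, h'.le, not_lt_of_gt h, if_true,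
          if_false, max_eq_right, min_eq_left, hu, hv, eq_comm (a := a), eq_comm (a := b)]
    · rintro ⟨a', b'⟩ - hne
      have : ¬ (T u a' ∧ T v b') := by
        rintro ⟨h1, h2⟩
        exact hne (by rw [hfun _ _ _ h1 ha, hfun _ _ _ h2 hb])
      simp [twistM, this]
    · simp
  · push Not at hex
    have h1 : ∀ a b, ¬ (T u a ∧ T v b) := fun a b h => hex a b h.1 h.2
    have h2 : ∀ a b, ¬ (T v a ∧ T u b) := fun a b h => hex b a h.2 h.1
    rw [Finset.sum_eq_zero]
    · rcases le_total u v with h | h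
      · simp [twistM, h1, h]
      · simp [twistM, h1, h2, h]
    · rintro ⟨a, b⟩ -
      simp [twistM, h1]

/-- The product of the transfer matrices of the first `t` columns. -/
def colProd (y x : K) (a e : ℕ → S) : ℕ → Matrix (S × S) (S × S) K
  | 0 => 1
  | t + 1 => colProd y x a e t * colM y x (a t) (e t)

theorem colProd_mul_exchM (y x : K) (a e : ℕ → S) (t : ℕ) :
    colProd y x a e t * exchM S y x = exchM S y x * colProd x y a e t := by
  induction t with
  | zero => simp [colProd]
  | succ t ih =>
    rw [colProd, Matrix.mul_assoc, colM_mul_exchM, ← Matrix.mul_assoc, ih, Matrix.mul_assoc]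
    rfl

/-- The traces of the twisted products are symmetric in the two parameters. -/
theorem trace_colProd_comm [IsDomain K] {y x : K} (hy : 1 - y ≠ 0) (hx : 1 - x ≠ 0)
    (a e : ℕ → S) (t : ℕ) (T : S → S → Prop) [DecidableRel T]
    (hT : ∀ a a' b b', T a a' → T b b' → (a < b ↔ a' < b'))
    (hfun : ∀ a b b', T a b → T a b' → b = b') :
    (colProd y x a e t * twistM K T).trace = (colProd x y a e t * twistM K T).trace := by
  have h0 : (1 - y) * (1 - x) ≠ 0 := mul_ne_zero hy hx
  apply mul_left_cancel₀ h0
  -- The scalar is written as a product of two exchange matrices. One of them is moved through the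
  -- twist and all the columns, which interchanges the parameters, and cyclicity of the trace brings
  -- it back to its partner.
  have e1 : (1 - y) * (1 - x) * (colProd y x a e t * twistM K T).trace =
      (colProd y x a e t * twistM K T * (exchM S y x * exchM S x y)).trace := by
    rw [exchM_mul_exchM, Matrix.mul_smul, Matrix.mul_one, Matrix.trace_smul, smul_eq_mul]
  have e2 : (1 - y) * (1 - x) * (colProd x y a e t * twistM K T).trace =
      (colProd x y a e t * twistM K T * (exchM S x y * exchM S y x)).trace := by
    rw [exchM_mul_exchM, Matrix.mul_smul, Matrix.mul_one, Matrix.trace_smul, smul_eq_mul,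
      mul_comm (1 - x)]
  rw [e1, e2, ← Matrix.mul_assoc, Matrix.mul_assoc (colProd y x a e t), twistM_mul_exchM T hT hfun,
    ← Matrix.mul_assoc, colProd_mul_exchM, Matrix.mul_assoc, Matrix.mul_assoc,
    Matrix.trace_mul_comm, Matrix.mul_assoc, Matrix.mul_assoc, Matrix.mul_assoc]

/-! ### Expansion of the trace over the sets of letters -/

/-- The pair of carriers after `t` columns, when the letters of the two layers are `E` and `E'`. -/
def path (a : ℕ → S) (E E' : Finset ℕ) (p : S × S) : ℕ → S × S
  | 0 => p
  | t + 1 =>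
    let q := path a E E' p t
    (if t ∈ E then min q.1 (a t) else a t,
      if t ∈ E' then min q.2 (if t ∈ E then max q.1 (a t) else q.1)
      else if t ∈ E then max q.1 (a t) else q.1)

/-- The deposit of the first layer in column `t`. -/
def dep1 (a : ℕ → S) (E E' : Finset ℕ) (p : S × S) (t : ℕ) : S :=
  if t ∈ E then max (path a E E' p t).1 (a t) else (path a E E' p t).1

/-- The deposit of the second layer in column `t`. -/
def dep2 (a : ℕ → S) (E E' : Finset ℕ) (p : S × S) (t : ℕ) : S :=
  if t ∈ E' then max (path a E E' p t).2 (dep1 a E E' p t) else (path a E E' p t).2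

/-- The weight of column `t`. -/
def colWeight (a e : ℕ → S) (E E' : Finset ℕ) (p : S × S) (t : ℕ) : K :=
  (if t ∈ E then pairSign (path a E E' p t).1 (a t) else 1) *
    (if t ∈ E' then pairSign (path a E E' p t).2 (dep1 a E E' p t) else 1) *
    (if dep2 a E E' p t = e t then 1 else 0)

theorem path_congr (a : ℕ → S) {E E' F F' : Finset ℕ} (p : S × S) {t : ℕ}
    (h : ∀ s < t, s ∈ E ↔ s ∈ F) (h' : ∀ s < t, s ∈ E' ↔ s ∈ F') :
    path a E E' p t = path a F F' p t := by
  induction t with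
  | zero => rfl
  | succ t ih =>
    simp only [path, ih (fun s hs => h s (by omega)) (fun s hs => h' s (by omega)),
      h t (by omega), h' t (by omega)]

theorem colWeight_congr (a e : ℕ → S) {E E' F F' : Finset ℕ} (p : S × S) {t : ℕ}
    (h : ∀ s < t + 1, s ∈ E ↔ s ∈ F) (h' : ∀ s < t + 1, s ∈ E' ↔ s ∈ F') :
    (colWeight a e E E' p t : K) = colWeight a e F F' p t := by
  have hq : path a E E' p t = path a F F' p t :=
    path_congr a p (fun s hs => h s (by omega)) (fun s hs => h' s (by omega))
  have e1 := h t (by omega)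
  have e2 := h' t (by omega)
  by_cases h1 : t ∈ F <;> by_cases h2 : t ∈ F' <;>
    simp only [colWeight, dep2, dep1, hq, e1, e2, h1, h2, if_true, if_false]

theorem sum_powerset_range_succ {M : Type*} [AddCommMonoid M] (t : ℕ) (f : Finset ℕ → M) :
    ∑ E ∈ (Finset.range (t + 1)).powerset, f E =
      ∑ E ∈ (Finset.range t).powerset, (f E + f (insert t E)) := by
  rw [Finset.range_add_one, Finset.sum_powerset_insert (by simp), Finset.sum_add_distrib]

/-- Expanding the factors `1 + x A` amounts to choosing, for each column and layer, whether the
letter is used. After these choices the carriers evolve deterministically, so each choice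
contributes to one entry only. -/
theorem colProd_apply (y x : K) (a e : ℕ → S) (t : ℕ) (p p' : S × S) :
    colProd y x a e t p p' = ∑ E ∈ (Finset.range t).powerset, ∑ E' ∈ (Finset.range t).powerset,
      y ^ E.card * x ^ E'.card * (∏ s ∈ Finset.range t, colWeight a e E E' p s) *
        if path a E E' p t = p' then 1 else 0 := by
  induction t generalizing p' with
  | zero =>
    simp [colProd, path, Matrix.one_apply]
    congr
  | succ t ih =>
    rw [colProd, Matrix.mul_apply]
    simp only [ih, Finset.sum_mul]
    rw [Finset.sum_comm, sum_powerset_range_succ]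
    refine Finset.sum_congr rfl fun E hE => ?_
    rw [Finset.sum_comm, sum_powerset_range_succ, sum_powerset_range_succ,
      ← Finset.sum_add_distrib]
    refine Finset.sum_congr rfl fun E' hE' => ?_
    rw [Finset.mem_powerset] at hE hE'
    have hEt : t ∉ E := fun h => by simpa using hE h
    have hEt' : t ∉ E' := fun h => by simpa using hE' h
    have hin : ∀ (F : Finset ℕ), ∀ s < t, s ∈ insert t F ↔ s ∈ F := by
      intro F s hs
      rw [Finset.mem_insert]
      constructor
      · rintro (h | h)
        · omega
        · exact h
      · exact Or.inr
    have hid : ∀ (F : Finset ℕ), ∀ s < t, s ∈ F ↔ s ∈ F := fun _ _ _ => Iff.rfl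
    have hw : ∀ F F' : Finset ℕ, (∀ s < t, s ∈ F ↔ s ∈ E) → (∀ s < t, s ∈ F' ↔ s ∈ E') →
        (∏ s ∈ Finset.range t, colWeight a e F F' p s : K) =
          ∏ s ∈ Finset.range t, colWeight a e E E' p s := by
      intro F F' h h'
      refine Finset.prod_congr rfl fun s hs => ?_
      rw [Finset.mem_range] at hs
      exact colWeight_congr a e p (fun r hr => h r (by omega)) (fun r hr => h' r (by omega))
    have hq1 := path_congr a p (hin E) (hid E')
    have hq2 := path_congr a p (hid E) (hin E')
    have hq3 := path_congr a p (hin E) (hin E')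
    simp only [mul_assoc, ite_mul, one_mul, zero_mul, mul_ite, mul_zero, Finset.sum_ite_eq,
      Finset.mem_univ, if_true]
    have hw1 := hw _ _ (hin E) (hid E')
    have hw2 := hw _ _ (hid E) (hin E')
    have hw3 := hw _ _ (hin E) (hin E')
    simp only [Finset.prod_range_succ, hw1, hw2, hw3, Finset.card_insert_of_notMem hEt,
      Finset.card_insert_of_notMem hEt']
    generalize (∏ s ∈ Finset.range t, colWeight a e E E' p s : K) = w
    simp only [colWeight, dep2, dep1, path, hq1, hq2, hq3, hEt, hEt',
      Finset.mem_insert_self, if_true, if_false]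
    generalize path a E E' p t = q
    simp only [colM, Matrix.of_apply, op23, op12, target, pow_succ, eq_comm (b := p'), mul_one,
      one_mul, ite_and]
    -- Turning the indicators into factors lets `ring` match the four choices at column `t`.
    have hb : ∀ (P : Prop) [Decidable P] (z : K), (if P then z else 0) = z * if P then 1 else 0 :=
      fun P _ z => by by_cases h : P <;> simp [h]
    rw [hb (p' = (a t, q.1)) (_ * _), hb (p' = (a t, min q.2 q.1)) (_ * _),
      hb (p' = (min q.1 (a t), max q.1 (a t))) (_ * _),
      hb (p' = (min q.1 (a t), min q.2 (max q.1 (a t)))) (_ * _)]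
    rw [hb (q.2 = e t) (if p' = (a t, q.1) then 1 else 0),
      hb (max q.2 q.1 = e t) (if p' = (a t, min q.2 q.1) then 1 else 0),
      hb (q.2 = e t) (if p' = (min q.1 (a t), max q.1 (a t)) then 1 else 0),
      hb (max q.2 (max q.1 (a t)) = e t)
        (if p' = (min q.1 (a t), min q.2 (max q.1 (a t))) then 1 else 0)]
    ring

end Transfer

/-! ### The operators `opH` commute -/

theorem prod_zmod_eq_prod_range {M : Type*} [CommMonoid M] (k : ℕ) (m : ℤ) (F : ZMod (k + 1) → M) :
    ∏ i, F i = ∏ t ∈ Finset.range (k + 1), F (((t : ℤ) - m : ℤ) : ZMod (k + 1)) := by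
  symm
  refine Finset.prod_nbij' (fun t => (((t : ℤ) - m : ℤ) : ZMod (k + 1)))
    (fun i => (i + (m : ZMod (k + 1))).val) ?_ ?_ ?_ ?_ ?_
  · simp
  · intro i _
    exact Finset.mem_range.2 (ZMod.val_lt _)
  · intro t ht
    simp only [Int.cast_sub, Int.cast_natCast, sub_add_cancel]
    exact ZMod.val_cast_of_lt (Finset.mem_range.1 ht)
  · intro i _
    simp
  · simp

theorem sum_zmod_eq_sum_range {M : Type*} [AddCommMonoid M] (k : ℕ) (m : ℤ)
    (F : ZMod (k + 1) → M) :
    ∑ i, F i = ∑ t ∈ Finset.range (k + 1), F (((t : ℤ) - m : ℤ) : ZMod (k + 1)) :=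
  prod_zmod_eq_prod_range (M := Multiplicative M) k m F

/-- The columns whose letter, shifted by `m`, lies in `J`. -/
def letterCols {k : ℕ} (m : ℤ) (J : Finset (ZMod (k + 1))) : Finset ℕ :=
  (Finset.range (k + 1)).filter fun t => (((t : ℤ) - m : ℤ) : ZMod (k + 1)) ∈ J

theorem card_letterCols {k : ℕ} (m : ℤ) (J : Finset (ZMod (k + 1))) :
    (letterCols m J).card = J.card := by
  rw [letterCols, Finset.card_filter,
    ← sum_zmod_eq_sum_range k m (fun i => if i ∈ J then 1 else 0)]
  simp

theorem mem_letterCols {k : ℕ} {m : ℤ} {J : Finset (ZMod (k + 1))} {t : ℕ} (ht : t < k + 1) :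
    t ∈ letterCols m J ↔ (((t : ℤ) - m : ℤ) : ZMod (k + 1)) ∈ J := by
  simp [letterCols, ht]

theorem sum_powerset_eq_sum_letterCols {M : Type*} [AddCommMonoid M] (k : ℕ) (m : ℤ)
    (f : Finset ℕ → M) : ∑ E ∈ (Finset.range (k + 1)).powerset, f E =
      ∑ J : Finset (ZMod (k + 1)), f (letterCols m J) := by
  symm
  refine Finset.sum_nbij' (fun J => letterCols m J)
    (fun E => E.image fun t : ℕ => (((t : ℤ) - m : ℤ) : ZMod (k + 1))) ?_ ?_ ?_ ?_ ?_
  · intro J _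
    exact Finset.mem_powerset.2 (Finset.filter_subset _ _)
  · simp
  · intro J _
    ext i
    simp only [letterCols, Finset.mem_image, Finset.mem_filter, Finset.mem_range]
    constructor
    · rintro ⟨t, ⟨_, h⟩, rfl⟩
      exact h
    · intro h
      refine ⟨(i + (m : ZMod (k + 1))).val, ⟨ZMod.val_lt _, ?_⟩, ?_⟩ <;> simp [h]
  · intro E hE
    rw [Finset.mem_powerset] at hE
    ext t
    simp only [letterCols, Finset.mem_image, Finset.mem_filter, Finset.mem_range]
    constructor
    · rintro ⟨ht, s, hs, h⟩
      have hs' := Finset.mem_range.1 (hE hs)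
      simp only [Int.cast_sub, Int.cast_natCast, sub_left_inj] at h
      have : s = t := by
        rw [← ZMod.val_cast_of_lt ht, ← ZMod.val_cast_of_lt hs', h]
      exact this ▸ hs
    · intro h
      exact ⟨Finset.mem_range.1 (hE h), t, h, rfl⟩
  · simp

theorem prod_liftZ_eq {k : ℕ} {M : Type*} [CommMonoid M] (m : ℤ) (J : Finset (ZMod (k + 1)))
    (f : ℤ → M) (hf : ∀ a b : ℤ, (a : ZMod (k + 1)) = b → f a = f b) :
    ∏ i ∈ J, f (liftZ i) =
      ∏ t ∈ Finset.range (k + 1), if t ∈ letterCols m J then f ((t : ℤ) - m) else 1 := by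
  rw [← Fintype.prod_ite_mem, prod_zmod_eq_prod_range k m]
  refine Finset.prod_congr rfl fun t ht => ?_
  simp only [mem_letterCols (Finset.mem_range.1 ht)]
  split_ifs
  · exact hf _ _ (cast_liftZ _)
  · rfl

/-- A column outside `P` makes the carrier forget its past. Two solutions agree from there to the
end of the period, hence by the closing condition at its start, hence everywhere. -/
theorem closed_unique {n : ℕ} {P : ℕ → Prop} [DecidablePred P] {x w w' : ℕ → ℤ}
    (h : ∀ t < n, w (t + 1) = if P t then min (w t) (x t) else x t)
    (h' : ∀ t < n, w' (t + 1) = if P t then min (w' t) (x t) else x t)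
    (hn : w n = w 0 + 1) (hn' : w' n = w' 0 + 1) (hP : ∃ t < n, ¬ P t) :
    ∀ t ≤ n, w t = w' t := by
  obtain ⟨s, hs, hsP⟩ := hP
  have key : ∀ a b, w a = w' a → a ≤ b → b ≤ n → w b = w' b := by
    intro a b ha hab
    induction b, hab using Nat.le_induction with
    | base => exact fun _ => ha
    | succ b hab ih =>
      intro hb
      rw [h b hb, h' b hb, ih (by omega)]
  have h1 : w (s + 1) = w' (s + 1) := by rw [h s hs, h' s hs, if_neg hsP, if_neg hsP]
  have h2 := key _ n h1 hs le_rfl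
  have h0 : w 0 = w' 0 := by omega
  exact fun t ht => key 0 t h0 (Nat.zero_le _) ht

/-- If every letter is used, the carrier never increases and cannot close up with a gain of one.
This is why the full set of residues does not contribute to the trace. -/
theorem not_closed_of_forall {n : ℕ} {P : ℕ → Prop} [DecidablePred P] {x w : ℕ → ℤ}
    (h : ∀ t < n, w (t + 1) = if P t then min (w t) (x t) else x t)
    (hn : w n = w 0 + 1) : ∃ t < n, ¬ P t := by
  by_contra! hP
  have : ∀ t ≤ n, w t ≤ w 0 := by
    intro t
    induction t with
    | zero => simp
    | succ t ih =>
      intro ht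
      rw [h t ht, if_pos (hP t ht)]
      exact (min_le_left _ _).trans (ih (by omega))
  have := this n le_rfl
  omega

theorem ne_univ_of_letterCols {k : ℕ} {m : ℤ} {J : Finset (ZMod (k + 1))} :
    (∃ t < k + 1, ¬ t ∈ letterCols m J) ↔ J ≠ Finset.univ := by
  constructor
  · rintro ⟨t, ht, h⟩ rfl
    exact h ((mem_letterCols ht).2 (Finset.mem_univ _))
  · intro h
    by_contra! hc
    apply h
    have h1 : letterCols m J = Finset.range (k + 1) := by
      ext t
      refine ⟨fun h => ?_, fun h => hc t (Finset.mem_range.1 h)⟩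
      exact (Finset.mem_filter.1 h).1
    rw [← Finset.card_eq_iff_eq_univ, ← card_letterCols m, h1, Finset.card_range, ZMod.card]

theorem QState.ext_range {k : ℕ} {c d : QState k} (m : ℤ)
    (h : ∀ t < k + 1, c ((t : ℤ) - m) = d ((t : ℤ) - m)) : c = d := by
  apply QState.ext
  intro j
  have e : j = ((((j : ZMod (k + 1)) + (m : ZMod (k + 1))).val : ℤ) - m) +
      (j - ((((j : ZMod (k + 1)) + (m : ZMod (k + 1))).val : ℤ) - m)) := by ring
  have h1 := sub_eq_sub_of_cast_eq c d (a := j)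
    (b := ((((j : ZMod (k + 1)) + (m : ZMod (k + 1))).val : ℤ) - m)) (by simp)
  have h2 := h _ (ZMod.val_lt ((j : ZMod (k + 1)) + (m : ZMod (k + 1))))
  omega

/-! ### Closed two-layer paths and the carriers of two successive operators -/

section Path

variable {V : Finset ℤ}

theorem coe_min_val (p q : {z // z ∈ V}) : (min p q).val = min p.val q.val :=
  Monotone.map_min (f := Subtype.val) fun _ _ h => h

theorem coe_max_val (p q : {z // z ∈ V}) : (max p q).val = max p.val q.val :=
  Monotone.map_max (f := Subtype.val) fun _ _ h => h

theorem path_succ_fst (a : ℕ → {z // z ∈ V}) (E E' : Finset ℕ) (p : {z // z ∈ V} × {z // z ∈ V})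
    (t : ℕ) : (path a E E' p (t + 1)).1.val =
      if t ∈ E then min (path a E E' p t).1.val (a t).val else (a t).val := by
  have : (path a E E' p (t + 1)).1 = if t ∈ E then min (path a E E' p t).1 (a t) else a t := rfl
  rw [this]
  split_ifs
  · exact coe_min_val _ _
  · rfl

theorem path_succ_snd (a : ℕ → {z // z ∈ V}) (E E' : Finset ℕ) (p : {z // z ∈ V} × {z // z ∈ V})
    (t : ℕ) : (path a E E' p (t + 1)).2.val =
      if t ∈ E' then min (path a E E' p t).2.val (dep1 a E E' p t).val
      else (dep1 a E E' p t).val := by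
  have : (path a E E' p (t + 1)).2 = if t ∈ E' then min (path a E E' p t).2 (dep1 a E E' p t)
      else dep1 a E E' p t := rfl
  rw [this]
  split_ifs
  · exact coe_min_val _ _
  · rfl

theorem dep1_val (a : ℕ → {z // z ∈ V}) (E E' : Finset ℕ) (p : {z // z ∈ V} × {z // z ∈ V})
    (t : ℕ) : (dep1 a E E' p t).val =
      if t ∈ E then max (path a E E' p t).1.val (a t).val else (path a E E' p t).1.val := by
  rw [dep1]
  split_ifs
  · exact coe_max_val _ _
  · rfl

theorem dep2_val (a : ℕ → {z // z ∈ V}) (E E' : Finset ℕ) (p : {z // z ∈ V} × {z // z ∈ V})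
    (t : ℕ) : (dep2 a E E' p t).val =
      if t ∈ E' then max (path a E E' p t).2.val (dep1 a E E' p t).val
      else (path a E E' p t).2.val := by
  rw [dep2]
  split_ifs
  · exact coe_max_val _ _
  · rfl

/-- The relation of the twist: the carriers grow by one over a period. -/
def twistRel (p q : {z // z ∈ V}) : Prop := p.val = q.val + 1

instance : DecidableRel (twistRel (V := V)) := fun _ _ => inferInstanceAs (Decidable (_ = _))

variable {k : ℕ} {c c1 c2 u v : QState k} {J I : Finset (ZMod (k + 1))}
  {a : ℕ → {z // z ∈ V}}

theorem IsCarrier.step_col (h : IsCarrier J c u c1) (m : ℤ) {t : ℕ} (ht : t < k + 1) :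
    u (((t + 1 : ℕ) : ℤ) - m) =
      if t ∈ letterCols m J then min (u ((t : ℤ) - m)) (c ((t : ℤ) - m)) else c ((t : ℤ) - m) := by
  simp only [mem_letterCols ht]
  rw [← h.step]
  congr 1
  push_cast
  ring

/-- What is deposited at `j` lands at position `j - 1`, so every layer shifts the columns by one.
This accounts for the offsets `0` and `1` of the two layers and `2` of the result. -/
theorem IsCarrier.deposit_col (h : IsCarrier J c u c1) (m : ℤ) {t : ℕ} (ht : t < k + 1) :
    c1 ((t : ℤ) - (m + 1)) =
      if t ∈ letterCols m J then max (u ((t : ℤ) - m)) (c ((t : ℤ) - m)) else u ((t : ℤ) - m) := by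
  simp only [mem_letterCols ht]
  rw [← h.deposit]
  congr 1
  ring

theorem path_fst_eq (ha : ∀ t < k + 1, (a t).val = c t) (h : IsCarrier J c u c1)
    (E' : Finset ℕ) {p : {z // z ∈ V} × {z // z ∈ V}} (hp : p.1.val = u 0) :
    ∀ t ≤ k + 1, (path a (letterCols 0 J) E' p t).1.val = u t := by
  intro t
  induction t with
  | zero => simpa [path] using hp
  | succ t ih =>
    intro ht
    have h1 := h.step_col 0 (t := t) (by omega)
    simp only [sub_zero] at h1
    rw [path_succ_fst, ih (by omega), ha t (by omega), h1]

theorem dep1_eq (ha : ∀ t < k + 1, (a t).val = c t) (h : IsCarrier J c u c1)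
    (E' : Finset ℕ) {p : {z // z ∈ V} × {z // z ∈ V}} (hp : p.1.val = u 0) {t : ℕ}
    (ht : t < k + 1) : (dep1 a (letterCols 0 J) E' p t).val = c1 ((t : ℤ) - 1) := by
  have h1 := h.deposit_col 0 ht
  simp only [sub_zero, zero_add] at h1
  rw [dep1_val, path_fst_eq ha h E' hp t ht.le, ha t ht, h1]

theorem path_snd_eq (ha : ∀ t < k + 1, (a t).val = c t) (h : IsCarrier J c u c1)
    (h' : IsCarrier I c1 v c2) {p : {z // z ∈ V} × {z // z ∈ V}} (hp : p.1.val = u 0)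
    (hp' : p.2.val = v (-1)) :
    ∀ t ≤ k + 1, (path a (letterCols 0 J) (letterCols 1 I) p t).2.val = v ((t : ℤ) - 1) := by
  intro t
  induction t with
  | zero => simpa [path] using hp'
  | succ t ih =>
    intro ht
    have h1 := h'.step_col 1 (t := t) (by omega)
    rw [path_succ_snd, ih (by omega), dep1_eq ha h _ hp (by omega), h1]

theorem dep2_eq (ha : ∀ t < k + 1, (a t).val = c t) (h : IsCarrier J c u c1)
    (h' : IsCarrier I c1 v c2) {p : {z // z ∈ V} × {z // z ∈ V}} (hp : p.1.val = u 0)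
    (hp' : p.2.val = v (-1)) {t : ℕ} (ht : t < k + 1) :
    (dep2 a (letterCols 0 J) (letterCols 1 I) p t).val = c2 ((t : ℤ) - 2) := by
  have h1 := h'.deposit_col 1 ht
  rw [show (1 : ℤ) + 1 = 2 by norm_num] at h1
  rw [dep2_val, path_snd_eq ha h h' hp hp' t ht.le, dep1_eq ha h _ hp ht, h1]

theorem path_end_eq (ha : ∀ t < k + 1, (a t).val = c t) (h : IsCarrier J c u c1)
    (h' : IsCarrier I c1 v c2) {p : {z // z ∈ V} × {z // z ∈ V}} (hp : p.1.val = u 0)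
    (hp' : p.2.val = v (-1)) :
    twistRel (path a (letterCols 0 J) (letterCols 1 I) p (k + 1)).1 p.1 ∧
      twistRel (path a (letterCols 0 J) (letterCols 1 I) p (k + 1)).2 p.2 := by
  constructor
  · rw [twistRel, path_fst_eq ha h _ hp _ le_rfl, hp, ← u.add_period]
    congr 1
    push_cast
    ring
  · rw [twistRel, path_snd_eq ha h h' hp hp' _ le_rfl, hp', ← v.add_period]
    congr 1

theorem ne_univ_of_path_end {p : {z // z ∈ V} × {z // z ∈ V}}
    (h : twistRel (path a (letterCols 0 J) (letterCols 1 I) p (k + 1)).1 p.1 ∧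
      twistRel (path a (letterCols 0 J) (letterCols 1 I) p (k + 1)).2 p.2) :
    J ≠ Finset.univ ∧ I ≠ Finset.univ := by
  constructor
  · rw [← ne_univ_of_letterCols (m := 0)]
    exact not_closed_of_forall (x := fun t => (a t).val)
      (w := fun t => (path a (letterCols 0 J) (letterCols 1 I) p t).1.val)
      (fun t _ => path_succ_fst a _ _ p t) h.1
  · rw [← ne_univ_of_letterCols (m := 1)]
    exact not_closed_of_forall
      (x := fun t => (dep1 a (letterCols 0 J) (letterCols 1 I) p t).val)
      (w := fun t => (path a (letterCols 0 J) (letterCols 1 I) p t).2.val)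
      (fun t _ => path_succ_snd a _ _ p t) h.2

/-- A path that closes up must follow the true carriers: `closed_unique` identifies the first layer,
and this fixes the input of the second layer, to which it applies again. -/
theorem path_start_eq (ha : ∀ t < k + 1, (a t).val = c t) (h : IsCarrier J c u c1)
    (h' : IsCarrier I c1 v c2) {p : {z // z ∈ V} × {z // z ∈ V}}
    (hp : twistRel (path a (letterCols 0 J) (letterCols 1 I) p (k + 1)).1 p.1 ∧
      twistRel (path a (letterCols 0 J) (letterCols 1 I) p (k + 1)).2 p.2) :
    p.1.val = u 0 ∧ p.2.val = v (-1) := by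
  obtain ⟨hJ, hI⟩ := ne_univ_of_path_end hp
  have h1 : p.1.val = u 0 := by
    refine closed_unique (x := fun t => (a t).val) (w' := fun t => u t)
      (w := fun t => (path a (letterCols 0 J) (letterCols 1 I) p t).1.val)
      (fun t _ => path_succ_fst a _ _ p t) (fun t ht => ?_) hp.1 ?_
      (ne_univ_of_letterCols (m := 0).2 hJ) 0 (Nat.zero_le _)
    · have h1 := h.step_col 0 ht
      simp only [sub_zero] at h1
      simp only [ha t ht, h1]
    · simp only [← u.add_period]
      congr 1
      push_cast
      ring
  refine ⟨h1, ?_⟩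
  have := closed_unique (x := fun t => (dep1 a (letterCols 0 J) (letterCols 1 I) p t).val)
      (w' := fun t => v ((t : ℤ) - 1))
      (w := fun t => (path a (letterCols 0 J) (letterCols 1 I) p t).2.val)
      (fun t _ => path_succ_snd a _ _ p t) (fun t ht => ?_) hp.2 ?_
      (ne_univ_of_letterCols (m := 1).2 hI) 0 (Nat.zero_le _)
  · simpa [path] using this
  · have h2 := h'.step_col 1 ht
    simp only [dep1_eq ha h _ h1 ht, h2]
  · simp only [← v.add_period]
    congr 1

theorem pairSign_val {K : Type*} [CommRing K] (p q : {z // z ∈ V}) :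
    (pairSign p q : K) = ((q.val - p.val).sign : ℤ) := by
  rw [pairSign]
  rcases lt_trichotomy p q with h | h | h
  · have : (q.val - p.val).sign = 1 := Int.sign_eq_one_of_pos (sub_pos.2 h)
    simp [h, this]
  · simp [h]
  · have : (q.val - p.val).sign = -1 := Int.sign_eq_neg_one_of_neg (sub_neg.2 h)
    simp [h, not_lt_of_gt h, this]

theorem carrierSign_eq (m : ℤ) : carrierSign J c u = ∏ t ∈ Finset.range (k + 1),
    if t ∈ letterCols m J then (c ((t : ℤ) - m) - u ((t : ℤ) - m)).sign else 1 :=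
  prod_liftZ_eq m J (fun z => (c z - u z).sign) fun a b hab => by
    simp only [sub_eq_sub_of_cast_eq c u hab]

theorem prod_colWeight_eq {K : Type*} [CommRing K] (e : ℕ → {z // z ∈ V}) {c3 : QState k}
    (ha : ∀ t < k + 1, (a t).val = c t) (he : ∀ t < k + 1, (e t).val = c3 ((t : ℤ) - 2))
    (h : IsCarrier J c u c1) (h' : IsCarrier I c1 v c2)
    {p : {z // z ∈ V} × {z // z ∈ V}} (hp : p.1.val = u 0) (hp' : p.2.val = v (-1)) :
    (∏ t ∈ Finset.range (k + 1), colWeight a e (letterCols 0 J) (letterCols 1 I) p t : K) =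
      ((Finsupp.single c2 (1 * carrierSign J c u * carrierSign I c1 v) c3 : ℤ) : K) := by
  classical
  simp only [colWeight, Finset.prod_mul_distrib]
  have e1 : (∏ t ∈ Finset.range (k + 1), if t ∈ letterCols 0 J then
      pairSign (path a (letterCols 0 J) (letterCols 1 I) p t).1 (a t) else 1 : K) =
      (carrierSign J c u : ℤ) := by
    rw [carrierSign_eq 0]
    push_cast
    refine Finset.prod_congr rfl fun t ht => ?_
    rw [Finset.mem_range] at ht
    rw [pairSign_val, path_fst_eq ha h _ hp t ht.le, ha t ht, sub_zero]
  have e2 : (∏ t ∈ Finset.range (k + 1), if t ∈ letterCols 1 I then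
      pairSign (path a (letterCols 0 J) (letterCols 1 I) p t).2
        (dep1 a (letterCols 0 J) (letterCols 1 I) p t) else 1 : K) =
      (carrierSign I c1 v : ℤ) := by
    rw [carrierSign_eq 1]
    push_cast
    refine Finset.prod_congr rfl fun t ht => ?_
    rw [Finset.mem_range] at ht
    rw [pairSign_val, path_snd_eq ha h h' hp hp' t ht.le, dep1_eq ha h _ hp ht]
  have e3 : (∏ t ∈ Finset.range (k + 1),
      if dep2 a (letterCols 0 J) (letterCols 1 I) p t = e t then 1 else 0 : K) =
      if c2 = c3 then 1 else 0 := by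
    rw [Finset.prod_ite_zero, Finset.prod_const_one]
    refine if_congr ⟨fun hh => QState.ext_range 2 fun t ht => ?_, ?_⟩ rfl rfl
    · rw [← dep2_eq ha h h' hp hp' ht, hh t (Finset.mem_range.2 ht), he t ht]
    · rintro rfl t ht
      rw [Finset.mem_range] at ht
      apply Subtype.ext
      rw [dep2_eq ha h h' hp hp' ht, he t ht]
  calc _ = ((carrierSign J c u : ℤ) : K) * ((carrierSign I c1 v : ℤ) : K) *
      (if c2 = c3 then 1 else 0) := by
        rw [e1, e2, ← e3]
        congr!
    _ = _ := by
        rw [Finsupp.single_apply]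
        split_ifs <;> simp

end Path

/-- The coefficient of a state in the composition of two cyclically decreasing operators. -/
def pairCoef {k : ℕ} (c c3 : QState k) (J I : Finset (ZMod (k + 1))) : ℤ :=
  if J ≠ Finset.univ ∧ I ≠ Finset.univ then opT k I (opT k J (Finsupp.single c 1)) c3 else 0

/-- The generating function of the coefficients of pairs is a trace. -/
theorem exists_trace {k : ℕ} [NeZero k] (c c3 : QState k) : ∃ (V : Finset ℤ)
    (a e : ℕ → {z // z ∈ V}), ∀ (K : Type) [CommRing K] (y x : K),
    (colProd y x a e (k + 1) * twistM K (twistRel (V := V))).trace =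
      ∑ J : Finset (ZMod (k + 1)), ∑ I : Finset (ZMod (k + 1)),
        y ^ J.card * x ^ I.card * (pairCoef c c3 J I : K) := by
  classical
  have : Nonempty (QState k) := ⟨c⟩
  choose! u c1 hc1 hT1 using fun (J : Finset (ZMod (k + 1))) (hJ : J ≠ Finset.univ) =>
    exists_isCarrier hJ c
  choose! v c2 hc2 hT2 using fun (J I : Finset (ZMod (k + 1))) (hI : I ≠ Finset.univ) =>
    exists_isCarrier hI (c1 J)
  -- Traces need finitely many levels. The contents, the target and the initial carriers for all
  -- sets suffice, since further values arise from them by `min` and `max`.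
  let V : Finset ℤ := (Finset.range (k + 1)).image (fun t : ℕ => c t) ∪
    (Finset.range (k + 1)).image (fun t : ℕ => c3 ((t : ℤ) - 2)) ∪
    Finset.univ.image (fun J => u J 0) ∪ Finset.univ.image (fun q : _ × _ => v q.1 q.2 (-1))
  have hmod : ∀ t, t % (k + 1) ∈ Finset.range (k + 1) := fun t =>
    Finset.mem_range.2 (Nat.mod_lt _ (Nat.succ_pos k))
  let a : ℕ → {z // z ∈ V} := fun t => ⟨c ((t % (k + 1) : ℕ) : ℤ), by
    simp only [V, Finset.mem_union]
    exact Or.inl (Or.inl (Or.inl (Finset.mem_image.2 ⟨_, hmod t, rfl⟩)))⟩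
  let e : ℕ → {z // z ∈ V} := fun t => ⟨c3 (((t % (k + 1) : ℕ) : ℤ) - 2), by
    simp only [V, Finset.mem_union]
    exact Or.inl (Or.inl (Or.inr (Finset.mem_image.2 ⟨_, hmod t, rfl⟩)))⟩
  have ha : ∀ t < k + 1, (a t).val = c t := fun t ht => by simp only [a, Nat.mod_eq_of_lt ht]
  have he : ∀ t < k + 1, (e t).val = c3 ((t : ℤ) - 2) := fun t ht => by
    simp only [e, Nat.mod_eq_of_lt ht]
  refine ⟨V, a, e, fun K _ y x => ?_⟩
  have h1 : (colProd y x a e (k + 1) * twistM K (twistRel (V := V))).trace =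
      ∑ p, ∑ E ∈ (Finset.range (k + 1)).powerset, ∑ E' ∈ (Finset.range (k + 1)).powerset,
      y ^ E.card * x ^ E'.card * ((∏ s ∈ Finset.range (k + 1), colWeight a e E E' p s) *
        twistM K (twistRel (V := V)) (path a E E' p (k + 1)) p) := by
    rw [Matrix.trace]
    refine Finset.sum_congr rfl fun p _ => ?_
    rw [Matrix.diag_apply, Matrix.mul_apply]
    simp only [colProd_apply, Finset.sum_mul]
    rw [Finset.sum_comm]
    refine Finset.sum_congr rfl fun E _ => ?_
    rw [Finset.sum_comm]
    refine Finset.sum_congr rfl fun E' _ => ?_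
    rw [Finset.sum_eq_single (path a E E' p (k + 1))]
    · rw [if_pos rfl]
      ring
    · intro p' _ hp'
      rw [if_neg (Ne.symm hp')]
      ring
    · simp
  rw [h1, Finset.sum_comm, sum_powerset_eq_sum_letterCols k 0]
  refine Finset.sum_congr rfl fun J _ => ?_
  rw [Finset.sum_comm, sum_powerset_eq_sum_letterCols k 1]
  refine Finset.sum_congr rfl fun I _ => ?_
  rw [← Finset.mul_sum, card_letterCols, card_letterCols]
  congr 1
  rw [pairCoef]
  split_ifs with hJI
  · obtain ⟨hJ, hI⟩ := hJI
    have hu : u J 0 ∈ V := by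
      simp only [V, Finset.mem_union]
      exact Or.inl (Or.inr (Finset.mem_image.2 ⟨J, Finset.mem_univ _, rfl⟩))
    have hv : v J I (-1) ∈ V := by
      simp only [V, Finset.mem_union]
      exact Or.inr (Finset.mem_image.2 ⟨(J, I), Finset.mem_univ _, rfl⟩)
    rw [Finset.sum_eq_single (⟨u J 0, hu⟩, ⟨v J I (-1), hv⟩)]
    · rw [prod_colWeight_eq e ha he (hc1 J hJ) (hc2 J I hI) rfl rfl, hT1 J hJ, hT2 J I hI, twistM,
        Matrix.of_apply, if_pos (path_end_eq ha (hc1 J hJ) (hc2 J I hI) rfl rfl), mul_one]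
    · rintro p - hp
      rw [twistM, Matrix.of_apply, if_neg, mul_zero]
      intro h
      obtain ⟨h1, h2⟩ := path_start_eq ha (hc1 J hJ) (hc2 J I hI) h
      exact hp (Prod.ext (Subtype.ext h1) (Subtype.ext h2))
    · simp
  · rw [Int.cast_zero, Finset.sum_eq_zero]
    intro p _
    rw [twistM, Matrix.of_apply, if_neg, mul_zero]
    exact fun h => hJI (ne_univ_of_path_end h)

theorem sum_pairCoef {k : ℕ} (c c3 : QState k) (r s : ℕ) :
    (opH k r * opH k s) (Finsupp.single c 1) c3 =
      ∑ J : Finset (ZMod (k + 1)), ∑ I : Finset (ZMod (k + 1)),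
        if J.card = s ∧ I.card = r then pairCoef c c3 J I else 0 := by
  classical
  rw [Module.End.mul_apply]
  simp only [opH, LinearMap.sum_apply, map_sum, Finsupp.coe_finsetSum, Finset.sum_apply]
  have hs : ∀ (r : ℕ), properSets k r = Finset.univ.filter fun J => J.card = r ∧ J ≠ Finset.univ :=
    fun r => by ext J; simp [mem_properSets]
  simp only [hs, Finset.sum_filter]
  refine Finset.sum_congr rfl fun J _ => ?_
  rw [← mul_boole, Finset.sum_mul]
  refine Finset.sum_congr rfl fun I _ => ?_
  by_cases h1 : J = Finset.univ
  · simp [h1, pairCoef]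
  · by_cases h2 : I = Finset.univ
    · simp [h2, pairCoef]
    · by_cases h3 : J.card = s <;> by_cases h4 : I.card = r <;> simp [h1, h2, h3, h4, pairCoef]

/-- With two independent formal parameters, the symmetry of the trace is compared at outer degree
`s` and inner degree `r`, which record the sizes of the two sets of letters. -/
theorem opH_mul_comm (k : ℕ) [NeZero k] (r s : ℕ) : opH k r * opH k s = opH k s * opH k r := by
  classical
  refine Finsupp.lhom_ext' fun c => LinearMap.ext_ring ?_
  ext c3
  simp only [LinearMap.comp_apply, Finsupp.lsingle_apply]
  obtain ⟨V, a, e, h⟩ := exists_trace c c3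
  have hne : ∀ p : Polynomial (Polynomial ℤ), p.eval 0 = 0 → 1 - p ≠ 0 := by
    intro p hp h0
    have := congrArg (Polynomial.eval 0) h0
    simp [hp] at this
  have hne' : (1 : Polynomial (Polynomial ℤ)) - Polynomial.C Polynomial.X ≠ 0 := by
    intro h0
    have := congrArg (fun p => Polynomial.eval 0 (Polynomial.eval 0 p)) h0
    simp at this
  have key := trace_colProd_comm (K := Polynomial (Polynomial ℤ)) (y := Polynomial.X)
    (x := Polynomial.C Polynomial.X) (hne _ (by simp)) hne' a e (k + 1) (twistRel (V := V))
    (fun a a' b b' h1 h2 => by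
      rw [← Subtype.coe_lt_coe, ← Subtype.coe_lt_coe, show a.val = a'.val + 1 from h1,
        show b.val = b'.val + 1 from h2, add_lt_add_iff_right])
    (fun a b b' h1 h2 => Subtype.ext (by
      have e1 : a.val = b.val + 1 := h1
      have e2 : a.val = b'.val + 1 := h2
      omega))
  rw [h, h] at key
  have key2 := congrArg (fun p => (p.coeff s).coeff r) key
  have hco : ∀ (m n : ℕ) (z : ℤ), ((Polynomial.X ^ m * Polynomial.C Polynomial.X ^ n *
      (z : Polynomial (Polynomial ℤ))).coeff s).coeff r = if m = s ∧ n = r then z else 0 := by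
    intro m n z
    have : (Polynomial.X ^ m * Polynomial.C Polynomial.X ^ n *
      (z : Polynomial (Polynomial ℤ))) =
        Polynomial.C (Polynomial.C z * Polynomial.X ^ n) * Polynomial.X ^ m := by
      simp only [map_mul, map_pow, eq_intCast, map_intCast]
      ring
    rw [this, Polynomial.coeff_C_mul_X_pow]
    by_cases h1 : s = m
    · subst h1
      simp only [if_true, Polynomial.coeff_C_mul_X_pow, true_and, eq_comm (a := r)]
    · rw [if_neg h1, if_neg (fun hh => h1 hh.1.symm), Polynomial.coeff_zero]
  have hco' : ∀ (m n : ℕ) (z : ℤ), ((Polynomial.C Polynomial.X ^ m * Polynomial.X ^ n *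
      (z : Polynomial (Polynomial ℤ))).coeff s).coeff r = if m = r ∧ n = s then z else 0 := by
    intro m n z
    rw [mul_comm (Polynomial.C Polynomial.X ^ m) (Polynomial.X ^ n : Polynomial (Polynomial ℤ)), hco]
    simp only [and_comm]
  simp only [Polynomial.finsetSum_coeff, hco, hco'] at key2
  rw [sum_pairCoef, sum_pairCoef]
  exact key2

/-! ### Adding and removing corners of cores -/

/-- The degree of the bounded partition of a core. -/
def coreDeg (k : ℕ) (g : YoungDiagram) : ℕ := (smallHookCells k g).card

theorem Rep.coreDeg_eq {k : ℕ} {c : QState k} {g : YoungDiagram} (h : Rep c g) :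
    coreDeg k g = invNum c := h.card_smallHookCells

theorem isCore_bot (k : ℕ) : IsCore (k + 1) ⊥ := (rep_emptyState k).isCore

theorem coreDeg_bot (k : ℕ) : coreDeg k ⊥ = 0 := by
  rw [(rep_emptyState k).coreDeg_eq, invNum_emptyState]

section Cores

variable {k : ℕ} [NeZero k] {g h : YoungDiagram}

theorem IsCore.addCorners (hg : IsCore (k + 1) g) (i : ZMod (k + 1)) :
    IsCore (k + 1) (addCorners k i g) := by
  obtain ⟨c, hc⟩ := exists_rep hg
  exact (hc.dem i).isCore

theorem coreDeg_addCorners_cases (hg : IsCore (k + 1) g) (i : ZMod (k + 1)) :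
    AffineGrothendieck.addCorners k i g = g ∨
      coreDeg k (AffineGrothendieck.addCorners k i g) = coreDeg k g + 1 ∧
        removeCorners k i (AffineGrothendieck.addCorners k i g) = g := by
  obtain ⟨c, hc⟩ := exists_rep hg
  have h := hc.dem i
  rcases le_or_gt (c.gap i) 0 with h0 | h0
  · rw [QState.dem_of_nonpos h0] at h
    exact Or.inl (h.eq_diagram hc)
  · rw [QState.dem_of_pos h0] at h
    refine Or.inr ⟨by rw [h.coreDeg_eq, hc.coreDeg_eq, invNum_swap_of_pos c h0], ?_⟩
    have h1 := h.swap_of_neg (i := i) (by rw [QState.gap_swap]; omega)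
    rw [QState.swap_swap] at h1
    exact h1.eq_diagram hc

theorem removeCorners_cases (hg : IsCore (k + 1) g) (i : ZMod (k + 1)) :
    IsCore (k + 1) (removeCorners k i g) ∧ (removeCorners k i g = g ∨
      coreDeg k (removeCorners k i g) + 1 = coreDeg k g ∧
        AffineGrothendieck.addCorners k i (removeCorners k i g) = g) := by
  obtain ⟨c, hc⟩ := exists_rep hg
  rcases le_or_gt 0 (c.gap i) with h0 | h0
  · rw [hc.removeCorners_of_nonneg h0]
    exact ⟨hg, Or.inl rfl⟩
  · have h := hc.swap_of_neg h0
    refine ⟨h.isCore, Or.inr ⟨by rw [h.coreDeg_eq, hc.coreDeg_eq, invNum_swap_of_neg c h0], ?_⟩⟩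
    have h1 := h.swap_of_pos (i := i) (by rw [QState.gap_swap]; omega)
    rw [QState.swap_swap] at h1
    exact h1.eq_diagram hc

/-- Remove from both cores the corners of a residue removable in `h`. Containment persists, `h`
loses exactly one degree and `g` at most one. If `g` loses none, its degree is strictly smaller than
that of `h`. -/
theorem coreDeg_le_of_le_and {g h : YoungDiagram} (hg : IsCore (k + 1) g) (hh : IsCore (k + 1) h) (hle : g ≤ h) :
    coreDeg k g ≤ coreDeg k h ∧ (coreDeg k g = coreDeg k h → g = h) := by
  by_cases hb : h = ⊥
  · subst hb
    obtain rfl : g = ⊥ := le_bot_iff.1 hle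
    simp
  · obtain ⟨p, hp⟩ := exists_isRemovable hb
    have hlt := card_removeCorners_lt (k := k) hp
    obtain ⟨hh1, hh2⟩ := removeCorners_cases hh (residue k p)
    obtain ⟨hg1, hg2⟩ := removeCorners_cases hg (residue k p)
    obtain ⟨ih1, ih2⟩ := coreDeg_le_of_le_and hg1 hh1 (removeCorners_mono k (residue k p) hle)
    rcases hh2 with hh2 | ⟨hh2, hh3⟩
    · rw [hh2] at hlt
      exact absurd hlt (lt_irrefl _)
    · rcases hg2 with hg2 | ⟨hg2, hg3⟩
      · rw [hg2] at ih1
        exact ⟨by omega, fun e => by omega⟩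
      · refine ⟨by omega, fun e => ?_⟩
        rw [← hg3, ← hh3, ih2 (by omega)]
termination_by h.card

theorem coreDeg_mono (hg : IsCore (k + 1) g) (hh : IsCore (k + 1) h) (hle : g ≤ h) :
    coreDeg k g ≤ coreDeg k h := (coreDeg_le_of_le_and hg hh hle).1

theorem eq_of_le_of_coreDeg_le (hg : IsCore (k + 1) g) (hh : IsCore (k + 1) h) (hle : g ≤ h)
    (hd : coreDeg k h ≤ coreDeg k g) : g = h :=
  (coreDeg_le_of_le_and hg hh hle).2 (le_antisymm (coreDeg_mono hg hh hle) hd)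

end Cores

/-- Add corners according to a word, the last letter first. -/
def addW (k : ℕ) (w : List (ZMod (k + 1))) (g : YoungDiagram) : YoungDiagram :=
  w.foldr (addCorners k) g

/-- Remove corners according to a word, the first letter first. -/
def removeW (k : ℕ) (w : List (ZMod (k + 1))) (g : YoungDiagram) : YoungDiagram :=
  w.foldl (fun h i => removeCorners k i h) g

@[simp] theorem addW_nil (k : ℕ) (g : YoungDiagram) : addW k [] g = g := rfl

@[simp] theorem addW_cons (k : ℕ) (i : ZMod (k + 1)) (w : List (ZMod (k + 1)))
    (g : YoungDiagram) : addW k (i :: w) g = addCorners k i (addW k w g) := rfl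

@[simp] theorem removeW_nil (k : ℕ) (g : YoungDiagram) : removeW k [] g = g := rfl

@[simp] theorem removeW_cons (k : ℕ) (i : ZMod (k + 1)) (w : List (ZMod (k + 1)))
    (g : YoungDiagram) : removeW k (i :: w) g = removeW k w (removeCorners k i g) := rfl

theorem le_addW (k : ℕ) (w : List (ZMod (k + 1))) (g : YoungDiagram) : g ≤ addW k w g := by
  induction w with
  | nil => exact le_rfl
  | cons i w ih => exact ih.trans (le_addCorners _ _ _)

theorem addW_mono (k : ℕ) (w : List (ZMod (k + 1))) {g h : YoungDiagram} (hle : g ≤ h) :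
    addW k w g ≤ addW k w h := by
  induction w with
  | nil => exact hle
  | cons i w ih => exact addCorners_mono k i ih

/-- `h` is obtained from `g` by adding a horizontal strip. -/
def IsStrip (g h : YoungDiagram) : Prop := ∀ p q, (p + 1, q) ∈ h → (p, q) ∈ g

/-! ### Horizontal strips and cyclically decreasing words -/

section Words

variable {k : ℕ} {g h : YoungDiagram} {w : List (ZMod (k + 1))}

theorem residue_right (k : ℕ) (p q : ℕ) : residue k (p, q + 1) = residue k (p, q) + 1 := by
  simp only [residue]
  push_cast
  ring

theorem residue_down (k : ℕ) (p q : ℕ) : residue k (p, q) = residue k (p + 1, q) + 1 := by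
  simp only [residue]
  push_cast
  ring

theorem residue_mem_of_mem_addW {x : ℕ × ℕ} (hx : x ∈ addW k w g) (hxg : x ∉ g) :
    residue k x ∈ w := by
  induction w with
  | nil => exact absurd hx hxg
  | cons i w ih =>
    rw [addW_cons, mem_addCorners] at hx
    rcases hx with hx | ⟨-, hx⟩
    · exact List.mem_cons_of_mem _ (ih hx)
    · simp [hx]

/-- The cell above a cell of residue `i` has residue `i + 1`. If both were new, `i + 1` would have
acted before `i`, that is, it would stand to the right of `i` in the word. -/
theorem IsCD.isStrip_addW (hw : IsCD w) (g : YoungDiagram) : IsStrip g (addW k w g) := by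
  induction w with
  | nil => exact fun p q h => g.up_left_mem (Nat.le_succ _) le_rfl h
  | cons i w ih =>
    obtain ⟨hi, hi1, hw⟩ := hw
    intro p q h
    rw [addW_cons, mem_addCorners] at h
    rcases h with h | ⟨h, hr⟩
    · exact ih hw p q h
    · have h1 : (p, q) ∈ addW k w g := by
        rcases h.2.1 with h0 | h0
        · simp at h0
        · simpa using h0
      by_contra hg
      have := residue_mem_of_mem_addW h1 hg
      rw [residue_down, hr] at this
      exact hi1 this

/-- The front letter `i` acts last. The new cells of residue `i` end their rows, because a right
neighbour would have residue `i + 1`, which is not in the word. They can be taken off `h` and are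
addable again once the rest has been built. -/
theorem IsCD.le_addW_of_isStrip [NeZero k] (hw : IsCD w) (hs : IsStrip g h) (hle : g ≤ h)
    (hr : ∀ x ∈ h, x ∉ g → residue k x ∈ w) : h ≤ addW k w g := by
  induction w generalizing h with
  | nil =>
    intro x hx
    by_contra hg
    simpa using hr x hx hg
  | cons i w ih =>
    obtain ⟨hi, hi1, hw⟩ := hw
    have hne : i + 1 ≠ i := by simpa using one_ne_zero_zmod k
    have hright : ∀ p q, (p, q) ∈ h → (p, q) ∉ g → residue k (p, q) = i → (p, q + 1) ∉ h := by
      intro p q h1 h2 h3 h4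
      have h5 := hr _ h4 fun h6 => h2 (g.up_left_mem le_rfl (Nat.le_succ _) h6)
      rw [residue_right, h3, List.mem_cons] at h5
      exact h5.elim hne hi1
    let h' : YoungDiagram :=
      { cells := h.cells.filter fun x => ¬ (x ∉ g ∧ residue k x = i)
        isLowerSet := by
          rintro ⟨a, b⟩ ⟨a', b'⟩ hle' hm
          obtain ⟨h1, h2⟩ : a' ≤ a ∧ b' ≤ b := hle'
          simp only [Finset.coe_filter, YoungDiagram.mem_cells, Set.mem_ofPred_eq] at hm ⊢
          refine ⟨h.up_left_mem h1 h2 hm.1, fun hx => ?_⟩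
          obtain ⟨hx1, hx2⟩ := hx
          have hmem := h.up_left_mem h1 h2 hm.1
          rcases h1.lt_or_eq with h1 | rfl
          · exact hx1 (hs a' b' (h.up_left_mem h1 h2 hm.1))
          · rcases h2.lt_or_eq with h2 | rfl
            · exact hright a' b' hmem hx1 hx2 (h.up_left_mem le_rfl h2 hm.1)
            · exact hm.2 ⟨hx1, hx2⟩ }
    have hmem' : ∀ x, x ∈ h' ↔ x ∈ h ∧ ¬ (x ∉ g ∧ residue k x = i) := fun x => by
      rw [← YoungDiagram.mem_cells]
      simp [h']
    have h1 : h' ≤ addW k w g := by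
      refine ih hw (fun p q hx => hs p q ((hmem' _).1 hx).1) (fun x hx => ?_) fun x hx hxg => ?_
      · exact (hmem' x).2 ⟨hle hx, fun h2 => h2.1 hx⟩
      · obtain ⟨hx1, hx2⟩ := (hmem' x).1 hx
        have := hr x hx1 hxg
        rw [List.mem_cons] at this
        exact this.resolve_left fun h3 => hx2 ⟨hxg, h3⟩
    rintro ⟨p, q⟩ hx
    rw [addW_cons, mem_addCorners]
    by_cases hx' : (p, q) ∈ h'
    · exact Or.inl (h1 hx')
    · rw [hmem'] at hx'
      have hx2 : (p, q) ∉ g ∧ residue k (p, q) = i := by tauto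
      by_cases ha : (p, q) ∈ addW k w g
      · exact Or.inl ha
      · refine Or.inr ⟨⟨ha, ?_, ?_⟩, hx2.2⟩
        · rcases p with _ | p
          · exact Or.inl rfl
          · exact Or.inr (le_addW k w g (hs p q hx))
        · rcases q with _ | q
          · exact Or.inl rfl
          · refine Or.inr (h1 ((hmem' _).2 ⟨h.up_left_mem le_rfl (Nat.le_succ _) hx, fun h3 => ?_⟩))
            simp only [add_tsub_cancel_right] at h3
            have := hx2.2
            rw [residue_right, h3.2] at this
            exact hne this

theorem IsCD.removeW_le [NeZero k] (hw : IsCD w) (hs : IsStrip g h)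
    (hr : ∀ x ∈ h, x ∉ g → residue k x ∈ w) : removeW k w h ≤ g := by
  induction w generalizing h with
  | nil =>
    intro x hx
    by_contra hg
    simpa using hr x hx hg
  | cons i w ih =>
    obtain ⟨hi, hi1, hw⟩ := hw
    have hne : i + 1 ≠ i := by simpa using one_ne_zero_zmod k
    refine ih hw (fun p q hx => hs p q (removeCorners_le _ _ _ hx)) ?_
    rintro ⟨p, q⟩ hx hxg
    obtain ⟨hx1, hx2⟩ := mem_removeCorners.1 hx
    refine (List.mem_cons.1 (hr _ hx1 hxg)).resolve_left fun h3 => hx2 ⟨⟨hx1, ?_, ?_⟩, h3⟩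
    · exact fun h4 => hxg (hs p q h4)
    · intro h4
      have h5 := hr _ h4 fun h6 => hxg (g.up_left_mem le_rfl (Nat.le_succ _) h6)
      rw [residue_right, h3, List.mem_cons] at h5
      exact h5.elim hne hi1

variable [NeZero k]

theorem IsCore.addW (hg : IsCore (k + 1) g) (w : List (ZMod (k + 1))) :
    IsCore (k + 1) (addW k w g) := by
  induction w with
  | nil => exact hg
  | cons i w ih => exact IsCore.addCorners ih i

theorem coreDeg_addW_le (hg : IsCore (k + 1) g) (w : List (ZMod (k + 1))) :
    coreDeg k (addW k w g) ≤ coreDeg k g + w.length := by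
  induction w with
  | nil => simp
  | cons i w ih =>
    rw [addW_cons, List.length_cons]
    rcases coreDeg_addCorners_cases (hg.addW w) i with h | ⟨h, -⟩
    · rw [h]; omega
    · omega

/-- A letter lowers the degree by at most one, and by exactly one only if adding the same residue
undoes the removal. -/
theorem removeW_spec (hg : IsCore (k + 1) g) (w : List (ZMod (k + 1))) :
    IsCore (k + 1) (removeW k w g) ∧ coreDeg k g ≤ coreDeg k (removeW k w g) + w.length ∧
      (coreDeg k g = coreDeg k (removeW k w g) + w.length →
        AffineGrothendieck.addW k w (removeW k w g) = g) := by
  induction w generalizing g with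
  | nil => exact ⟨hg, by simp, fun _ => rfl⟩
  | cons i w ih =>
    obtain ⟨h1, h2⟩ := removeCorners_cases hg i
    obtain ⟨ih1, ih2, ih3⟩ := ih h1
    rw [removeW_cons, List.length_cons, addW_cons]
    refine ⟨ih1, ?_, fun e => ?_⟩
    · rcases h2 with h2 | ⟨h2, -⟩
      · rw [h2] at ih2 ⊢; omega
      · omega
    · rcases h2 with h2 | ⟨h2, h3⟩
      · rw [h2] at ih2 e
        omega
      · rw [ih3 (by omega), h3]

/-- If the degree increases as much as possible, then each letter of the word occurs as the residue
of a new cell. -/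
theorem exists_residue_of_coreDeg_addW (hg : IsCore (k + 1) g)
    (he : coreDeg k (AffineGrothendieck.addW k w g) = coreDeg k g + w.length) {i : ZMod (k + 1)}
    (hi : i ∈ w) : ∃ x ∈ AffineGrothendieck.addW k w g, x ∉ g ∧ residue k x = i := by
  induction w with
  | nil => simp at hi
  | cons j w ih =>
    rw [addW_cons, List.length_cons] at he
    have h1 := coreDeg_addW_le hg w
    rw [addW_cons]
    rcases coreDeg_addCorners_cases (hg.addW w) j with h | ⟨h, -⟩
    · rw [h] at he
      omega
    · rcases List.mem_cons.1 hi with rfl | hi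
      · have hne : AffineGrothendieck.addCorners k i (AffineGrothendieck.addW k w g) ≠
            AffineGrothendieck.addW k w g := by
          intro h'
          rw [h'] at h
          omega
        by_contra! hc
        apply hne
        refine le_antisymm (fun x hx => ?_) (le_addCorners _ _ _)
        rcases (mem_addCorners _ _ _ _).1 hx with h2 | ⟨h2, h3⟩
        · exact h2
        · exact absurd h3 (hc x hx fun h4 => h2.1 (le_addW k w g h4))
      · obtain ⟨x, hx, hx'⟩ := ih (by omega) hi
        exact ⟨x, le_addCorners _ _ _ hx, hx'⟩

/-- The action of a word on the state of a core. -/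
theorem exists_prod_genA (w : List (ZMod (k + 1))) {c : QState k} (hc : Rep c g) :
    ∃ d : QState k, ∃ e : ℤ, Rep d (AffineGrothendieck.addW k w g) ∧
      (∀ a : ℤ, (w.map (genA k)).prod (Finsupp.single c a) = Finsupp.single d (a * e)) ∧
      (coreDeg k (AffineGrothendieck.addW k w g) = coreDeg k g + w.length → e = 1) := by
  induction w with
  | nil => exact ⟨c, 1, hc, fun a => by simp, fun _ => rfl⟩
  | cons i w ih =>
    obtain ⟨d, e, h1, h2, h3⟩ := ih
    refine ⟨d.dem i, e * (d.gap i).sign, h1.dem i, fun a => ?_, fun he => ?_⟩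
    · rw [List.map_cons, List.prod_cons, Module.End.mul_apply, h2, genA_single, mul_assoc]
    · rw [addW_cons, List.length_cons] at he
      have h4 := coreDeg_addW_le hc.isCore w
      have h5 : 0 < d.gap i := by
        by_contra h5
        have h6 := h1.dem i
        rw [QState.dem_of_nonpos (not_lt.1 h5)] at h6
        rw [h6.eq_diagram h1] at he
        omega
      have h7 := h1.dem i
      rw [QState.dem_of_pos h5] at h7
      rw [h7.coreDeg_eq, invNum_swap_of_pos d h5, ← h1.coreDeg_eq] at he
      rw [h3 (by omega), Int.sign_eq_one_of_pos h5, one_mul]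

end Words

/-! ### The rows of the bounded partition of a core -/

theorem injOn_succ_fst (s : Set (ℕ × ℕ)) : Set.InjOn (fun c : ℕ × ℕ => (c.1 + 1, c.2)) s := by
  rintro ⟨a, b⟩ _ ⟨a', b'⟩ _ h
  simpa using h

/-- Remove the first row. -/
def tailD (g : YoungDiagram) : YoungDiagram where
  cells := g.cells.preimage (fun c => (c.1 + 1, c.2)) (injOn_succ_fst _)
  isLowerSet := by
    rintro ⟨a, b⟩ ⟨a', b'⟩ hle hm
    obtain ⟨h1, h2⟩ : a' ≤ a ∧ b' ≤ b := hle
    have hm' := Finset.mem_preimage.1 (Finset.mem_coe.1 hm)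
    refine Finset.mem_coe.2 (Finset.mem_preimage.2 ?_)
    rw [YoungDiagram.mem_cells] at hm' ⊢
    exact g.up_left_mem (Nat.succ_le_succ h1) h2 hm'

theorem mem_tailD {g : YoungDiagram} {p q : ℕ} : (p, q) ∈ tailD g ↔ (p + 1, q) ∈ g := by
  have h : (p, q) ∈ (tailD g).cells ↔ (p + 1, q) ∈ g.cells :=
    Finset.mem_preimage (hf := injOn_succ_fst _)
  exact h

theorem rowLen_tailD (g : YoungDiagram) (p : ℕ) : (tailD g).rowLen p = g.rowLen (p + 1) :=
  eq_of_lt_iff fun j => by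
    rw [← YoungDiagram.mem_iff_lt_rowLen, ← YoungDiagram.mem_iff_lt_rowLen, mem_tailD]

theorem colLen_tailD (g : YoungDiagram) (q : ℕ) : (tailD g).colLen q = g.colLen q - 1 :=
  eq_of_lt_iff fun j => by
    rw [← YoungDiagram.mem_iff_lt_colLen, mem_tailD, YoungDiagram.mem_iff_lt_colLen]
    omega

theorem tailD_le (g : YoungDiagram) : tailD g ≤ g := by
  rintro ⟨p, q⟩ h
  exact g.up_left_mem (Nat.le_succ _) le_rfl (mem_tailD.1 h)

theorem hookLength_tailD (g : YoungDiagram) (p q : ℕ) :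
    hookLength (tailD g) (p, q) = hookLength g (p + 1, q) := by
  simp only [hookLength, rowLen_tailD, colLen_tailD]
  omega

theorem IsCore.tailD {n : ℕ} {g : YoungDiagram} (hg : IsCore n g) : IsCore n (tailD g) := by
  rintro ⟨p, q⟩ h
  rw [hookLength_tailD]
  exact hg _ (mem_tailD.1 h)

theorem mem_smallHookCells {k : ℕ} {g : YoungDiagram} {c : ℕ × ℕ} :
    c ∈ smallHookCells k g ↔ c ∈ g ∧ hookLength g c ≤ k := by
  simp [smallHookCells]

theorem boundedRows_tailD (k : ℕ) (g : YoungDiagram) (i : ℕ) :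
    boundedRows k (tailD g) i = boundedRows k g (i + 1) := by
  refine Finset.card_nbij (fun c => (c.1 + 1, c.2)) ?_ ?_ ?_
  · rintro ⟨p, q⟩ h
    simp only [Finset.coe_filter, Set.mem_ofPred_eq, mem_smallHookCells, hookLength_tailD,
      mem_tailD, add_left_inj] at h ⊢
    exact h
  · rintro ⟨a, b⟩ _ ⟨a', b'⟩ _ h
    simpa using h
  · rintro ⟨p, q⟩ h
    simp only [Finset.coe_filter, Set.mem_ofPred_eq, mem_smallHookCells] at h
    obtain ⟨h, rfl⟩ := h
    refine ⟨(i, q), ?_, rfl⟩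
    simpa [mem_smallHookCells, hookLength_tailD, mem_tailD] using h

theorem coreDeg_eq_sum (k : ℕ) (g : YoungDiagram) {B : ℕ} (hB : g.colLen 0 ≤ B) :
    coreDeg k g = ∑ i ∈ Finset.range B, boundedRows k g i := by
  refine Finset.card_eq_sum_card_fiberwise (f := Prod.fst) ?_
  rintro ⟨p, q⟩ h
  simp only [Finset.mem_coe, mem_smallHookCells] at h
  have := YoungDiagram.mem_iff_lt_colLen.1 (g.up_left_mem le_rfl (Nat.zero_le _) h.1)
  simp only [Finset.coe_range, Set.mem_Iio]
  omega

theorem card_eq_sum_rowLen (g : YoungDiagram) {B : ℕ} (hB : g.colLen 0 ≤ B) :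
    g.card = ∑ i ∈ Finset.range B, g.rowLen i := by
  simp only [YoungDiagram.rowLen_eq_card]
  refine Finset.card_eq_sum_card_fiberwise (f := Prod.fst) ?_
  rintro ⟨p, q⟩ h
  have := YoungDiagram.mem_iff_lt_colLen.1 (g.up_left_mem le_rfl (Nat.zero_le _) h)
  simp only [Finset.coe_range, Set.mem_Iio]
  omega

theorem coreDeg_eq_add (k : ℕ) (g : YoungDiagram) :
    coreDeg k g = boundedRows k g 0 + coreDeg k (tailD g) := by
  rw [coreDeg_eq_sum k g (Nat.le_succ _), coreDeg_eq_sum k (tailD g) (B := g.colLen 0)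
    (by rw [colLen_tailD]; omega), Finset.sum_range_succ']
  simp only [boundedRows_tailD]
  rw [add_comm]

theorem bead_top (g : YoungDiagram) : bead g ((g.rowLen 0 : ℤ) - 1) := ⟨0, by simp⟩

open Classical in
/-- The number of gaps among the `k` positions before `q`. -/
def gapCount (k : ℕ) (g : YoungDiagram) (q : ℤ) : ℕ :=
  ((Finset.Ico (q - k) q).filter fun t => ¬ bead g t).card

theorem gapCount_le (k : ℕ) (g : YoungDiagram) (q : ℤ) : gapCount k g q ≤ k := by
  classical
  rw [gapCount]
  refine (Finset.card_filter_le _ _).trans ?_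
  simp

/-- The cells of the first row correspond to the gaps below the top bead, and the hook length is the
distance to it. -/
theorem boundedRows_zero (k : ℕ) (g : YoungDiagram) :
    boundedRows k g 0 = gapCount k g ((g.rowLen 0 : ℤ) - 1) := by
  refine Finset.card_nbij (fun c => (c.2 : ℤ) - g.colLen c.2) ?_ ?_ ?_
  · rintro ⟨p, q⟩ h
    simp only [Finset.coe_filter, Set.mem_ofPred_eq, mem_smallHookCells, Finset.mem_Ico] at h ⊢
    obtain ⟨⟨h1, h2⟩, rfl⟩ := h
    have h3 := hookLength_eq h1
    have h4 := YoungDiagram.mem_iff_lt_rowLen.1 h1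
    have h5 := YoungDiagram.mem_iff_lt_colLen.1 h1
    refine ⟨⟨by omega, by omega⟩, not_bead_iff.2 ⟨q, rfl⟩⟩
  · rintro ⟨p, q⟩ h ⟨p', q'⟩ h' he
    simp only [Finset.coe_filter, Set.mem_ofPred_eq] at h h' he
    obtain ⟨-, rfl⟩ := h
    obtain ⟨-, rfl⟩ := h'
    rcases lt_trichotomy q q' with hlt | rfl | hlt
    · have := g.colLen_anti q q' hlt.le
      omega
    · rfl
    · have := g.colLen_anti q' q hlt.le
      omega
  · intro t ht
    simp only [Finset.coe_filter, Set.mem_ofPred_eq, Finset.mem_Ico] at ht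
    obtain ⟨⟨h1, h2⟩, h3⟩ := ht
    obtain ⟨s, hs⟩ := not_bead_iff.1 h3
    have hm : (0, s) ∈ g := mem_of_colLen_lt (by push_cast; omega)
    refine ⟨(0, s), ?_, hs⟩
    have h4 := hookLength_eq hm
    simp only [Finset.coe_filter, Set.mem_ofPred_eq, mem_smallHookCells, and_true]
    refine ⟨hm, ?_⟩
    push_cast at h4
    omega

theorem boundedRows_zero_le (k : ℕ) (g : YoungDiagram) : boundedRows k g 0 ≤ k := by
  rw [boundedRows_zero]
  exact gapCount_le _ _ _

open Classical in
theorem gapCount_add_one (k : ℕ) (g : YoungDiagram) (q : ℤ) :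
    gapCount k g (q + 1) + (if bead g (q - k) then 0 else 1) =
      gapCount k g q + if bead g q then 0 else 1 := by
  have e1 : Finset.Ico (q - k) (q + 1) = insert q (Finset.Ico (q - k) q) := by
    ext t; simp only [Finset.mem_Ico, Finset.mem_insert]; omega
  have e2 : Finset.Ico (q - k) (q + 1) = insert (q - k) (Finset.Ico (q + 1 - k) (q + 1)) := by
    ext t; simp only [Finset.mem_Ico, Finset.mem_insert]; omega
  have h := congrArg (fun s : Finset ℤ => (s.filter fun t => ¬ bead g t).card) (e2.symm.trans e1)
  simp only [Finset.filter_insert] at h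
  have n1 : q - k ∉ (Finset.Ico (q + 1 - k) (q + 1)).filter fun t => ¬ bead g t := by
    simp only [Finset.mem_filter, Finset.mem_Ico]; omega
  have n2 : q ∉ (Finset.Ico (q - k) q).filter fun t => ¬ bead g t := by
    simp only [Finset.mem_filter, Finset.mem_Ico]; omega
  rw [gapCount, gapCount]
  by_cases h1 : bead g q <;> by_cases h2 : bead g (q - k) <;>
    simp only [h1, h2, not_true_eq_false, not_false_eq_true, if_true, if_false,
      Finset.card_insert_of_notMem n1, Finset.card_insert_of_notMem n2] at h ⊢ <;> omega

theorem gapCount_eq (k : ℕ) (g : YoungDiagram) : gapCount k g ((g.rowLen 0 : ℤ) + k) = k := by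
  classical
  rw [gapCount, Finset.filter_true_of_mem]
  · simp
  · intro t ht
    rw [Finset.mem_Ico] at ht
    exact not_bead_of_le g (by omega)

/-- Add a first row of length `p`. -/
def consD (p : ℕ) (g : YoungDiagram) (hp : g.rowLen 0 ≤ p) : YoungDiagram where
  cells := (Finset.range p).image (fun q => (0, q)) ∪ g.cells.image (fun c => (c.1 + 1, c.2))
  isLowerSet := by
    rintro ⟨a, b⟩ ⟨a', b'⟩ hle hm
    obtain ⟨h1, h2⟩ : a' ≤ a ∧ b' ≤ b := hle
    simp only [Finset.coe_union, Finset.coe_image, Set.mem_union, Set.mem_image, Finset.mem_coe,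
      Finset.mem_range, YoungDiagram.mem_cells, Prod.mk.injEq, Prod.exists] at hm ⊢
    have hb : b < p := by
      rcases hm with ⟨q, hq, -, rfl⟩ | ⟨a1, b1, h3, -, rfl⟩
      · exact hq
      · have := YoungDiagram.mem_iff_lt_rowLen.1 (g.up_left_mem (Nat.zero_le _) le_rfl h3)
        omega
    rcases a' with _ | a'
    · exact Or.inl ⟨b', by omega, rfl, rfl⟩
    · rcases hm with ⟨q, hq, h3, rfl⟩ | ⟨a1, b1, h3, rfl, rfl⟩
      · omega
      · exact Or.inr ⟨a', b', g.up_left_mem (by omega) h2 h3, rfl, rfl⟩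

theorem tailD_consD {p : ℕ} {g : YoungDiagram} (hp : g.rowLen 0 ≤ p) :
    tailD (consD p g hp) = g := by
  ext ⟨a, b⟩
  rw [YoungDiagram.mem_cells, YoungDiagram.mem_cells, mem_tailD, ← YoungDiagram.mem_cells]
  simp [consD]

theorem rowLen_consD {p : ℕ} {g : YoungDiagram} (hp : g.rowLen 0 ≤ p) :
    (consD p g hp).rowLen 0 = p :=
  eq_of_lt_iff fun j => by
    rw [← YoungDiagram.mem_iff_lt_rowLen, ← YoungDiagram.mem_cells]
    simp [consD]

theorem bead_consD {p : ℕ} {g : YoungDiagram} (hp : g.rowLen 0 ≤ p) (j : ℤ) :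
    bead (consD p g hp) j ↔ j = p - 1 ∨ bead g (j + 1) := by
  have h1 : ∀ r, (consD p g hp).rowLen (r + 1) = g.rowLen r := fun r => by
    rw [← rowLen_tailD, tailD_consD]
  constructor
  · rintro ⟨r, hr⟩
    rcases r with _ | r
    · rw [rowLen_consD] at hr
      push_cast at hr
      exact Or.inl (by omega)
    · rw [h1] at hr
      push_cast at hr
      exact Or.inr ⟨r, by omega⟩
  · rintro (rfl | ⟨r, hr⟩)
    · exact ⟨0, by rw [rowLen_consD]; push_cast; ring⟩
    · exact ⟨r + 1, by rw [h1]; push_cast; omega⟩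

/-- The new top bead is slid to the right until the `k` positions before it contain at least `t`
gaps for the first time. By minimality there are then exactly `t` of them and the position just
leaving the window is a bead, which is the core condition for the new bead. -/
theorem exists_consD {k : ℕ} {g : YoungDiagram} (hg : IsCore (k + 1) g) {t : ℕ}
    (ht : boundedRows k g 0 ≤ t) (htk : t ≤ k) :
    ∃ h : YoungDiagram, IsCore (k + 1) h ∧ tailD h = g ∧ boundedRows k h 0 = t := by
  classical
  have hex : ∃ j : ℕ, t ≤ gapCount k g ((g.rowLen 0 : ℤ) + j) := ⟨k, by rwa [gapCount_eq]⟩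
  set j := Nat.find hex with hj
  have h1 : t ≤ gapCount k g ((g.rowLen 0 : ℤ) + j) := Nat.find_spec hex
  have h2 : gapCount k g ((g.rowLen 0 : ℤ) + j) = t ∧ bead g ((g.rowLen 0 : ℤ) + j - (k + 1)) := by
    rcases hj0 : j with _ | i
    · rw [hj0] at h1
      have h3 := gapCount_add_one k g ((g.rowLen 0 : ℤ) - 1)
      rw [sub_add_cancel, if_pos (bead_top g), ← boundedRows_zero] at h3
      push_cast at h1 ⊢
      rw [add_zero] at h1 ⊢
      split_ifs at h3 with h4
      · refine ⟨by omega, ?_⟩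
        convert h4 using 1
        ring
      · omega
    · have h3 := gapCount_add_one k g ((g.rowLen 0 : ℤ) + i)
      have h4 : ¬ t ≤ gapCount k g ((g.rowLen 0 : ℤ) + i) := Nat.find_min hex (by omega)
      rw [if_neg (not_bead_of_le g (j := (g.rowLen 0 : ℤ) + i) (by omega))] at h3
      rw [hj0] at h1
      push_cast at h1 ⊢
      rw [← add_assoc] at h1 ⊢
      split_ifs at h3 with h5
      · refine ⟨by omega, ?_⟩
        convert h5 using 1
        ring
      · omega
  have hp : g.rowLen 0 ≤ g.rowLen 0 + j := Nat.le_add_right _ _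
  refine ⟨consD _ g hp, ?_, tailD_consD hp, ?_⟩
  · rw [isCore_iff] at hg ⊢
    intro i hi
    rw [bead_consD] at hi ⊢
    rcases hi with rfl | hi
    · right
      convert h2.2 using 1
      push_cast
      ring
    · right
      convert hg _ hi using 1
      ring
  · rw [boundedRows_zero, rowLen_consD, ← h2.1, gapCount, gapCount]
    refine Finset.card_nbij (fun t => t + 1) ?_ (fun a _ b _ h => by simpa using h) ?_
    · intro t ht
      simp only [Finset.coe_filter, Set.mem_ofPred_eq, Finset.mem_Ico, bead_consD, not_or] at ht ⊢
      push_cast at ht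
      exact ⟨⟨by omega, by omega⟩, ht.2.2⟩
    · intro t ht
      simp only [Finset.coe_filter, Set.mem_ofPred_eq, Finset.mem_Ico] at ht
      refine ⟨t - 1, ?_, by simp⟩
      simp only [Finset.coe_filter, Set.mem_ofPred_eq, Finset.mem_Ico, bead_consD, not_or,
        sub_add_cancel]
      push_cast
      exact ⟨⟨by omega, by omega⟩, by omega, ht.2⟩

/-- Surjectivity of `boundedRows` on cores, with rows added from the bottom up. This is all that the
choice in `coreOf` requires. -/
theorem exists_core (k B : ℕ) (f : ℕ → ℕ) (hf : Antitone f) (h0 : f 0 ≤ k)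
    (hB : ∀ i, B ≤ i → f i = 0) : ∃ g, IsCore (k + 1) g ∧ boundedRows k g = f := by
  induction B generalizing f with
  | zero =>
    refine ⟨⊥, isCore_bot k, ?_⟩
    funext i
    rw [hB i (Nat.zero_le _), boundedRows, Finset.card_eq_zero]
    ext c
    simp [mem_smallHookCells]
  | succ B ih =>
    obtain ⟨g, hg, hgf⟩ := ih (fun i => f (i + 1)) (fun a b h => hf (by omega))
      ((hf (Nat.zero_le _)).trans h0) (fun i hi => hB _ (by omega))
    obtain ⟨h, h1, h2, h3⟩ := exists_consD hg (t := f 0)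
      (by rw [hgf]; exact hf (Nat.zero_le _)) h0
    refine ⟨h, h1, ?_⟩
    funext i
    rcases i with _ | i
    · exact h3
    · rw [← boundedRows_tailD, h2, hgf]

theorem exists_core_of_boundedPartition {k : ℕ} (l : BoundedPartition k) :
    ∃ g ∈ {g | IsCore (k + 1) g}, boundedRows k g = l.1.rowLen := by
  refine exists_core k (l.1.colLen 0) _ (fun a b h => l.1.rowLen_anti a b h) l.2 fun i hi => ?_
  by_contra h
  have := YoungDiagram.mem_iff_lt_colLen.1
    (YoungDiagram.mem_iff_lt_rowLen.2 (Nat.pos_of_ne_zero h))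
  omega

theorem isCore_coreOf {k : ℕ} (l : BoundedPartition k) : IsCore (k + 1) (coreOf k l) :=
  Function.invFunOn_mem (exists_core_of_boundedPartition l)

theorem boundedRows_coreOf {k : ℕ} (l : BoundedPartition k) :
    boundedRows k (coreOf k l) = l.1.rowLen :=
  Function.invFunOn_eq (exists_core_of_boundedPartition l)

theorem coreDeg_coreOf {k : ℕ} (l : BoundedPartition k) : coreDeg k (coreOf k l) = l.size := by
  rw [coreDeg_eq_sum k (coreOf k l) (le_max_left _ (l.1.colLen 0)), BoundedPartition.size,
    card_eq_sum_rowLen l.1 (le_max_right ((coreOf k l).colLen 0) _), boundedRows_coreOf]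

/-! ### The strip between `tailD g` and `g` -/

/-- The residues of the bottom cells of the columns. -/
def bottomRes (k : ℕ) (g : YoungDiagram) : Finset (ZMod (k + 1)) :=
  (g.cells.filter fun x => x ∉ tailD g).image (residue k)

theorem mem_bottomRes {k : ℕ} {g : YoungDiagram} {i : ZMod (k + 1)} :
    i ∈ bottomRes k g ↔ ∃ x ∈ g, x ∉ tailD g ∧ residue k x = i := by
  simp only [bottomRes, Finset.mem_image, Finset.mem_filter, YoungDiagram.mem_cells, and_assoc]

/-- The bottom cell of a column has residue one more than the gap of that column. In a core, a gap
moved up by multiples of `k + 1` stays a gap, so it can be brought among the `k` positions before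
the top bead, where `boundedRows k g 0` counts the gaps. -/
theorem card_bottomRes_le {k : ℕ} {g : YoungDiagram} (hg : IsCore (k + 1) g) :
    (bottomRes k g).card ≤ boundedRows k g 0 := by
  classical
  rw [isCore_iff] at hg
  rw [boundedRows_zero, gapCount]
  refine (Finset.card_le_card ?_).trans
    (Finset.card_image_le (f := fun t : ℤ => ((t + 1 : ℤ) : ZMod (k + 1))))
  intro i hi
  obtain ⟨⟨p, q⟩, h1, h2, rfl⟩ := mem_bottomRes.1 hi
  rw [mem_tailD] at h2
  have h3 := YoungDiagram.mem_iff_lt_colLen.1 h1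
  rw [YoungDiagram.mem_iff_lt_colLen] at h2
  have h4 := YoungDiagram.mem_iff_lt_rowLen.1 (g.up_left_mem (Nat.zero_le _) le_rfl h1)
  set M : ℤ := (g.rowLen 0 : ℤ) - 1 with hM
  set t : ℤ := (q : ℤ) - g.colLen q with ht
  have hgap : ¬ bead g t := not_bead_iff.2 ⟨q, rfl⟩
  have hup : ∀ m : ℕ, ¬ bead g (t + m * (k + 1)) := by
    intro m
    induction m with
    | zero => simpa using hgap
    | succ m ih =>
      intro hb
      apply ih
      convert hg _ hb using 1
      push_cast
      ring
  have hk : (0 : ℤ) < (k : ℤ) + 1 := by positivity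
  have hdm := Int.emod_add_mul_ediv (M - t) (k + 1)
  have hm1 := Int.emod_nonneg (M - t) hk.ne'
  have hm2 := Int.emod_lt_of_pos (M - t) hk
  have hd : 0 ≤ (M - t) / (k + 1) := Int.ediv_nonneg (by omega) hk.le
  obtain ⟨m, hm⟩ := Int.eq_ofNat_of_zero_le hd
  rw [hm] at hdm
  have hmm : ((k : ℤ) + 1) * (m : ℤ) = m * (k + 1) := mul_comm _ _
  have hne : t + m * (k + 1) ≠ M := by
    intro h
    apply hup m
    rw [h]
    exact bead_top g
  refine Finset.mem_image.2 ⟨t + m * (k + 1), ?_, ?_⟩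
  · rw [Finset.mem_filter, Finset.mem_Ico]
    exact ⟨⟨by linarith, by
      refine lt_of_le_of_ne ?_ hne
      linarith⟩, hup m⟩
  · have hp : (g.colLen q : ℤ) = p + 1 := by omega
    rw [residue_eq, intCast_eq_iff_exists]
    exact ⟨-m, by rw [ht, hp]; ring⟩

/-- The word covers the strip, so its result contains `g`. Its length is at most the difference in
degree between `g` and `tailD g`, and equal degrees force equality. -/
theorem addW_bottomRes {k : ℕ} [NeZero k] {g : YoungDiagram} (hg : IsCore (k + 1) g) :
    bottomRes k g ≠ Finset.univ ∧ (bottomRes k g).card = boundedRows k g 0 ∧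
      addW k (wordOf (bottomRes k g)) (tailD g) = g := by
  have hle := card_bottomRes_le hg
  have hk := boundedRows_zero_le k g
  have hne : bottomRes k g ≠ Finset.univ := by
    intro h
    rw [h, Finset.card_univ, ZMod.card] at hle
    omega
  have h1 : g ≤ addW k (wordOf (bottomRes k g)) (tailD g) := by
    refine (wordOf_isCD hne).le_addW_of_isStrip (fun p q h => mem_tailD.2 h) (tailD_le g) ?_
    intro x hx hxg
    rw [mem_wordOf hne, mem_bottomRes]
    exact ⟨x, hx, hxg, rfl⟩
  have h2 := coreDeg_addW_le hg.tailD (wordOf (bottomRes k g))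
  rw [length_wordOf hne] at h2
  have h3 := coreDeg_eq_add k g
  have h4 := coreDeg_mono hg (hg.tailD.addW _) h1
  refine ⟨hne, by omega, ?_⟩
  exact (eq_of_le_of_coreDeg_le hg (hg.tailD.addW _) h1 (by omega)).symm

/-! ### Expansion of the coefficients over sequences of sets of residues -/

/-- Add corners according to a sequence of sets of residues, the last set first. -/
def addL (k : ℕ) (s : List (Finset (ZMod (k + 1)))) (g : YoungDiagram) : YoungDiagram :=
  s.foldr (fun J h => addW k (wordOf J) h) g

@[simp] theorem addL_nil (k : ℕ) (g : YoungDiagram) : addL k [] g = g := rfl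

@[simp] theorem addL_cons (k : ℕ) (J : Finset (ZMod (k + 1))) (s : List (Finset (ZMod (k + 1))))
    (g : YoungDiagram) : addL k (J :: s) g = addW k (wordOf J) (addL k s g) := rfl

/-- The sequences of proper sets of residues with given cardinalities. -/
def seqs (k : ℕ) : List ℕ → Finset (List (Finset (ZMod (k + 1))))
  | [] => {[]}
  | r :: L => (properSets k r ×ˢ seqs k L).map
      ⟨fun q => q.1 :: q.2, fun a b h => Prod.ext (List.cons.inj h).1 (List.cons.inj h).2⟩

theorem mem_seqs_nil {k : ℕ} {s : List (Finset (ZMod (k + 1)))} : s ∈ seqs k [] ↔ s = [] :=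
  Finset.mem_singleton

theorem mem_seqs_cons {k r : ℕ} {L : List ℕ} {s : List (Finset (ZMod (k + 1)))} :
    s ∈ seqs k (r :: L) ↔ ∃ J s', J ∈ properSets k r ∧ s' ∈ seqs k L ∧ s = J :: s' := by
  rw [seqs, Finset.mem_map]
  constructor
  · rintro ⟨⟨J, s'⟩, h, rfl⟩
    exact ⟨J, s', (Finset.mem_product.1 h).1, (Finset.mem_product.1 h).2, rfl⟩
  · rintro ⟨J, s', h1, h2, rfl⟩
    exact ⟨(J, s'), Finset.mem_product.2 ⟨h1, h2⟩, rfl⟩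

theorem mem_seqs {k : ℕ} {L : List ℕ} {s : List (Finset (ZMod (k + 1)))} :
    s ∈ seqs k L ↔ s.map Finset.card = L ∧ ∀ J ∈ s, J ≠ Finset.univ := by
  induction L generalizing s with
  | nil =>
    rw [mem_seqs_nil, List.map_eq_nil_iff]
    constructor
    · rintro rfl
      simp
    · exact fun h => h.1
  | cons r L ih =>
    rw [mem_seqs_cons]
    constructor
    · rintro ⟨J, s', hJ, hs, rfl⟩
      rw [mem_properSets] at hJ
      rw [ih] at hs
      refine ⟨by rw [List.map_cons, hJ.1, hs.1], fun I hI => ?_⟩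
      rcases List.mem_cons.1 hI with rfl | hI
      · exact hJ.2
      · exact hs.2 I hI
    · rintro ⟨h1, h2⟩
      rcases s with _ | ⟨J, s'⟩
      · simp at h1
      · rw [List.map_cons, List.cons.injEq] at h1
        exact ⟨J, s', mem_properSets.2 ⟨h1.1, h2 J (by simp)⟩,
          ih.2 ⟨h1.2, fun I hI => h2 I (List.mem_cons_of_mem _ hI)⟩, rfl⟩

theorem prod_opH_eq (k : ℕ) (L : List ℕ) :
    (L.map (opH k)).prod = ∑ s ∈ seqs k L, (s.map (opT k)).prod := by
  induction L with
  | nil => simp [seqs]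
  | cons r L ih =>
    rw [List.map_cons, List.prod_cons, ih, opH, seqs, Finset.sum_map, Finset.sum_product,
      Finset.sum_mul_sum]
    rfl

section

variable {k : ℕ} [NeZero k]

theorem IsCore.addL {g : YoungDiagram} (hg : IsCore (k + 1) g)
    (s : List (Finset (ZMod (k + 1)))) : IsCore (k + 1) (addL k s g) := by
  induction s with
  | nil => exact hg
  | cons J s ih => exact ih.addW _

theorem coreDeg_addL_le {L : List ℕ} {s : List (Finset (ZMod (k + 1)))} (hs : s ∈ seqs k L) :
    coreDeg k (AffineGrothendieck.addL k s ⊥) ≤ L.sum := by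
  induction L generalizing s with
  | nil =>
    rw [mem_seqs_nil.1 hs, addL_nil, coreDeg_bot]
    simp
  | cons r L ih =>
    obtain ⟨J, s', hJ, hs', rfl⟩ := mem_seqs_cons.1 hs
    rw [mem_properSets] at hJ
    have h1 := coreDeg_addW_le (k := k) ((isCore_bot k).addL s') (wordOf J)
    rw [length_wordOf hJ.2, hJ.1] at h1
    have h2 := ih hs'
    rw [addL_cons, List.sum_cons]
    omega

theorem exists_prod_opT {L : List ℕ} {s : List (Finset (ZMod (k + 1)))} (hs : s ∈ seqs k L) :
    ∃ d : QState k, ∃ e : ℤ, Rep d (AffineGrothendieck.addL k s ⊥) ∧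
      (s.map (opT k)).prod (Finsupp.single (emptyState k) 1) = Finsupp.single d e ∧
      (coreDeg k (AffineGrothendieck.addL k s ⊥) = L.sum → e = 1) := by
  induction L generalizing s with
  | nil =>
    rw [mem_seqs_nil.1 hs]
    exact ⟨emptyState k, 1, rep_emptyState k, by simp, fun _ => rfl⟩
  | cons r L ih =>
    obtain ⟨J, s', hJ, hs', rfl⟩ := mem_seqs_cons.1 hs
    rw [mem_properSets] at hJ
    obtain ⟨d, e, h1, h2, h3⟩ := ih hs'
    obtain ⟨d', e', h1', h2', h3'⟩ := exists_prod_genA (wordOf J) h1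
    refine ⟨d', e * e', h1', ?_, fun he => ?_⟩
    · rw [List.map_cons, List.prod_cons, Module.End.mul_apply, h2, opT, h2']
    · rw [addL_cons, List.sum_cons] at he
      have h4 := coreDeg_addW_le (k := k) ((isCore_bot k).addL s') (wordOf J)
      have h5 := coreDeg_addL_le hs'
      rw [length_wordOf hJ.2, hJ.1] at h3' h4
      rw [h3 (by omega), h3' (by omega), one_mul]

open Classical in
/-- The number of sequences of sets of residues that build the shape `g`. -/
def numSeq (k : ℕ) (L : List ℕ) (g : YoungDiagram) : ℕ :=
  ((seqs k L).filter fun s => AffineGrothendieck.addL k s ⊥ = g).card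

/-- In this degree all letters must add corners effectively, so every contributing sequence has sign
`+1`. -/
theorem coefH_eq_numSeq {c : QState k} {g : YoungDiagram} (hc : Rep c g) {L : List ℕ}
    (hL : coreDeg k g = L.sum) : coefH L c = numSeq k L g := by
  classical
  rw [coefH, prod_opH_eq, LinearMap.sum_apply, Finsupp.coe_finsetSum, Finset.sum_apply, numSeq,
    Finset.card_filter]
  push_cast
  refine Finset.sum_congr rfl fun s hs => ?_
  obtain ⟨d, e, h1, h2, h3⟩ := exists_prod_opT hs
  rw [h2, Finsupp.single_apply]
  refine if_ctx_congr ⟨?_, fun h => ?_⟩ (fun h => ?_) fun _ => rfl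
  · rintro rfl
    exact h1.eq_diagram hc
  · rw [h] at h1
    exact h1.eq_state hc
  · exact h3 (by rw [h, hL])

theorem coefH_eq_zero {c : QState k} {g : YoungDiagram} (hc : Rep c g) {L : List ℕ}
    (hL : L.sum < coreDeg k g) : coefH L c = 0 := by
  classical
  rw [coefH, prod_opH_eq, LinearMap.sum_apply, Finsupp.coe_finsetSum, Finset.sum_apply]
  refine Finset.sum_eq_zero fun s hs => ?_
  obtain ⟨d, e, h1, h2, -⟩ := exists_prod_opT hs
  rw [h2, Finsupp.single_apply, if_neg]
  rintro rfl
  have h3 := coreDeg_addL_le hs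
  rw [h1.eq_diagram hc] at h3
  omega

theorem coefH_perm {L L' : List ℕ} (h : L.Perm L') (c : QState k) : coefH L c = coefH L' c := by
  rw [coefH, coefH]
  have : (L.map (opH k)).prod = (L'.map (opH k)).prod := by
    refine (h.map _).prod_eq' (List.pairwise_map.2 (List.Pairwise.imp (R := fun _ _ => True)
      (fun _ => opH_mul_comm k _ _) (List.pairwise_of_forall fun _ _ => trivial)))
  rw [this]

theorem opH_zero : opH k 0 = 1 := by
  have h : properSets k 0 = {∅} := by
    ext J
    rw [mem_properSets, Finset.card_eq_zero, Finset.mem_singleton]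
    refine and_iff_left_of_imp ?_
    rintro rfl
    exact Finset.univ_nonempty.ne_empty.symm
  have h2 : wordOf (∅ : Finset (ZMod (k + 1))) = [] := by
    have h3 : (∅ : Finset (ZMod (k + 1))) ≠ Finset.univ := Finset.univ_nonempty.ne_empty.symm
    rw [← List.length_eq_zero_iff, length_wordOf h3, Finset.card_empty]
  rw [opH, h, Finset.sum_singleton, opT, h2, List.map_nil, List.prod_nil]

theorem coefH_filter (L : List ℕ) (c : QState k) :
    coefH (L.filter (· ≠ 0)) c = coefH L c := by
  rw [coefH, coefH]
  congr 2
  induction L with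
  | nil => rfl
  | cons r L ih =>
    by_cases h : r = 0
    · rw [List.filter_cons_of_neg (by simpa using h), ih, h, List.map_cons, List.prod_cons,
        opH_zero, one_mul]
    · rw [List.filter_cons_of_pos (by simpa using h), List.map_cons, List.prod_cons, ih,
        List.map_cons, List.prod_cons]

theorem coefH_eq_zero_of_lt {L : List ℕ} {r : ℕ} (hr : r ∈ L) (hk : k < r) (c : QState k) :
    coefH L c = 0 := by
  have h0 : opH k r = 0 := by
    rw [opH]
    refine Finset.sum_eq_zero fun J hJ => ?_
    obtain ⟨h1, h2⟩ := mem_properSets.1 hJ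
    have h3 := Finset.card_lt_card (Finset.ssubset_univ_iff.2 h2)
    rw [Finset.card_univ, ZMod.card] at h3
    omega
  rw [coefH, List.prod_eq_zero (List.mem_map.2 ⟨r, hr, h0⟩)]
  simp

/-! ### Triangularity -/

/-- The head of the list acts last. Before this last strip the core already contains `tailD g`, so
the strip cannot raise the degree by more than the first bounded row. -/
theorem le_of_numSeq_cons {g : YoungDiagram} (hg : IsCore (k + 1) g) {r : ℕ} {L : List ℕ}
    (hL : coreDeg k g = r + L.sum) (h : numSeq k (r :: L) g ≠ 0) : r ≤ boundedRows k g 0 := by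
  classical
  obtain ⟨s, hs⟩ := Finset.card_ne_zero.1 h
  obtain ⟨hs, hsg⟩ := Finset.mem_filter.1 hs
  obtain ⟨J, s', hJ, hs', rfl⟩ := mem_seqs_cons.1 hs
  rw [mem_properSets] at hJ
  rw [addL_cons] at hsg
  have hc := (isCore_bot k).addL s'
  have h1 := coreDeg_addL_le hs'
  have h2 : tailD g ≤ AffineGrothendieck.addL k s' ⊥ := by
    rintro ⟨p, q⟩ hx
    rw [mem_tailD, ← hsg] at hx
    exact (wordOf_isCD hJ.2).isStrip_addW _ p q hx
  have h3 := coreDeg_mono hg.tailD hc h2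
  have h4 := coreDeg_eq_add k g
  omega

/-- If the last strip is as large as possible, the core before it contains `tailD g` and has the
same degree, hence is `tailD g`. The last set is then forced to be `bottomRes k g`. -/
theorem numSeq_cons {g : YoungDiagram} (hg : IsCore (k + 1) g) {L : List ℕ}
    (hL : coreDeg k (tailD g) = L.sum) :
    numSeq k (boundedRows k g 0 :: L) g = numSeq k L (tailD g) := by
  classical
  obtain ⟨hne, hcard, hadd⟩ := addW_bottomRes hg
  symm
  refine Finset.card_nbij (fun s => bottomRes k g :: s) ?_ (fun a _ b _ h => (List.cons.inj h).2) ?_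
  · intro s hs
    obtain ⟨hs, hsg⟩ := Finset.mem_filter.1 (Finset.mem_coe.1 hs)
    refine Finset.mem_coe.2 (Finset.mem_filter.2
      ⟨mem_seqs_cons.2 ⟨_, s, mem_properSets.2 ⟨hcard, hne⟩, hs, rfl⟩, ?_⟩)
    rw [addL_cons, hsg, hadd]
  · intro s hs
    obtain ⟨hs, hsg⟩ := Finset.mem_filter.1 (Finset.mem_coe.1 hs)
    obtain ⟨J, s', hJ, hs', rfl⟩ := mem_seqs_cons.1 hs
    rw [mem_properSets] at hJ
    rw [addL_cons] at hsg
    have hc := (isCore_bot k).addL s'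
    have h1 := coreDeg_addL_le hs'
    have h2 : tailD g ≤ AffineGrothendieck.addL k s' ⊥ := by
      rintro ⟨p, q⟩ hx
      rw [mem_tailD, ← hsg] at hx
      exact (wordOf_isCD hJ.2).isStrip_addW _ p q hx
    have h4 := coreDeg_eq_add k g
    have h5 : tailD g = AffineGrothendieck.addL k s' ⊥ :=
      eq_of_le_of_coreDeg_le hg.tailD hc h2 (by omega)
    have h6 : bottomRes k g = J := by
      ext i
      rw [mem_bottomRes, h5]
      constructor
      · rintro ⟨x, hx, hx', rfl⟩
        rw [← hsg] at hx
        rw [← mem_wordOf hJ.2]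
        exact residue_mem_of_mem_addW hx hx'
      · intro hi
        obtain ⟨x, hx, hx'⟩ := exists_residue_of_coreDeg_addW hc (w := wordOf J) (by
          rw [hsg, ← h5, length_wordOf hJ.2, hJ.1]
          omega) ((mem_wordOf hJ.2).2 hi)
        rw [hsg] at hx
        exact ⟨x, hx, hx'⟩
    refine ⟨s', Finset.mem_coe.2 (Finset.mem_filter.2 ⟨hs', h5.symm⟩), ?_⟩
    simp only [h6]

theorem eq_bot_of_coreDeg {g : YoungDiagram} (hg : IsCore (k + 1) g) (h : coreDeg k g = 0) :
    g = ⊥ :=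
  (eq_of_le_of_coreDeg_le (isCore_bot k) hg bot_le (by omega)).symm

theorem boundedRows_bot (k i : ℕ) : boundedRows k ⊥ i = 0 := by
  rw [boundedRows, Finset.card_eq_zero]
  ext c
  simp [mem_smallHookCells]

/-- The numbers of sequences are unitriangular with respect to the lexicographic order. -/
theorem numSeq_triangular {g : YoungDiagram} (hg : IsCore (k + 1) g) {L : List ℕ}
    (hL : coreDeg k g = L.sum) :
    ((∀ i, L.getD i 0 = boundedRows k g i) → numSeq k L g = 1) ∧
      (numSeq k L g ≠ 0 → (∀ i, L.getD i 0 = boundedRows k g i) ∨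
        ∃ i, (∀ j < i, L.getD j 0 = boundedRows k g j) ∧ L.getD i 0 < boundedRows k g i) := by
  classical
  induction L generalizing g with
  | nil =>
    obtain rfl := eq_bot_of_coreDeg hg hL
    refine ⟨fun _ => ?_, fun _ => Or.inl fun i => ?_⟩
    · rw [numSeq, Finset.filter_true_of_mem]
      · simp [seqs]
      · intro s hs
        rw [mem_seqs_nil.1 hs, addL_nil]
    · simp [boundedRows_bot]
  | cons r L ih =>
    rw [List.sum_cons] at hL
    have h4 := coreDeg_eq_add k g
    have key : r = boundedRows k g 0 → coreDeg k (tailD g) = L.sum := fun h => by omega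
    constructor
    · intro h
      have h0 : r = boundedRows k g 0 := by simpa using h 0
      rw [h0, numSeq_cons hg (key h0)]
      refine (ih hg.tailD (key h0)).1 fun i => ?_
      rw [boundedRows_tailD, ← h (i + 1), List.getD_cons_succ]
    · intro h
      rcases (le_of_numSeq_cons hg hL h).lt_or_eq with h1 | h0
      · exact Or.inr ⟨0, by simp, by simpa using h1⟩
      · rw [h0, numSeq_cons hg (key h0)] at h
        rcases (ih hg.tailD (key h0)).2 h with h1 | ⟨i, h1, h2⟩
        · left
          intro i
          rcases i with _ | i
          · simpa using h0
          · rw [List.getD_cons_succ, h1, boundedRows_tailD]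
        · right
          refine ⟨i + 1, fun j hj => ?_, ?_⟩
          · rcases j with _ | j
            · simpa using h0
            · rw [List.getD_cons_succ, h1 j (by omega), boundedRows_tailD]
          · rw [List.getD_cons_succ, ← boundedRows_tailD]
            exact h2

end

/-! ### Tableaux and sequences of sets of residues -/

/-- The shapes that are built by a sequence of sets of residues. -/
def chainD (k : ℕ) (J : ℕ → Finset (ZMod (k + 1))) (x : ℕ) : YoungDiagram :=
  addL k ((List.range x).reverse.map J) ⊥

theorem chainD_zero (k : ℕ) (J : ℕ → Finset (ZMod (k + 1))) : chainD k J 0 = ⊥ := rfl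

theorem chainD_succ (k : ℕ) (J : ℕ → Finset (ZMod (k + 1))) (x : ℕ) :
    chainD k J (x + 1) = addW k (wordOf (J x)) (chainD k J x) := by
  rw [chainD, List.range_succ, List.reverse_append]
  rfl

theorem chainD_mono (k : ℕ) (J : ℕ → Finset (ZMod (k + 1))) : Monotone (chainD k J) :=
  monotone_nat_of_le_succ fun x => by
    rw [chainD_succ]
    exact le_addW _ _ _

section Tableau

variable {g : YoungDiagram}

/-- The cells of a tableau with entries less than `x`. -/
def levelD (T : SemistandardYoungTableau g) (x : ℕ) : YoungDiagram where
  cells := g.cells.filter fun c => T c.1 c.2 < x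
  isLowerSet := by
    rintro ⟨a, b⟩ ⟨a', b'⟩ hle hm
    obtain ⟨h1, h2⟩ : a' ≤ a ∧ b' ≤ b := hle
    simp only [Finset.coe_filter, YoungDiagram.mem_cells, Set.mem_ofPred_eq] at hm ⊢
    refine ⟨g.up_left_mem h1 h2 hm.1, ?_⟩
    have h3 := T.row_weak_of_le h2 (g.up_left_mem h1 le_rfl hm.1)
    have h4 := T.col_weak h1 hm.1
    omega

theorem mem_levelD {T : SemistandardYoungTableau g} {x p q : ℕ} :
    (p, q) ∈ levelD T x ↔ (p, q) ∈ g ∧ T p q < x := by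
  rw [← YoungDiagram.mem_cells]
  simp [levelD]

theorem levelD_zero (T : SemistandardYoungTableau g) : levelD T 0 = ⊥ := by
  rw [← le_bot_iff]
  rintro ⟨p, q⟩ h
  exact absurd (mem_levelD.1 h).2 (Nat.not_lt_zero _)

theorem levelD_le_succ (T : SemistandardYoungTableau g) (x : ℕ) :
    levelD T x ≤ levelD T (x + 1) := by
  rintro ⟨p, q⟩ h
  rw [mem_levelD] at h ⊢
  exact ⟨h.1, by omega⟩

theorem isStrip_levelD (T : SemistandardYoungTableau g) (x : ℕ) :
    IsStrip (levelD T x) (levelD T (x + 1)) := by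
  intro p q h
  rw [mem_levelD] at h ⊢
  have := T.col_strict (Nat.lt_add_one p) h.1
  exact ⟨g.up_left_mem (Nat.le_succ _) le_rfl h.1, by omega⟩

/-- The residues of the cells with entry `x`. -/
def resSet (k : ℕ) (T : SemistandardYoungTableau g) (x : ℕ) : Finset (ZMod (k + 1)) :=
  (g.cells.filter fun c => T c.1 c.2 = x).image (residue k)

theorem mem_resSet {k : ℕ} {T : SemistandardYoungTableau g} {x : ℕ} {i : ZMod (k + 1)} :
    i ∈ resSet k T x ↔ ∃ p q, (p, q) ∈ g ∧ T p q = x ∧ residue k (p, q) = i := by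
  simp only [resSet, Finset.mem_image, Finset.mem_filter, YoungDiagram.mem_cells, Prod.exists,
    and_assoc]

theorem residue_mem_resSet {k : ℕ} {T : SemistandardYoungTableau g} {x : ℕ} {c : ℕ × ℕ}
    (h : c ∈ levelD T (x + 1)) (h' : c ∉ levelD T x) : residue k c ∈ resSet k T x := by
  obtain ⟨p, q⟩ := c
  rw [mem_levelD] at h h'
  exact mem_resSet.2 ⟨p, q, h.1, by have := h.1; have := h.2; by_contra hc; exact h' ⟨h.1, by omega⟩,
    rfl⟩

variable {k : ℕ} [NeZero k]

/-- The level shapes of a tableau are not known to be cores, so cores `h` inside them are tested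
instead. Removing the strip of the letter `x` costs at most one degree per residue, and equality
makes every removal reversible. A letter with all `k + 1` residues makes the inequality strict,
since passing to `tailD h` costs at most `k`. -/
theorem coreDeg_le_of_le_levelD (T : SemistandardYoungTableau g) (x : ℕ) {h : YoungDiagram}
    (hh : IsCore (k + 1) h) (hle : h ≤ levelD T x) :
    coreDeg k h ≤ ∑ y ∈ Finset.range x, (resSet k T y).card ∧
      (coreDeg k h = ∑ y ∈ Finset.range x, (resSet k T y).card →
        (∀ y < x, resSet k T y ≠ Finset.univ) ∧ chainD k (resSet k T) x = h ∧
          ∀ y ≤ x, chainD k (resSet k T) y ≤ levelD T y) := by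
  induction x generalizing h with
  | zero =>
    rw [levelD_zero, le_bot_iff] at hle
    subst hle
    rw [coreDeg_bot]
    refine ⟨by simp, fun _ => ⟨by simp, rfl, fun y hy => ?_⟩⟩
    obtain rfl : y = 0 := by omega
    exact bot_le
  | succ x ih =>
    rw [Finset.sum_range_succ]
    by_cases hu : resSet k T x = Finset.univ
    · have h1 : tailD h ≤ levelD T x := by
        rintro ⟨p, q⟩ hx
        exact isStrip_levelD T x p q (hle (mem_tailD.1 hx))
      have h2 := (ih hh.tailD h1).1
      have h3 := coreDeg_eq_add k h
      have h4 := boundedRows_zero_le k h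
      rw [hu, Finset.card_univ, ZMod.card]
      exact ⟨by omega, fun _ => by omega⟩
    · have h1 : removeW k (wordOf (resSet k T x)) h ≤ levelD T x :=
        (wordOf_isCD hu).removeW_le (fun p q hx => isStrip_levelD T x p q (hle hx))
          fun c hc hc' => (mem_wordOf hu).2 (residue_mem_resSet (hle hc) hc')
      obtain ⟨h2, h3, h4⟩ := removeW_spec hh (wordOf (resSet k T x))
      rw [length_wordOf hu] at h3 h4
      obtain ⟨h5, h6⟩ := ih h2 h1
      refine ⟨by omega, fun he => ?_⟩
      obtain ⟨h7, h8, h9⟩ := h6 (by omega)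
      have h10 : chainD k (resSet k T) (x + 1) = h := by
        rw [chainD_succ, h8, h4 (by omega)]
      refine ⟨fun y hy => ?_, h10, fun y hy => ?_⟩
      · rcases Nat.lt_succ_iff_lt_or_eq.1 hy with hy | rfl
        · exact h7 y hy
        · exact hu
      · rcases Nat.lt_or_eq_of_le hy with hy | rfl
        · exact h9 y (by omega)
        · rw [h10]
          exact hle

theorem levelD_le_chainD (T : SemistandardYoungTableau g) {x : ℕ}
    (h : ∀ y < x, resSet k T y ≠ Finset.univ) : levelD T x ≤ chainD k (resSet k T) x := by
  induction x with
  | zero => rw [levelD_zero]; exact bot_le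
  | succ x ih =>
    have hx := h x (Nat.lt_succ_self x)
    rw [chainD_succ]
    refine le_trans ?_ (addW_mono k _ (ih fun y hy => h y (by omega)))
    exact (wordOf_isCD hx).le_addW_of_isStrip (isStrip_levelD T x) (levelD_le_succ T x)
      fun c hc hc' => (mem_wordOf hx).2 (residue_mem_resSet hc hc')

/-- The bound on the entries of a tableau of weight `a`. -/
def supBound (a : ℕ →₀ ℕ) : ℕ := a.support.sup (· + 1)

theorem lt_supBound {a : ℕ →₀ ℕ} {x : ℕ} (h : a x ≠ 0) : x < supBound a :=
  Finset.le_sup (f := (· + 1)) (Finsupp.mem_support_iff.2 h)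

theorem eq_zero_of_supBound_le {a : ℕ →₀ ℕ} {x : ℕ} (h : supBound a ≤ x) : a x = 0 := by
  by_contra hc
  have := lt_supBound hc
  omega

theorem degree_eq_sum_range (a : ℕ →₀ ℕ) : a.degree = ∑ y ∈ Finset.range (supBound a), a y := by
  rw [Finsupp.degree_apply]
  refine Finset.sum_subset (fun x hx => Finset.mem_range.2 (lt_supBound
    (Finsupp.mem_support_iff.1 hx))) fun x _ hx => ?_
  simpa using hx

theorem entry_lt_supBound {T : SemistandardYoungTableau g} {a : ℕ →₀ ℕ} (hT : IsKTableau k T a)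
    {p q : ℕ} (h : (p, q) ∈ g) : T p q < supBound a := by
  apply lt_supBound
  rw [← hT.2, ← Nat.pos_iff_ne_zero, Finset.card_pos]
  exact ⟨_, mem_resSet.2 ⟨p, q, h, rfl, rfl⟩⟩

theorem levelD_supBound {T : SemistandardYoungTableau g} {a : ℕ →₀ ℕ} (hT : IsKTableau k T a) :
    levelD T (supBound a) = g := by
  ext ⟨p, q⟩
  rw [YoungDiagram.mem_cells, YoungDiagram.mem_cells, mem_levelD]
  exact ⟨fun h => h.1, fun h => ⟨h, entry_lt_supBound hT h⟩⟩

/-- The weight condition is the case of equality for `h = g`. The two inclusions then squeeze every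
level shape onto the core built by the residue sets. -/
theorem IsKTableau.chain (hg : IsCore (k + 1) g) {T : SemistandardYoungTableau g} {a : ℕ →₀ ℕ}
    (hT : IsKTableau k T a) : (∀ y < supBound a, resSet k T y ≠ Finset.univ) ∧
      chainD k (resSet k T) (supBound a) = g ∧
        ∀ y ≤ supBound a, chainD k (resSet k T) y = levelD T y := by
  have hc : ∀ y, (resSet k T y).card = a y := hT.2
  have hd : coreDeg k g = ∑ y ∈ Finset.range (supBound a), (resSet k T y).card := by
    simp only [hc]
    rw [← degree_eq_sum_range, hT.1]
    rfl
  obtain ⟨h1, h2, h3⟩ := (coreDeg_le_of_le_levelD T (supBound a) hg (levelD_supBound hT).ge).2 hd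
  exact ⟨h1, h2, fun y hy => le_antisymm (h3 y hy)
    (levelD_le_chainD T fun z hz => h1 z (by omega))⟩

theorem IsKTableau.eq_of_resSet_eq (hg : IsCore (k + 1) g) {T T' : SemistandardYoungTableau g}
    {a : ℕ →₀ ℕ} (hT : IsKTableau k T a) (hT' : IsKTableau k T' a)
    (h : ∀ y < supBound a, resSet k T y = resSet k T' y) : T = T' := by
  have hl : ∀ y ≤ supBound a, levelD T y = levelD T' y := by
    intro y hy
    rw [← (hT.chain hg).2.2 y hy, ← (hT'.chain hg).2.2 y hy, chainD, chainD]
    congr 1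
    refine List.map_congr_left fun z hz => h z ?_
    rw [List.mem_reverse, List.mem_range] at hz
    omega
  ext p q
  by_cases hpq : (p, q) ∈ g
  · have h1 := entry_lt_supBound hT hpq
    have h2 := entry_lt_supBound hT' hpq
    have h3 : (p, q) ∈ levelD T' (T p q + 1) := by
      rw [← hl _ h1]
      exact mem_levelD.2 ⟨hpq, Nat.lt_succ_self _⟩
    have h4 : (p, q) ∈ levelD T (T' p q + 1) := by
      rw [hl _ h2]
      exact mem_levelD.2 ⟨hpq, Nat.lt_succ_self _⟩
    rw [mem_levelD] at h3 h4
    omega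
  · rw [T.zeros hpq, T'.zeros hpq]

theorem IsCore.chainD (k : ℕ) [NeZero k] (J : ℕ → Finset (ZMod (k + 1))) (x : ℕ) :
    IsCore (k + 1) (chainD k J x) := (isCore_bot k).addL _

/-- The total degree is maximal, so no step may fall short. -/
theorem coreDeg_chainD {J : ℕ → Finset (ZMod (k + 1))} {b : ℕ} (hJ : ∀ y < b, J y ≠ Finset.univ)
    (hd : coreDeg k (AffineGrothendieck.chainD k J b) = ∑ y ∈ Finset.range b, (J y).card) {x : ℕ}
    (hx : x < b) : coreDeg k (AffineGrothendieck.chainD k J (x + 1)) =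
      coreDeg k (AffineGrothendieck.chainD k J x) + (J x).card := by
  have step : ∀ y < b, coreDeg k (AffineGrothendieck.chainD k J (y + 1)) ≤
      coreDeg k (AffineGrothendieck.chainD k J y) + (J y).card := by
    intro y hy
    have := coreDeg_addW_le (IsCore.chainD k J y) (wordOf (J y))
    rwa [length_wordOf (hJ y hy), ← chainD_succ] at this
  have h1 : ∀ y ≤ b, coreDeg k (AffineGrothendieck.chainD k J y) ≤
      ∑ z ∈ Finset.range y, (J z).card := by
    intro y
    induction y with
    | zero => intro _; rw [chainD_zero, coreDeg_bot]; simp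
    | succ y ih =>
      intro hy
      rw [Finset.sum_range_succ]
      have := ih (by omega)
      have := step y hy
      omega
  have h2 : ∀ y, x + 1 ≤ y → y ≤ b → coreDeg k (AffineGrothendieck.chainD k J y) +
      ∑ z ∈ Finset.range (x + 1), (J z).card ≤
        coreDeg k (AffineGrothendieck.chainD k J (x + 1)) + ∑ z ∈ Finset.range y, (J z).card := by
    intro y hy
    induction y, hy using Nat.le_induction with
    | base => exact fun _ => le_rfl
    | succ y _ ih =>
      intro hy
      rw [Finset.sum_range_succ _ y]
      have := ih (by omega)
      have := step y hy
      omega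
  have h3 := h2 b hx le_rfl
  have h4 := h1 x hx.le
  have h5 := step x hx
  rw [Finset.sum_range_succ _ x] at h3
  omega

open Classical in
/-- The tableau of a sequence of sets of residues. -/
theorem exists_tableau (hg : IsCore (k + 1) g) {a : ℕ →₀ ℕ} (ha : a.degree = coreDeg k g)
    {J : ℕ → Finset (ZMod (k + 1))} (hJ : ∀ y < supBound a, J y ≠ Finset.univ)
    (hJa : ∀ y < supBound a, (J y).card = a y)
    (hJg : AffineGrothendieck.chainD k J (supBound a) = g) :
    ∃ T : SemistandardYoungTableau g, IsKTableau k T a ∧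
      ∀ y < supBound a, resSet k T y = J y := by
  have hmono := chainD_mono k J
  have hdeg : coreDeg k (AffineGrothendieck.chainD k J (supBound a)) =
      ∑ y ∈ Finset.range (supBound a), (J y).card := by
    rw [hJg, ← ha, degree_eq_sum_range]
    exact Finset.sum_congr rfl fun y hy => (hJa y (Finset.mem_range.1 hy)).symm
  have hex : ∀ c ∈ g, ∃ t, t < supBound a ∧ c ∈ AffineGrothendieck.chainD k J (t + 1) := by
    intro c hc
    rw [← hJg] at hc
    rcases hb : supBound a with _ | t
    · rw [hb, chainD_zero] at hc
      exact absurd hc (YoungDiagram.notMem_bot c)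
    · rw [hb] at hc
      exact ⟨t, Nat.lt_succ_self t, hc⟩
  -- The entry of a cell is the index of the strip that adds it. The value `0` outside `g` is the
  -- convention of `SemistandardYoungTableau`.
  let F : ℕ → ℕ → ℕ := fun p q => if h : (p, q) ∈ g then Nat.find (hex (p, q) h) else 0
  have hF1 : ∀ {p q}, (p, q) ∈ g → F p q < supBound a ∧
      (p, q) ∈ AffineGrothendieck.chainD k J (F p q + 1) := by
    intro p q h
    simp only [F, dif_pos h]
    exact Nat.find_spec (hex (p, q) h)
  have hF2 : ∀ {p q t}, (p, q) ∈ AffineGrothendieck.chainD k J t → t ≤ supBound a → F p q < t := by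
    intro p q t h ht
    have hpq : (p, q) ∈ g := by
      rw [← hJg]
      exact hmono ht h
    rcases t with _ | t
    · rw [chainD_zero] at h
      exact absurd h (YoungDiagram.notMem_bot _)
    · simp only [F, dif_pos hpq]
      exact Nat.lt_succ_of_le (Nat.find_min' (hex (p, q) hpq) ⟨ht, h⟩)
  have hstrip : ∀ {t p q}, t < supBound a → (p + 1, q) ∈ AffineGrothendieck.chainD k J (t + 1) →
      (p, q) ∈ AffineGrothendieck.chainD k J t := by
    intro t p q ht h
    rw [chainD_succ] at h
    exact (wordOf_isCD (hJ t ht)).isStrip_addW _ p q h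
  let T : SemistandardYoungTableau g :=
    { entry := F
      row_weak' := by
        intro i j1 j2 hj hm
        obtain ⟨h1, h2⟩ := hF1 hm
        exact Nat.lt_succ_iff.1 (hF2 (YoungDiagram.up_left_mem _ le_rfl hj.le h2) h1)
      col_strict' := by
        intro i1 i2 j hi hm
        obtain ⟨h1, h2⟩ := hF1 hm
        exact hF2 (hstrip h1 (YoungDiagram.up_left_mem _ hi le_rfl h2)) h1.le
      zeros' := fun h => dif_neg h }
  have hT : ∀ p q, T p q = F p q := fun _ _ => rfl
  have hres : ∀ y < supBound a, resSet k T y = J y := by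
    intro y hy
    have hd := coreDeg_chainD hJ hdeg hy
    ext i
    rw [mem_resSet]
    constructor
    · rintro ⟨p, q, hpq, rfl, rfl⟩
      rw [hT] at hy ⊢
      obtain ⟨h1, h2⟩ := hF1 hpq
      rw [chainD_succ] at h2
      rw [← mem_wordOf (hJ _ hy)]
      exact residue_mem_of_mem_addW h2 fun h3 => lt_irrefl _ (hF2 h3 h1.le)
    · intro hi
      rw [← mem_wordOf (hJ _ hy)] at hi
      obtain ⟨⟨p, q⟩, h1, h2, h3⟩ := exists_residue_of_coreDeg_addW (IsCore.chainD k J y)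
        (by rw [← chainD_succ, hd, length_wordOf (hJ _ hy)]) hi
      rw [← chainD_succ] at h1
      have h4 := hF2 h1 hy
      have hpq : (p, q) ∈ g := by
        rw [← hJg]
        exact hmono hy h1
      refine ⟨p, q, hpq, ?_, h3⟩
      rw [hT]
      by_contra hne
      exact h2 (hmono (show F p q + 1 ≤ y by omega) (hF1 hpq).2)
  refine ⟨T, ⟨ha, fun x => ?_⟩, hres⟩
  change (resSet k T x).card = a x
  by_cases hx : x < supBound a
  · rw [hres x hx, hJa x hx]
  · rw [eq_zero_of_supBound_le (not_lt.1 hx), Finset.card_eq_zero, Finset.eq_empty_iff_forall_notMem]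
    intro i hi
    obtain ⟨p, q, hpq, h1, -⟩ := mem_resSet.1 hi
    rw [hT] at h1
    have := (hF1 hpq).1
    omega

/-- The number of `k`-tableaux is a number of sequences of sets of residues. -/
theorem card_kTableau (hg : IsCore (k + 1) g) {a : ℕ →₀ ℕ} (ha : a.degree = coreDeg k g) :
    Nat.card {T : SemistandardYoungTableau g // IsKTableau k T a} =
      numSeq k ((List.range (supBound a)).reverse.map a) g := by
  classical
  rw [numSeq, ← Fintype.card_coe, ← Nat.card_eq_fintype_card]
  have hmem : ∀ T : {T : SemistandardYoungTableau g // IsKTableau k T a},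
      (List.range (supBound a)).reverse.map (resSet k T.1) ∈
        (seqs k ((List.range (supBound a)).reverse.map a)).filter fun s => addL k s ⊥ = g := by
    rintro ⟨T, hT⟩
    obtain ⟨h1, h2, -⟩ := hT.chain hg
    refine Finset.mem_filter.2 ⟨mem_seqs.2 ⟨?_, ?_⟩, h2⟩
    · rw [List.map_map]
      exact List.map_congr_left fun x _ => hT.2 x
    · intro I hI
      obtain ⟨y, hy, rfl⟩ := List.mem_map.1 hI
      rw [List.mem_reverse, List.mem_range] at hy
      exact h1 y hy
  refine Nat.card_congr (Equiv.ofBijective (fun T => ⟨_, hmem T⟩) ⟨?_, ?_⟩)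
  · rintro ⟨T, hT⟩ ⟨T', hT'⟩ h
    refine Subtype.ext (hT.eq_of_resSet_eq hg hT' fun y hy => ?_)
    refine List.map_inj_left.1 (congrArg Subtype.val h) y ?_
    rwa [List.mem_reverse, List.mem_range]
  · rintro ⟨s, hs⟩
    obtain ⟨h1, h2⟩ := Finset.mem_filter.1 hs
    obtain ⟨h3, h4⟩ := mem_seqs.1 h1
    have hlen : s.length = supBound a := by
      have := congrArg List.length h3
      simpa using this
    -- Sequences list the last set first, so the set of letter `y` is found at place `y` of the
    -- reversed list.
    have hsJ : s = (List.range (supBound a)).reverse.map fun y => s.reverse.getD y ∅ := by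
      rw [← List.reverse_inj, ← List.map_reverse, List.reverse_reverse]
      refine List.ext_getElem (by simp [hlen]) fun n hn _ => ?_
      rw [List.getElem_map, List.getElem_range, List.getD_eq_getElem _ _ hn]
    set J : ℕ → Finset (ZMod (k + 1)) := fun y => s.reverse.getD y ∅ with hJdef
    have hJ : ∀ y < supBound a, J y ≠ Finset.univ := by
      intro y hy
      refine h4 _ ?_
      rw [hsJ]
      exact List.mem_map.2 ⟨y, by rwa [List.mem_reverse, List.mem_range], rfl⟩
    have hJa : ∀ y < supBound a, (J y).card = a y := by
      intro y hy
      rw [hsJ, List.map_map] at h3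
      exact List.map_inj_left.1 h3 y (by rwa [List.mem_reverse, List.mem_range])
    obtain ⟨T, hT, hTJ⟩ := exists_tableau hg ha hJ hJa (by rw [chainD, ← hsJ, h2])
    refine ⟨⟨T, hT⟩, Subtype.ext ?_⟩
    change (List.range (supBound a)).reverse.map (resSet k T) = s
    rw [hsJ]
    refine List.map_congr_left fun y hy => ?_
    rw [List.mem_reverse, List.mem_range] at hy
    exact hTJ y hy

end Tableau

/-! ### Symmetric series -/

/-- The multiset of the nonzero exponents. -/
def parts (a : ℕ →₀ ℕ) : Multiset ℕ := a.support.val.map a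

theorem count_parts (a : ℕ →₀ ℕ) {v : ℕ} (hv : v ≠ 0) :
    (parts a).count v = (a.support.filter fun x => v = a x).card := by
  rw [parts, Multiset.count_map]
  rfl

/-- Over a nonzero value the fibres are finite and counted by `parts`. Over `0` both are countably
infinite, so permutations of the variables see only the multiset of nonzero exponents. -/
theorem nonempty_equiv_fiber {a b : ℕ →₀ ℕ} (h : parts a = parts b) (v : ℕ) :
    Nonempty ({x // a x = v} ≃ {x // b x = v}) := by
  classical
  by_cases hv : v = 0
  · subst hv
    have hinf : ∀ a : ℕ →₀ ℕ, Infinite {x // a x = 0} := by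
      intro a
      have h1 : ((a.support : Set ℕ)ᶜ).Infinite := a.support.finite_toSet.infinite_compl
      have h2 : ((a.support : Set ℕ)ᶜ) = {x | a x = 0} := by
        ext x
        simp
      rw [h2] at h1
      exact h1.to_subtype
    have := hinf a
    have := hinf b
    have := Denumerable.ofEncodableOfInfinite {x // a x = 0}
    have := Denumerable.ofEncodableOfInfinite {x // b x = 0}
    exact ⟨Denumerable.equiv₂ _ _⟩
  · have e : ∀ a : ℕ →₀ ℕ, Nonempty
        ({x // a x = v} ≃ {x // x ∈ a.support.filter fun x => v = a x}) := fun a =>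
      ⟨Equiv.subtypeEquivRight fun x => by
        simp only [Finset.mem_filter, Finsupp.mem_support_iff]
        constructor
        · rintro rfl
          exact ⟨hv, rfl⟩
        · exact fun h => h.2.symm⟩
    obtain ⟨e1⟩ := e a
    obtain ⟨e2⟩ := e b
    have hc := congrArg (Multiset.count v) h
    rw [count_parts a hv, count_parts b hv] at hc
    exact ⟨e1.trans ((Finset.equivOfCardEq hc).trans e2.symm)⟩

theorem exists_perm_of_parts_eq {a b : ℕ →₀ ℕ} (h : parts a = parts b) :
    ∃ s : Equiv.Perm ℕ, a.equivMapDomain s = b := by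
  have e : ∀ v, {x // a x = v} ≃ {x // b x = v} := fun v => (nonempty_equiv_fiber h v).some
  refine ⟨(Equiv.sigmaFiberEquiv a).symm.trans
    ((Equiv.sigmaCongrRight e).trans (Equiv.sigmaFiberEquiv b)), ?_⟩
  ext x
  rw [Finsupp.equivMapDomain_apply]
  exact ((e (b x)).symm ⟨x, rfl⟩).2

theorem parts_equivMapDomain (s : Equiv.Perm ℕ) (a : ℕ →₀ ℕ) :
    parts (a.equivMapDomain s) = parts a := by
  rw [parts, Finsupp.equivMapDomain, parts]
  simp only [Finset.map_val, Multiset.map_map]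
  refine Multiset.map_congr rfl fun x _ => ?_
  simp

theorem mem_symmSeries_iff {f : MvPowerSeries ℕ ℤ} : f ∈ symmSeries ↔
    ∀ a b : ℕ →₀ ℕ, parts a = parts b → MvPowerSeries.coeff a f = MvPowerSeries.coeff b f := by
  constructor
  · intro hf a b h
    obtain ⟨s, rfl⟩ := exists_perm_of_parts_eq h
    exact (hf s a).symm
  · intro h s a
    exact h _ _ (parts_equivMapDomain s a)

/-- The exponent of the monomial of a partition. -/
def expo (u : YoungDiagram) : ℕ →₀ ℕ :=
  Finsupp.onFinset (Finset.range (u.colLen 0)) u.rowLen fun i hi => by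
    rw [Finset.mem_range, ← YoungDiagram.mem_iff_lt_colLen, YoungDiagram.mem_iff_lt_rowLen]
    exact Nat.pos_of_ne_zero hi

@[simp] theorem expo_apply (u : YoungDiagram) (i : ℕ) : expo u i = u.rowLen i := rfl

theorem support_expo (u : YoungDiagram) : (expo u).support = Finset.range (u.colLen 0) := by
  ext i
  rw [Finsupp.mem_support_iff, expo_apply, Finset.mem_range, ← YoungDiagram.mem_iff_lt_colLen,
    YoungDiagram.mem_iff_lt_rowLen, Nat.pos_iff_ne_zero]

theorem parts_expo (u : YoungDiagram) : parts (expo u) = (u.rowLens : Multiset ℕ) := by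
  rw [parts, support_expo]
  rfl

theorem degree_expo (u : YoungDiagram) : (expo u).degree = u.card := by
  rw [Finsupp.degree_apply, support_expo, card_eq_sum_rowLen u le_rfl]
  rfl

theorem expo_injective : Function.Injective expo := fun u v h => by
  refine eq_of_bead_iff fun j => ?_
  simp only [bead, ← expo_apply, h]

theorem rowLens_injective {u v : YoungDiagram}
    (h : (u.rowLens : Multiset ℕ) = (v.rowLens : Multiset ℕ)) : u = v := by
  have h1 : u.rowLens = v.rowLens :=
    (Multiset.coe_eq_coe.1 h).eq_of_sortedGE u.rowLens_sorted v.rowLens_sorted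
  exact YoungDiagram.equivListRowLens.injective (Subtype.ext h1)

theorem exists_parts_eq (a : ℕ →₀ ℕ) : ∃ u : YoungDiagram, parts a = parts (expo u) := by
  set w := (parts a).sort (· ≥ ·) with hw
  have hs : w.SortedGE := by
    rw [List.sortedGE_iff_pairwise]
    exact (Multiset.pairwise_sort _ _).imp fun h => h
  have hpos : ∀ x ∈ w, 0 < x := by
    intro x hx
    rw [hw, Multiset.mem_sort, parts, Multiset.mem_map] at hx
    obtain ⟨i, hi, rfl⟩ := hx
    exact Nat.pos_of_ne_zero (Finsupp.mem_support_iff.1 hi)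
  refine ⟨YoungDiagram.ofRowLens w hs, ?_⟩
  rw [parts_expo, YoungDiagram.rowLens_ofRowLens_eq_self hpos, hw, Multiset.sort_eq]

theorem coeff_monomialSymm (u : YoungDiagram) (a : ℕ →₀ ℕ) :
    MvPowerSeries.coeff a (monomialSymm u) = if parts a = parts (expo u) then 1 else 0 := by
  rw [parts_expo]
  rfl

theorem coeff_eq_zero_of_mem_idealCompletion {k : ℕ} {f : MvPowerSeries ℕ ℤ}
    (hf : f ∈ idealCompletion k) (u : YoungDiagram) (hu : u.rowLen 0 ≤ k) :
    MvPowerSeries.coeff (expo u) f = 0 := by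
  have hc : IsClosed {f : MvPowerSeries ℕ ℤ | MvPowerSeries.coeff (expo u) f = 0} :=
    isClosed_eq (MvPowerSeries.WithPiTopology.continuous_coeff ℤ _) continuous_const
  refine closure_minimal ?_ hc hf
  intro g hg
  refine Submodule.span_induction (p := fun g _ => MvPowerSeries.coeff (expo u) g = 0) ?_ ?_ ?_ ?_ hg
  · rintro _ ⟨v, hv, rfl⟩
    rw [coeff_monomialSymm, if_neg]
    intro h
    rw [parts_expo, parts_expo] at h
    rw [rowLens_injective h] at hu
    omega
  · simp
  · intro x y _ _ hx hy
    rw [map_add, hx, hy, add_zero]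
  · intro z x _ hx
    rw [map_zsmul, hx, smul_zero]

/-- A symmetric series is the convergent sum of its `m_u`-components. Those with `u_1 ≤ k` vanish by
hypothesis, and the partial sums of the others lie in the span. -/
theorem mem_idealCompletion_of_coeff {k : ℕ} {f : MvPowerSeries ℕ ℤ} (hf : f ∈ symmSeries)
    (h : ∀ u : YoungDiagram, u.rowLen 0 ≤ k → MvPowerSeries.coeff (expo u) f = 0) :
    f ∈ idealCompletion k := by
  rw [mem_symmSeries_iff] at hf
  have hs : HasSum (fun u : {u : YoungDiagram // k < u.rowLen 0} =>
      MvPowerSeries.coeff (expo u.1) f • monomialSymm u.1) f := by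
    rw [MvPowerSeries.WithPiTopology.hasSum_iff_hasSum_coeff]
    intro a
    obtain ⟨u, hu⟩ := exists_parts_eq a
    simp only [map_zsmul, coeff_monomialSymm, smul_eq_mul]
    rw [hf a _ hu]
    by_cases hk : u.rowLen 0 ≤ k
    · rw [h u hk]
      convert hasSum_zero using 2 with v
      rw [if_neg, mul_zero]
      intro h1
      rw [hu, parts_expo, parts_expo] at h1
      have := rowLens_injective h1
      have := v.2
      subst u
      omega
    · have := hasSum_single (f := fun v : {u : YoungDiagram // k < u.rowLen 0} =>
        MvPowerSeries.coeff (expo v.1) f * if parts a = parts (expo v.1) then 1 else 0)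
        ⟨u, not_le.1 hk⟩ (by
          intro v hv
          rw [if_neg, mul_zero]
          intro h1
          rw [hu, parts_expo, parts_expo] at h1
          exact hv (Subtype.ext (rowLens_injective h1).symm))
      simpa [hu] using this
  refine mem_closure_of_tendsto hs (Filter.Eventually.of_forall fun s => ?_)
  exact Submodule.sum_mem _ fun v _ => Submodule.smul_mem _ _
    (Submodule.subset_span ⟨v.1, v.2, rfl⟩)

/-! ### Triangular systems -/

/-- Row `i` determines `c i` from the values at predecessors of `i`, so the solution is built and
shown unique by well-founded recursion. The sets `F i` only make the row sums finite. -/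
theorem existsUnique_triangular {ι : Type*} {r : ι → ι → Prop} (wf : WellFounded r)
    (A : ι → ι → ℤ) (F : ι → Finset ι) (hA : ∀ i j, A i j ≠ 0 → j ∈ F i) (hd : ∀ i, A i i = 1)
    (ht : ∀ i j, A i j ≠ 0 → j = i ∨ r j i) (b : ι → ℤ) :
    ∃! c : ι → ℤ, ∀ i, ∑ j ∈ F i, c j * A i j = b i := by
  classical
  have hsum : ∀ (c : ι → ℤ) (i : ι), ∑ j ∈ F i, c j * A i j =
      c i + ∑ j ∈ (F i).filter (fun j => r j i ∧ j ≠ i), c j * A i j := by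
    intro c i
    have hi : i ∈ F i := hA i i (by rw [hd]; exact one_ne_zero)
    rw [← Finset.add_sum_erase _ _ hi, hd, mul_one]
    congr 1
    symm
    refine Finset.sum_subset (fun j hj => ?_) fun j hj hj' => ?_
    · obtain ⟨h1, h2, h3⟩ := Finset.mem_filter.1 hj
      exact Finset.mem_erase.2 ⟨h3, h1⟩
    · obtain ⟨h1, h2⟩ := Finset.mem_erase.1 hj
      by_contra hne
      have := (ht i j (right_ne_zero_of_mul hne)).resolve_left h1
      exact hj' (Finset.mem_filter.2 ⟨h2, this, h1⟩)
  let G : (i : ι) → ((j : ι) → r j i → ℤ) → ℤ := fun i rec =>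
    b i - ∑ j ∈ ((F i).filter (fun j => r j i ∧ j ≠ i)).attach,
      rec j.1 (Finset.mem_filter.1 j.2).2.1 * A i j.1
  have hfix : ∀ i, wf.fix G i = b i - ∑ j ∈ (F i).filter (fun j => r j i ∧ j ≠ i),
      wf.fix G j * A i j := by
    intro i
    rw [wf.fix_eq]
    simp only [G]
    rw [Finset.sum_attach _ fun j => wf.fix G j * A i j]
  refine ⟨wf.fix G, fun i => ?_, fun c hc => ?_⟩
  · rw [hsum, hfix i]
    ring
  · funext i
    induction i using wf.induction with
    | _ i ih =>
      have h1 := hc i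
      rw [hsum] at h1
      have h2 : ∑ j ∈ (F i).filter (fun j => r j i ∧ j ≠ i), c j * A i j =
          ∑ j ∈ (F i).filter (fun j => r j i ∧ j ≠ i), wf.fix G j * A i j :=
        Finset.sum_congr rfl fun j hj => by rw [ih j (Finset.mem_filter.1 hj).2.1]
      rw [hfix i, ← h2]
      omega

/-! ### Coefficients of the affine Grothendieck polynomials -/

/-- The exponents, the last one first. -/
def expoList (a : ℕ →₀ ℕ) : List ℕ := (List.range (supBound a)).reverse.map a

theorem sum_expoList (a : ℕ →₀ ℕ) : (expoList a).sum = a.degree := by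
  rw [degree_eq_sum_range, expoList, List.map_reverse, List.sum_reverse]
  rfl

theorem mem_expoList {a : ℕ →₀ ℕ} {x : ℕ} (h : a x ≠ 0) : a x ∈ expoList a :=
  List.mem_map.2 ⟨x, by simpa using lt_supBound h, rfl⟩

theorem coe_filter_expoList (a : ℕ →₀ ℕ) :
    (((expoList a).filter (· ≠ 0) : List ℕ) : Multiset ℕ) = parts a := by
  have h1 : ((expoList a : List ℕ) : Multiset ℕ) =
      (Finset.range (supBound a)).val.map a := by
    rw [expoList, ← Multiset.map_coe, Multiset.coe_reverse]
    rfl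
  have h2 : (Finset.range (supBound a)).filter (fun x => a x ≠ 0) = a.support := by
    ext x
    simp only [Finset.mem_filter, Finset.mem_range, Finsupp.mem_support_iff]
    exact and_iff_right_of_imp lt_supBound
  rw [← Multiset.filter_coe, h1, Multiset.filter_map, parts, ← h2]
  rfl

section

variable {k : ℕ} [NeZero k]

theorem coefH_eq_of_parts {a b : ℕ →₀ ℕ} (h : parts a = parts b) (c : QState k) :
    coefH (expoList a) c = coefH (expoList b) c := by
  rw [← coefH_filter (expoList a), ← coefH_filter (expoList b)]
  refine coefH_perm ?_ c
  rw [← Multiset.coe_eq_coe, coe_filter_expoList, coe_filter_expoList, h]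

theorem exists_rep_coreOf (l : BoundedPartition k) : ∃ c : QState k, Rep c (coreOf k l) :=
  exists_rep (isCore_coreOf l)

theorem coeff_affineGrothendieck_eq {l : BoundedPartition k} {c : QState k}
    (h : Rep c (coreOf k l)) (a : ℕ →₀ ℕ) :
    MvPowerSeries.coeff a (affineGrothendieck k l) = coefH (expoList a) c :=
  coeff_affineGrothendieck h a

theorem affineGrothendieck_mem_symmSeries (l : BoundedPartition k) :
    affineGrothendieck k l ∈ symmSeries := by
  obtain ⟨c, hc⟩ := exists_rep_coreOf l
  rw [mem_symmSeries_iff]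
  intro a b h
  rw [coeff_affineGrothendieck_eq hc, coeff_affineGrothendieck_eq hc, coefH_eq_of_parts h]

theorem coeff_affineGrothendieck_of_lt (l : BoundedPartition k) {a : ℕ →₀ ℕ}
    (h : a.degree < l.size) : MvPowerSeries.coeff a (affineGrothendieck k l) = 0 := by
  obtain ⟨c, hc⟩ := exists_rep_coreOf l
  rw [coeff_affineGrothendieck_eq hc]
  refine coefH_eq_zero hc ?_
  rwa [sum_expoList, coreDeg_coreOf]

theorem coeff_affineGrothendieck_of_lt_apply (l : BoundedPartition k) {a : ℕ →₀ ℕ} {x : ℕ}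
    (h : k < a x) : MvPowerSeries.coeff a (affineGrothendieck k l) = 0 := by
  obtain ⟨c, hc⟩ := exists_rep_coreOf l
  rw [coeff_affineGrothendieck_eq hc]
  exact coefH_eq_zero_of_lt (mem_expoList (by omega)) h c

/-- The dual `k`-Schur function is the part of lowest degree. -/
theorem coeff_dualKSchur (l : BoundedPartition k) (a : ℕ →₀ ℕ) :
    MvPowerSeries.coeff a (dualKSchur k l) =
      if a.degree = l.size then MvPowerSeries.coeff a (affineGrothendieck k l) else 0 := by
  have h0 : MvPowerSeries.coeff a (dualKSchur k l) =
    (Nat.card {T : SemistandardYoungTableau (coreOf k l) // IsKTableau k T a} : ℤ) := rfl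
  rw [h0]
  split_ifs with h
  · obtain ⟨c, hc⟩ := exists_rep_coreOf l
    rw [coeff_affineGrothendieck_eq hc, coefH_eq_numSeq hc (by rw [sum_expoList, h,
      coreDeg_coreOf]), card_kTableau (isCore_coreOf l) (by rw [h, coreDeg_coreOf])]
    rfl
  · have : IsEmpty {T : SemistandardYoungTableau (coreOf k l) // IsKTableau k T a} := by
      refine ⟨fun T => h ?_⟩
      rw [T.2.1, ← coreDeg_coreOf]
      rfl
    rw [Nat.card_of_isEmpty, Nat.cast_zero]

theorem dualKSchur_mem_symmSeries (l : BoundedPartition k) : dualKSchur k l ∈ symmSeries := by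
  rw [mem_symmSeries_iff]
  intro a b h
  have hdeg : a.degree = b.degree := congrArg Multiset.sum h
  rw [coeff_dualKSchur, coeff_dualKSchur, hdeg,
    mem_symmSeries_iff.1 (affineGrothendieck_mem_symmSeries l) a b h]

/-- The relation of the triangular systems: `l` comes before `m`. -/
def lexRel (l m : BoundedPartition k) : Prop :=
  l.size < m.size ∨ l.size = m.size ∧ toLex m.1.rowLen < toLex l.1.rowLen

theorem finite_size_le (k d : ℕ) : {l : BoundedPartition k | l.size ≤ d}.Finite := by
  refine Set.Finite.of_injOn (f := fun l : BoundedPartition k => l.1.cells)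
    (t := ((Finset.range d ×ˢ Finset.range d).powerset : Finset (Finset (ℕ × ℕ)))) ?_ ?_
    (Finset.finite_toSet _)
  · intro l hl
    refine Finset.mem_coe.2 (Finset.mem_powerset.2 ?_)
    rintro ⟨p, q⟩ hc
    rw [YoungDiagram.mem_cells] at hc
    have hl' : l.1.card ≤ d := hl
    have h1 := YoungDiagram.mem_iff_lt_rowLen.1 hc
    have h2 := YoungDiagram.mem_iff_lt_colLen.1 hc
    rw [YoungDiagram.rowLen_eq_card] at h1
    rw [YoungDiagram.colLen_eq_card] at h2
    have h3 : (l.1.row p).card ≤ l.1.card := Finset.card_filter_le _ _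
    have h4 : (l.1.col q).card ≤ l.1.card := Finset.card_filter_le _ _
    rw [Finset.mem_product, Finset.mem_range, Finset.mem_range]
    exact ⟨by omega, by omega⟩
  · intro l _ m _ h
    exact Subtype.ext (YoungDiagram.ext h)

theorem wellFounded_lexRel : WellFounded (lexRel (k := k)) := by
  -- `N l` counts the partitions of the same size that are lexicographically larger than `l`. These
  -- are finitely many, and fewer for a predecessor.
  let N : BoundedPartition k → ℕ := fun l =>
    {m : BoundedPartition k | m.size = l.size ∧ toLex l.1.rowLen < toLex m.1.rowLen}.ncard
  refine Subrelation.wf (r := InvImage (Prod.Lex (· < ·) (· < ·)) fun l => (l.size, N l)) ?_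
    (InvImage.wf _ (WellFounded.prod_lex Nat.lt_wfRel.wf Nat.lt_wfRel.wf))
  intro l m h
  rcases h with h | ⟨h1, h2⟩
  · exact Prod.Lex.left _ _ h
  · refine Prod.lex_def.2 (Or.inr ⟨h1, ?_⟩)
    refine Set.ncard_lt_ncard ?_ ((finite_size_le k m.size).subset fun x hx => hx.1.le)
    refine ⟨fun x hx => ⟨hx.1.trans h1, h2.trans hx.2⟩, fun hsub => ?_⟩
    exact lt_irrefl _ (hsub ⟨h1, h2⟩ : l ∈ {x : BoundedPartition k | _ ∧ _}).2

/-- `expoList` has the last exponent in front, while rows are peeled with the largest part acting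
last. Symmetry permits reversing the list. -/
theorem coeff_expo_triangular {l m : BoundedPartition k} (h : l.size = m.size) :
    (l = m → MvPowerSeries.coeff (expo m.1) (affineGrothendieck k l) = 1) ∧
      (MvPowerSeries.coeff (expo m.1) (affineGrothendieck k l) ≠ 0 →
        l = m ∨ toLex m.1.rowLen < toLex l.1.rowLen) := by
  obtain ⟨c, hc⟩ := exists_rep_coreOf l
  have hperm : (expoList (expo m.1)).Perm ((List.range (supBound (expo m.1))).map m.1.rowLen) := by
    rw [expoList, List.map_reverse]
    exact List.reverse_perm _
  have hsum : coreDeg k (coreOf k l) =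
      ((List.range (supBound (expo m.1))).map m.1.rowLen).sum := by
    rw [← hperm.sum_eq, sum_expoList, degree_expo, coreDeg_coreOf]
    exact h
  have hget : ∀ i, ((List.range (supBound (expo m.1))).map m.1.rowLen).getD i 0 = m.1.rowLen i := by
    intro i
    by_cases hi : i < supBound (expo m.1)
    · rw [List.getD_eq_getElem _ _ (by simpa using hi)]
      simp
    · rw [List.getD_eq_default _ _ (by simpa using hi)]
      exact (eq_zero_of_supBound_le (not_lt.1 hi)).symm
  obtain ⟨h1, h2⟩ := numSeq_triangular (isCore_coreOf l) hsum
  simp only [hget, boundedRows_coreOf] at h1 h2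
  rw [coeff_affineGrothendieck_eq hc, coefH_perm hperm, coefH_eq_numSeq hc hsum]
  constructor
  · rintro rfl
    rw [h1 fun i => rfl, Nat.cast_one]
  · intro hne
    rcases h2 (by exact_mod_cast hne) with h3 | h3
    · left
      refine Subtype.ext (expo_injective ?_)
      ext i
      exact (h3 i).symm
    · exact Or.inr h3

theorem coeff_expo_self (l : BoundedPartition k) :
    MvPowerSeries.coeff (expo l.1) (affineGrothendieck k l) = 1 := (coeff_expo_triangular rfl).1 rfl

theorem lexRel_of_coeff_ne_zero {l m : BoundedPartition k}
    (h : MvPowerSeries.coeff (expo m.1) (affineGrothendieck k l) ≠ 0) : l = m ∨ lexRel l m := by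
  rcases lt_trichotomy l.size m.size with h1 | h1 | h1
  · exact Or.inr (Or.inl h1)
  · exact ((coeff_expo_triangular h1).2 h).imp_right fun h2 => Or.inr ⟨h1, h2⟩
  · exact absurd (coeff_affineGrothendieck_of_lt l (by rw [degree_expo]; exact h1)) h

theorem coeff_dualKSchur_expo (l m : BoundedPartition k) :
    MvPowerSeries.coeff (expo m.1) (dualKSchur k l) =
      if m.size = l.size then MvPowerSeries.coeff (expo m.1) (affineGrothendieck k l) else 0 := by
  rw [coeff_dualKSchur, degree_expo]
  rfl

/-! ### Convergence and expansions -/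

/-- The partitions of size at most `d`. -/
def sizeFin (k d : ℕ) : Finset (BoundedPartition k) := (finite_size_le k d).toFinset

theorem mem_sizeFin {d : ℕ} {l : BoundedPartition k} : l ∈ sizeFin k d ↔ l.size ≤ d := by
  rw [sizeFin, Set.Finite.mem_toFinset]
  rfl

theorem hasSum_coeff_affineGrothendieck (c : BoundedPartition k → ℤ) (a : ℕ →₀ ℕ) :
    HasSum (fun l => MvPowerSeries.coeff a (c l • affineGrothendieck k l))
      (∑ l ∈ sizeFin k a.degree, c l * MvPowerSeries.coeff a (affineGrothendieck k l)) := by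
  simp only [map_zsmul, smul_eq_mul]
  refine hasSum_sum_of_ne_finset_zero fun l hl => ?_
  rw [mem_sizeFin, not_le] at hl
  rw [coeff_affineGrothendieck_of_lt l hl, mul_zero]

theorem order_affineGrothendieck (l : BoundedPartition k) :
    (affineGrothendieck k l).order = (l.size : ℕ∞) := by
  rw [MvPowerSeries.order_eq_nat]
  refine ⟨⟨expo l.1, ?_, degree_expo _⟩, fun a ha => coeff_affineGrothendieck_of_lt l ha⟩
  rw [coeff_expo_self]
  exact one_ne_zero

theorem homogeneousComponent_affineGrothendieck (l : BoundedPartition k) :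
    MvPowerSeries.homogeneousComponent l.size (affineGrothendieck k l) = dualKSchur k l := by
  ext a
  rw [MvPowerSeries.coeff_homogeneousComponent, coeff_dualKSchur]

/-- All series are symmetric, so coefficients at partitions suffice. If a part exceeds `k` they
vanish on both sides, and this makes the expansion exact rather than modulo the ideal. The
`k`-bounded partitions give a unitriangular system. -/
theorem exists_dualKSchur_expansion (l : BoundedPartition k) : ∃ d : BoundedPartition k → ℤ,
    HasSum (fun u : {u : BoundedPartition k // l.size < u.size} => d u.1 • dualKSchur k u.1)
      (affineGrothendieck k l - dualKSchur k l) := by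
  obtain ⟨d, hd, -⟩ := existsUnique_triangular (wellFounded_lexRel (k := k))
    (fun m u => MvPowerSeries.coeff (expo m.1) (dualKSchur k u)) (fun m => sizeFin k m.size)
    (fun m u h => by
      rw [coeff_dualKSchur_expo] at h
      rw [mem_sizeFin]
      by_contra hc
      exact h (if_neg (by omega)))
    (fun m => by rw [coeff_dualKSchur_expo, if_pos rfl, coeff_expo_self])
    (fun m u h => by
      rw [coeff_dualKSchur_expo] at h
      exact lexRel_of_coeff_ne_zero fun h0 => h (by rw [h0, ite_self]))
    (fun m => MvPowerSeries.coeff (expo m.1) (affineGrothendieck k l - dualKSchur k l))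
  refine ⟨d, ?_⟩
  rw [MvPowerSeries.WithPiTopology.hasSum_iff_hasSum_coeff]
  intro a
  obtain ⟨u, hu⟩ := exists_parts_eq a
  have hS := fun m : BoundedPartition k =>
    mem_symmSeries_iff.1 (dualKSchur_mem_symmSeries m) a _ hu
  have hG := mem_symmSeries_iff.1 (affineGrothendieck_mem_symmSeries l) a _ hu
  simp only [map_zsmul, map_sub, hS, hG, smul_eq_mul] at hd ⊢
  by_cases hk : u.rowLen 0 ≤ k
  · let m : BoundedPartition k := ⟨u, hk⟩
    have hdm := hd m
    have hS' := fun v : BoundedPartition k => coeff_dualKSchur_expo v m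
    change HasSum (fun v : {v : BoundedPartition k // l.size < v.size} =>
      d v.1 * MvPowerSeries.coeff (expo m.1) (dualKSchur k v.1))
      (MvPowerSeries.coeff (expo m.1) (affineGrothendieck k l) -
        MvPowerSeries.coeff (expo m.1) (dualKSchur k l))
    rcases le_or_gt m.size l.size with hs | hs
    · have e1 : MvPowerSeries.coeff (expo m.1) (affineGrothendieck k l) -
          MvPowerSeries.coeff (expo m.1) (dualKSchur k l) = 0 := by
        rw [hS']
        split_ifs with h
        · rw [sub_self]
        · rw [coeff_affineGrothendieck_of_lt l (by
            rw [degree_expo]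
            exact lt_of_le_of_ne hs h), sub_zero]
      rw [e1]
      convert hasSum_zero using 2 with v
      have := v.2
      rw [hS', if_neg (by omega), mul_zero]
    · have h1 : HasSum (fun v : BoundedPartition k =>
          d v * MvPowerSeries.coeff (expo m.1) (dualKSchur k v))
          (MvPowerSeries.coeff (expo m.1) (affineGrothendieck k l) -
            MvPowerSeries.coeff (expo m.1) (dualKSchur k l)) := by
        rw [← hdm]
        refine hasSum_sum_of_ne_finset_zero fun v hv => ?_
        rw [mem_sizeFin, not_le] at hv
        rw [hS', if_neg (by omega), mul_zero]
      -- By homogeneity only the `v` with the size of `m` contribute, and these are larger than `l`.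
      refine (hasSum_subtype_iff_of_support_subset (s := {v | l.size < v.size}) ?_).2 h1
      intro v hv
      by_contra hc
      have hc' : ¬ l.size < v.size := hc
      apply hv
      simp only
      rw [hS', if_neg (by omega), mul_zero]
  · have e1 : ∀ v : BoundedPartition k,
        MvPowerSeries.coeff (expo u) (affineGrothendieck k v) = 0 := fun v =>
      coeff_affineGrothendieck_of_lt_apply v (x := 0) (not_le.1 hk)
    have e2 : ∀ v : BoundedPartition k, MvPowerSeries.coeff (expo u) (dualKSchur k v) = 0 := by
      intro v
      rw [coeff_dualKSchur, e1, ite_self]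
    simp only [e1, e2, mul_zero, sub_zero]
    exact hasSum_zero

theorem summable_affineGrothendieck (c : BoundedPartition k → ℤ) :
    Summable fun l => c l • affineGrothendieck k l := by
  rw [MvPowerSeries.WithPiTopology.summable_iff_summable_coeff]
  exact fun a => (hasSum_coeff_affineGrothendieck c a).summable

/-- Congruence modulo the completed ideal is equality of the coefficients at `k`-bounded partitions,
which is exactly the triangular system for `c`. -/
theorem existsUnique_affineGrothendieck_expansion {f : MvPowerSeries ℕ ℤ} (hf : f ∈ symmSeries) :
    ∃! c : BoundedPartition k → ℤ, ∃ g : MvPowerSeries ℕ ℤ,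
      HasSum (fun l => c l • affineGrothendieck k l) g ∧ f - g ∈ idealCompletion k := by
  obtain ⟨c, hc, huniq⟩ := existsUnique_triangular (wellFounded_lexRel (k := k))
    (fun m u => MvPowerSeries.coeff (expo m.1) (affineGrothendieck k u))
    (fun m => sizeFin k (expo m.1).degree) (fun m u h => by
      rw [mem_sizeFin]
      by_contra hc
      exact h (coeff_affineGrothendieck_of_lt u (not_le.1 hc)))
    (fun m => coeff_expo_self m) (fun m u h => lexRel_of_coeff_ne_zero h)
    (fun m => MvPowerSeries.coeff (expo m.1) f)
  obtain ⟨g, hg⟩ := summable_affineGrothendieck c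
  have hco : ∀ (c : BoundedPartition k → ℤ) (g : MvPowerSeries ℕ ℤ),
      HasSum (fun l => c l • affineGrothendieck k l) g → ∀ a, MvPowerSeries.coeff a g =
        ∑ l ∈ sizeFin k a.degree, c l * MvPowerSeries.coeff a (affineGrothendieck k l) := by
    intro c g hg a
    rw [MvPowerSeries.WithPiTopology.hasSum_iff_hasSum_coeff] at hg
    exact (hg a).unique (hasSum_coeff_affineGrothendieck c a)
  refine ⟨c, ⟨g, hg, mem_idealCompletion_of_coeff (Submodule.sub_mem _ hf ?_) fun u hu => ?_⟩, ?_⟩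
  · rw [mem_symmSeries_iff]
    intro a b h
    rw [hco c g hg, hco c g hg, show a.degree = b.degree from congrArg Multiset.sum h]
    refine Finset.sum_congr rfl fun l _ => ?_
    rw [mem_symmSeries_iff.1 (affineGrothendieck_mem_symmSeries l) a b h]
  · rw [map_sub, hco c g hg, sub_eq_zero]
    exact (hc ⟨u, hu⟩).symm
  · rintro c' ⟨g', hg', hfg⟩
    refine huniq c' fun m => ?_
    have := coeff_eq_zero_of_mem_idealCompletion hfg m.1 m.2
    rw [map_sub, hco c' g' hg', sub_eq_zero] at this
    exact this.symm

end

end AffineGrothendieck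

end

theorem mainTheorem10 (k : ℕ) (hk : 0 < k) :
    -- the expansion in dual `k`-Schur functions, with integer coefficients
    (∃ a : AffineGrothendieck.BoundedPartition k → AffineGrothendieck.BoundedPartition k → ℤ,
      ∀ l : AffineGrothendieck.BoundedPartition k,
        ∃ r : MvPowerSeries ℕ ℤ,
          HasSum
            (fun u : {u : AffineGrothendieck.BoundedPartition k // l.size < u.size} =>
              a l u.1 • AffineGrothendieck.dualKSchur k u.1) r ∧
          AffineGrothendieck.affineGrothendieck k l = AffineGrothendieck.dualKSchur k l + r) ∧
    -- the part of lowest degree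
    (∀ l : AffineGrothendieck.BoundedPartition k,
      (AffineGrothendieck.affineGrothendieck k l).order = (l.size : ℕ∞) ∧
      MvPowerSeries.homogeneousComponent l.size (AffineGrothendieck.affineGrothendieck k l) =
        AffineGrothendieck.dualKSchur k l) ∧
    -- the basis of the (completed) quotient of the ring of symmetric functions
    (∀ l : AffineGrothendieck.BoundedPartition k,
      AffineGrothendieck.affineGrothendieck k l ∈ AffineGrothendieck.symmSeries) ∧
    (∀ c : AffineGrothendieck.BoundedPartition k → ℤ,
      Summable (fun l => c l • AffineGrothendieck.affineGrothendieck k l)) ∧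
    (∀ f ∈ AffineGrothendieck.symmSeries,
      ∃! c : AffineGrothendieck.BoundedPartition k → ℤ,
        ∃ g : MvPowerSeries ℕ ℤ,
          HasSum (fun l => c l • AffineGrothendieck.affineGrothendieck k l) g ∧
          f - g ∈ AffineGrothendieck.idealCompletion k) := by
  have : NeZero k := ⟨hk.ne'⟩
  refine ⟨?_, fun l => ⟨AffineGrothendieck.order_affineGrothendieck l,
    AffineGrothendieck.homogeneousComponent_affineGrothendieck l⟩,
    AffineGrothendieck.affineGrothendieck_mem_symmSeries,
    AffineGrothendieck.summable_affineGrothendieck,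
    fun f hf => AffineGrothendieck.existsUnique_affineGrothendieck_expansion hf⟩
  choose a ha using fun l : AffineGrothendieck.BoundedPartition k =>
    AffineGrothendieck.exists_dualKSchur_expansion l
  exact ⟨a, fun l => ⟨_, ha l, (add_sub_cancel _ _).symm⟩⟩
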